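/- Let $q$ be an odd prime power and let $r\ge 4$ be even. Let $A$ be an invertible symmetric $(r+1)\times(r+1)$ matrix over $\mathrm{GF}(q)$, and let $\mathcal Q(r,q)=\{\langle x\rangle : x^{T}Ax=0\}$ be the corresponding parabolic quadric of $\Sigma=\mathrm{PG}(r,q)$. Embed $\Sigma$ in $\mathrm{PG}(r,q^2)$. Let $\mathcal H(r,q^2)=\{\langle x\rangle : x^{T}A\,x^{(q)}=0\}$, where $x^{(q)}$ is obtained from $x$ by raising every coordinate to the $q$-th power; this is the non-degenerate Hermitian variety of $\mathrm{PG}(r,q^2)$ whose unitary polarity $\perp_h$ commutes with the orthogonal polarity $\perp$ of $A$ and satisfies $\perp\perp_h=\perp_h\perp=\tau$, where $\tau$ is the semilinear involution fixing $\Sigma$ pointwise. Let $G\cong\mathrm{PGO}(r+1,q)$ be the group of projectivities of $\Sigma$ stabilizing $\mathcal Q(r,q)$, that is, those induced by the invertible matrices $g$ over $\mathrm{GF}(q)$ with $g^{T}Ag=cA$ for some $c\in\mathrm{GF}(q)$, $c\ne 0$; consider $G$ as acting on $\mathrm{PG}(r,q^2)$. An extended line of $\Sigma$ is the line of $\mathrm{PG}(r,q^2)$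 spanned by a line of $\Sigma$. Put $\theta_{n,s}=s^n+\dots+s+1$. A set $\mathcal X$ of points of $\mathcal H(r,q^2)$ is called $i$-tight if, for every point $P$ of $\mathcal H(r,q^2)$, $$|P^{\perp_h}\cap\mathcal X|=\begin{cases} i\,\theta_{\frac{r-4}{2},q^2}+q^{r-2} & \text{if } P\in\mathcal X,\\ i\,\theta_{\frac{r-4}{2},q^2} & \text{if } P\notin\mathcal X.\end{cases}$$ Theorem. The group $G$ has exactly four orbits on the points of $\mathcal H(r,q^2)$: (1) $\mathcal Q(r,q)$; (2) $\mathcal O$, the points not in $\Sigma$ on the extended lines of $\Sigma$ contained in $\mathcal Q(r,q)$; (3) $\mathcal E$, the points of $\mathcal H(r,q^2)$ on the extended lines of $\Sigma$ having no point in common with $\mathcal Q(r,q)$; (4) $\mathcal S$, the points of $\mathcal H(r,q^2)\setminus\mathcal Q(r,q)$ on the extended lines of $\Sigma$ having exactly two points in common with $\mathcal Q(r,q)$. Each of $\mathcal Q(r,q)$, $\mathcal O$, $\mathcal E$, $\mathcal S$ is an $i$-tight set of $\mathcal H(r,q^2)$, with parameter $i=q+1$, $q^{r-1}-q$, $\frac{q^{r+1}-q^{r-1}}{2}$,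 $\frac{q^{r+1}-q^{r-1}}{2}$, respectively. -/

import Mathlib

open scoped LinearAlgebra.Projectivization MatrixGroups

noncomputable section

namespace HermTight

/-- `θ_{n,q} = q ^ n + ⋯ + q + 1`, the number of points of an `n`-dimensional projective space
over the field with `q` elements. -/
def theta (n q : ℕ) : ℕ := ∑ j ∈ Finset.range (n + 1), q ^ j

section

variable {F : Type*} [Field F] {r : ℕ}

/-- The points of the quadric of `PG(r, F)` with symmetric Gram matrix `A`. -/
def quadric (A : Matrix (Fin (r + 1)) (Fin (r + 1)) F) : Set (ℙ F (Fin (r + 1) → F)) :=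
  {P | P.rep ⬝ᵥ A.mulVec P.rep = 0}

/-- The similitudes of the form with Gram matrix `A`: invertible linear maps that multiply the
form by a nonzero scalar. Modulo scalars, this is the group `PGO`. -/
def similitudes (A : Matrix (Fin (r + 1)) (Fin (r + 1)) F) : Subgroup (GL (Fin (r + 1)) F) where
  carrier := {g | ∃ c : F, c ≠ 0 ∧ g.val.transpose * A * g.val = c • A}
  one_mem' := ⟨1, one_ne_zero, by simp⟩
  mul_mem' := by
    rintro g h ⟨c, hc, hg⟩ ⟨d, hd, hh⟩
    refine ⟨c * d, mul_ne_zero hc hd, ?_⟩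
    calc (g * h).val.transpose * A * (g * h).val
        = h.val.transpose * (g.val.transpose * A * g.val) * h.val := by
          simp only [Units.val_mul, Matrix.transpose_mul, Matrix.mul_assoc]
      _ = (c * d) • A := by
          rw [hg, Matrix.mul_smul, Matrix.smul_mul, hh, smul_smul]
  inv_mem' := by
    rintro g ⟨c, hc, hg⟩
    refine ⟨c⁻¹, inv_ne_zero hc, ?_⟩
    have h1 : g.val * (g⁻¹).val = 1 := by rw [← Units.val_mul]; simp
    have h2 : (g⁻¹).val.transpose * g.val.transpose = 1 := by
      rw [← Matrix.transpose_mul, h1, Matrix.transpose_one]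
    have h3 : A = c • ((g⁻¹).val.transpose * A * (g⁻¹).val) := by
      calc A = ((g⁻¹).val.transpose * g.val.transpose) * A * (g.val * (g⁻¹).val) := by
            rw [h1, h2, Matrix.one_mul, Matrix.mul_one]
        _ = (g⁻¹).val.transpose * (g.val.transpose * A * g.val) * (g⁻¹).val := by
            simp only [Matrix.mul_assoc]
        _ = _ := by rw [hg, Matrix.mul_smul, Matrix.smul_mul]
    conv_rhs => rw [h3]
    rw [smul_smul, inv_mul_cancel₀ hc, one_smul]

/-- The points of `PG(r, F)` on the quadric that lie on the subspace `l`. -/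
def quadricOn (A : Matrix (Fin (r + 1)) (Fin (r + 1)) F) (l : Submodule F (Fin (r + 1) → F)) :
    Set (ℙ F (Fin (r + 1) → F)) :=
  {P | P ∈ quadric A ∧ P.submodule ≤ l}

/-- A line of `PG(r, F)` (a vector subspace of dimension two) contained in the quadric. -/
def IsLineOfQuadric (A : Matrix (Fin (r + 1)) (Fin (r + 1)) F)
    (l : Submodule F (Fin (r + 1) → F)) : Prop :=
  Module.finrank F l = 2 ∧ ∀ P : ℙ F (Fin (r + 1) → F), P.submodule ≤ l → P ∈ quadric A

/-- A line of `PG(r, F)` having no point in common with the quadric. -/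
def IsExternalLine (A : Matrix (Fin (r + 1)) (Fin (r + 1)) F)
    (l : Submodule F (Fin (r + 1) → F)) : Prop :=
  Module.finrank F l = 2 ∧ quadricOn A l = ∅

/-- A line of `PG(r, F)` having exactly two points in common with the quadric. -/
def IsSecantLine (A : Matrix (Fin (r + 1)) (Fin (r + 1)) F)
    (l : Submodule F (Fin (r + 1) → F)) : Prop :=
  Module.finrank F l = 2 ∧ (quadricOn A l).ncard = 2

end

section

variable {F : Type*} (K : Type*) [Field F] [Field K] [Algebra F K] {r : ℕ}

/-- The inclusion `F ^ (r + 1) → K ^ (r + 1)`, as a semilinear map. -/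
def incl (F K : Type*) [Field F] [Field K] [Algebra F K] (r : ℕ) :
    (Fin (r + 1) → F) →ₛₗ[algebraMap F K] (Fin (r + 1) → K) where
  toFun v := fun i => algebraMap F K (v i)
  map_add' _ _ := by ext i; simp
  map_smul' _ _ := by ext i; simp

theorem incl_injective (F K : Type*) [Field F] [Field K] [Algebra F K] (r : ℕ) :
    Function.Injective (incl F K r) := fun _ _ h =>
  funext fun i => (algebraMap F K).injective (congrFun h i)

/-- The embedding of `Σ = PG(r, F)` in `PG(r, K)`. -/
def embed : ℙ F (Fin (r + 1) → F) → ℙ K (Fin (r + 1) → K) :=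
  Projectivization.map (incl F K r) (incl_injective F K r)

/-- The extension over `K` of a subspace of `PG(r, F)`. -/
def extend (l : Submodule F (Fin (r + 1) → F)) : Submodule K (Fin (r + 1) → K) :=
  Submodule.span K (incl F K r '' l)

/-- The Hermitian form `h(x, y) = ∑ A i j * x i * (y j) ^ q`, where `q = |F|`. When `A` is the
Gram matrix over `F` of the orthogonal polarity `⊥`, this is the Hermitian form, unique up to a
scalar, whose unitary polarity `⊥ₕ` satisfies `⊥ ⊥ₕ = ⊥ₕ ⊥ = τ`, with `τ` the involution induced
by `x ↦ x ^ q` on coordinates. -/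
def herm (A : Matrix (Fin (r + 1)) (Fin (r + 1)) F) (x y : Fin (r + 1) → K) : K :=
  x ⬝ᵥ (A.map (algebraMap F K)).mulVec (fun j => y j ^ Nat.card F)

/-- The points of the Hermitian variety `H(r, q²)`. -/
def hermVariety (A : Matrix (Fin (r + 1)) (Fin (r + 1)) F) : Set (ℙ K (Fin (r + 1) → K)) :=
  {P | herm K A P.rep P.rep = 0}

/-- The points of the polar hyperplane of `P` with respect to the unitary polarity `⊥ₕ`. -/
def hermPerp (A : Matrix (Fin (r + 1)) (Fin (r + 1)) F) (P : ℙ K (Fin (r + 1) → K)) :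
    Set (ℙ K (Fin (r + 1) → K)) :=
  {R | herm K A R.rep P.rep = 0}

/-- `X` is an `i`-tight set of `H(r, q²)`, `r ≥ 4` even, where `q = |F|`. -/
def IsTight (A : Matrix (Fin (r + 1)) (Fin (r + 1)) F) (i : ℕ)
    (X : Set (ℙ K (Fin (r + 1) → K))) : Prop :=
  X ⊆ hermVariety K A ∧
    ∀ P ∈ hermVariety K A,
      (P ∈ X → (hermPerp K A P ∩ X).ncard =
        i * theta ((r - 4) / 2) (Nat.card F ^ 2) + Nat.card F ^ (r - 2)) ∧
      (P ∉ X → (hermPerp K A P ∩ X).ncard = i * theta ((r - 4) / 2) (Nat.card F ^ 2))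

/-- The group `G ≅ PGO(r + 1, q)` of projectivities of `Σ` stabilizing `Q(r, q)`, considered as a
group of projectivities of `PG(r, K)`. -/
def groupG (A : Matrix (Fin (r + 1)) (Fin (r + 1)) F) : Subgroup PGL(Fin (r + 1), K) :=
  (similitudes A).map
    (Matrix.ProjGenLinGroup.mk.comp (Matrix.GeneralLinearGroup.map (algebraMap F K)))

/-- `Q(r, q)` as a set of points of `PG(r, K)`. -/
def setQ (A : Matrix (Fin (r + 1)) (Fin (r + 1)) F) : Set (ℙ K (Fin (r + 1) → K)) :=
  embed K '' quadric A

/-- The points, not in `Σ`, on the extended lines of `Q(r, q)`. -/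
def setO (A : Matrix (Fin (r + 1)) (Fin (r + 1)) F) : Set (ℙ K (Fin (r + 1) → K)) :=
  {P | P ∉ Set.range (embed (F := F) K) ∧
    ∃ l, IsLineOfQuadric A l ∧ P.submodule ≤ extend K l}

/-- The points of `H(r, q²)` on the extended lines of `Σ` external to `Q(r, q)`. -/
def setE (A : Matrix (Fin (r + 1)) (Fin (r + 1)) F) : Set (ℙ K (Fin (r + 1) → K)) :=
  {P | P ∈ hermVariety K A ∧ ∃ l, IsExternalLine A l ∧ P.submodule ≤ extend K l}

/-- The points of `H(r, q²)`, not in `Q(r, q)`, on the extended lines of `Σ` secant to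
`Q(r, q)`. -/
def setS (A : Matrix (Fin (r + 1)) (Fin (r + 1)) F) : Set (ℙ K (Fin (r + 1) → K)) :=
  {P | P ∈ hermVariety K A ∧ P ∉ setQ K A ∧ ∃ l, IsSecantLine A l ∧ P.submodule ≤ extend K l}

end

end HermTight

end

/-! Write `B` for the form of `A`, over `F` and extended `K`-bilinearly, and `h` for the Hermitian
form. Fix `δ` in `K` with `δ² = d` in `F` and `δ^q = -δ`, so that every vector over `K` is `Z = x +
δ y` with `x, y` over `F`. Then `h(Z, Z) = B(x, x) - d B(y, y)` and `B(Z, Z) = B(x, x) + d B(y, y) +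
2 δ B(x, y)`. Hence for isotropic `Z` the value `B(Z, Z)` determines the Gram matrix of `(x, y)`,
and Witt's theorem turns this invariant into a classification.

If `B(Z, Z) = 0`, then `x` and `y` are singular and orthogonal: either `Z` is a multiple of a vector
over `F` (the points of `Q`), or `x, y` span a line of the quadric (`O`). If `B(Z, Z) ≠ 0`, scaling
`Z` multiplies it by a square of `K`, and a similitude multiplies it by an element of `F`, which is
again a square in `K`. So only the square class of `2 δ B(Z, Z)` is left; it is a square exactly
when the plane of `x, y` contains a nonzero singular vector. This separates `S` from `E` (`setO_eq`,
`setE_eq`, `setS_eq`), and transitivity on each class follows from `exists_isometry_pair` and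
`exists_isometry_of_singular_pair`.

Tightness needs only one intersection number computed by hand. For a class `j`, let the excess at a
point be the number of vectors of the class orthogonal to it, minus the number required by
tightness. It is constant on each orbit, so it is a `4 × 4` matrix `ε i j`. Three facts force it to
vanish. The sizes of the classes being right, the excess sums to zero over every generator, by
double counting (`sum_excess_generator`). Counting orthogonal pairs between two classes makes `ε`
symmetric up to the sizes of the classes (`card_mul_excess`). Finally there are generators with
points only in `Q` and `O`, and others with points only in `Q`, `O` and one of `E`, `S`
(`exists_mixed_isGenerator`). Thus `ε 0 j = 0` implies that column `j` vanishes. The direct count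
`card_vecQ_perp` gives `ε 0 0 = 0`, so column `0` vanishes; by symmetry row `0` vanishes, and then
so does every column. -/

noncomputable section

namespace HermTight

/-! ### Reflections, Witt's theorem and Witt decompositions. -/

section Orthogonal

variable {F V : Type*} [Field F] [AddCommGroup V] [Module F V]

/-- The reflection in a vector of nonzero norm, as a linear isometry. -/
theorem exists_reflection (B : LinearMap.BilinForm F V) (hs : ∀ x y, B x y = B y x)
    (a : V) (ha : B a a ≠ 0) :
    ∃ g : V ≃ₗ[F] V, (∀ x y, B (g x) (g y) = B x y) ∧
      ∀ x, g x = x - (2 * B x a / B a a) • a := by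
  let s : V →ₗ[F] V := LinearMap.id - (2 / B a a) • (B a).smulRight a
  have hs' : ∀ x, s x = x - (2 * B x a / B a a) • a := fun x => by
    simp only [s, LinearMap.sub_apply, LinearMap.id_apply, LinearMap.smul_apply,
      LinearMap.smulRight_apply, smul_smul, hs a x]
    congr 2; ring
  have hinv : Function.Involutive s := fun x => by
    rw [hs' (s x), hs' x]
    simp only [map_sub, map_smul, LinearMap.sub_apply, LinearMap.smul_apply, smul_eq_mul]
    rw [sub_sub, ← add_smul]
    have : 2 * B x a / B a a + 2 * (B x a - 2 * B x a / B a a * B a a) / B a a = 0 := by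
      field_simp; ring
    rw [this, zero_smul, sub_zero]
  refine ⟨LinearEquiv.ofInvolutive s hinv, fun x y => ?_, hs'⟩
  change B (s x) (s y) = B x y
  rw [hs' x, hs' y]
  simp only [map_sub, map_smul, LinearMap.sub_apply, LinearMap.smul_apply, smul_eq_mul]
  rw [hs a y]
  field_simp; ring

/-- Two vectors of the same nonzero norm are related by an isometry that fixes all vectors
orthogonal to both. -/
theorem exists_isometry_of_norm_eq (h2 : (2 : F) ≠ 0) (B : LinearMap.BilinForm F V)
    (hs : ∀ x y, B x y = B y x) (u v : V) (hu : B u u ≠ 0) (huv : B u u = B v v) :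
    ∃ g : V ≃ₗ[F] V, (∀ x y, B (g x) (g y) = B x y) ∧ g u = v ∧
      ∀ w, B w u = 0 → B w v = 0 → g w = w := by
  -- The reflection in `u - v` sends `u` to `v` if that vector is nonsingular. Otherwise `u + v` is
  -- nonsingular, because the norms of `u - v` and `u + v` add up to `4 B(u, u)`; the reflection in
  -- `u + v` sends `u` to `-v`, and the one in `v` corrects the sign.
  by_cases h : B (u - v) (u - v) = 0
  · have hp : B (u + v) (u + v) ≠ 0 := by
      intro h'
      simp only [map_sub, map_add, LinearMap.sub_apply, LinearMap.add_apply] at h h'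
      apply hu
      have : (2 * 2) * B u u = 0 := by linear_combination h + h' + 2 * huv
      simpa [h2] using this
    obtain ⟨g, hg, hgx⟩ := exists_reflection B hs (u + v) hp
    obtain ⟨k, hk, hkx⟩ := exists_reflection B hs v (huv ▸ hu)
    have e1 : g u = -v := by
      rw [hgx]
      have : 2 * B u (u + v) / B (u + v) (u + v) = 1 := by
        rw [div_eq_one_iff_eq hp]
        simp only [map_add, LinearMap.add_apply]
        linear_combination hs u v + huv
      rw [this]; module
    have e2 : k (-v) = v := by
      have hv : B v v ≠ 0 := huv ▸ hu
      rw [hkx]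
      have : 2 * B (-v) v / B v v = -2 := by
        simp only [map_neg, LinearMap.neg_apply]
        field_simp
      rw [this]; module
    refine ⟨g.trans k, fun x y => by simp [hk, hg], by simp [e1, e2], fun w h1 h3 => ?_⟩
    have : g w = w := by rw [hgx]; simp [h1, h3]
    simp [this, hkx, h3]
  · obtain ⟨g, hg, hgx⟩ := exists_reflection B hs (u - v) h
    refine ⟨g, hg, ?_, fun w h1 h3 => by rw [hgx]; simp [h1, h3]⟩
    rw [hgx]
    have : 2 * B u (u - v) / B (u - v) (u - v) = 1 := by
      rw [div_eq_one_iff_eq h]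
      simp only [map_sub, LinearMap.sub_apply]
      linear_combination huv - hs u v
    rw [this]; module

/-- Witt's theorem for orthogonal families of vectors of nonzero norm. -/
theorem exists_isometry_of_orthogonal (h2 : (2 : F) ≠ 0) (B : LinearMap.BilinForm F V)
    (hs : ∀ x y, B x y = B y x) (k : ℕ) (u v : Fin k → V)
    (hu : ∀ i j, i ≠ j → B (u i) (u j) = 0) (hv : ∀ i j, i ≠ j → B (v i) (v j) = 0)
    (hne : ∀ i, B (u i) (u i) ≠ 0) (huv : ∀ i, B (u i) (u i) = B (v i) (v i)) :
    ∃ g : V ≃ₗ[F] V, (∀ x y, B (g x) (g y) = B x y) ∧ ∀ i, g (u i) = v i := by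
  induction k with
  | zero => exact ⟨LinearEquiv.refl F V, fun _ _ => rfl, fun i => i.elim0⟩
  | succ k ih =>
    obtain ⟨g, hg, hgu⟩ := ih (fun i => u i.castSucc) (fun i => v i.castSucc)
      (fun i j hij => hu _ _ (by simpa using hij)) (fun i j hij => hv _ _ (by simpa using hij))
      (fun i => hne _) (fun i => huv _)
    -- The image of the last `u` and the last `v` are both orthogonal to the earlier `v i`, so the
    -- correcting isometry `s` does not disturb what has been achieved.
    obtain ⟨s, hs1, hs2, hs3⟩ := exists_isometry_of_norm_eq h2 B hs (g (u (Fin.last k)))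
      (v (Fin.last k)) (by rw [hg]; exact hne _) (by rw [hg]; exact huv _)
    refine ⟨g.trans s, fun x y => by simp [hs1, hg], fun i => ?_⟩
    refine Fin.lastCases (by simpa using hs2) (fun i => ?_) i
    simp only [LinearEquiv.trans_apply]
    rw [hgu]
    refine hs3 _ ?_ (hv _ _ (Fin.castSucc_lt_last i).ne)
    rw [← hgu, hg]
    exact hu _ _ (Fin.castSucc_lt_last i).ne

/-- Witt's theorem for bases of nondegenerate planes. -/
theorem exists_isometry_pair (h2 : (2 : F) ≠ 0) (B : LinearMap.BilinForm F V)
    (hs : ∀ x y, B x y = B y x) (x y x' y' : V) (hx : B x x = B x' x') (hy : B y y = B y' y')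
    (hxy : B x y = B x' y') (hd : B x x * B y y - B x y ^ 2 ≠ 0) :
    ∃ g : V ≃ₗ[F] V, (∀ x y, B (g x) (g y) = B x y) ∧ g x = x' ∧ g y = y' := by
  by_cases h : B y y = 0
  · have hxy0 : B x y ≠ 0 := by
      rintro h'; simp [h, h'] at hd
    -- Since `y` is singular, Gram–Schmidt cannot start from it. This `c` gives `x + c y` norm `1`,
    -- and the same `c` works for `x', y'` because the Gram matrices agree.
    let c : F := (1 - B x x) / (2 * B x y)
    have hc : B x x + 2 * c * B x y = 1 := by simp only [c]; field_simp; ring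
    have hyx : B y x = B x y := hs y x
    have hyx' : B y' x' = B x' y' := hs y' x'
    obtain ⟨g, hg, hgu⟩ := exists_isometry_of_orthogonal h2 B hs 2
      ![x + c • y, y - (B x y) • (x + c • y)] ![x' + c • y', y' - (B x' y') • (x' + c • y')]
      (by
        intro i j hij
        fin_cases i <;> fin_cases j <;>
          simp [hyx, h] at hij ⊢ <;> linear_combination (- B x y) * hc)
      (by
        intro i j hij
        fin_cases i <;> fin_cases j <;>
          simp [hyx', ← hy, ← hx, ← hxy, h] at hij ⊢ <;> linear_combination (- B x y) * hc)
      (by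
        intro i
        fin_cases i
        · have : B (x + c • y) (x + c • y) = 1 := by
            simp [hyx, h]; linear_combination hc
          simp only [Fin.zero_eta, Matrix.cons_val_zero, this]; exact one_ne_zero
        · have : B (y - (B x y) • (x + c • y)) (y - (B x y) • (x + c • y)) = - B x y ^ 2 := by
            simp [hyx, h]; linear_combination (B x y ^ 2) * hc
          simp only [Fin.mk_one, Matrix.cons_val_one, Matrix.cons_val_zero, this]
          exact neg_ne_zero.2 (pow_ne_zero 2 hxy0))
      (by
        intro i
        fin_cases i <;> simp [hyx, hyx', hx, hy, hxy])
    have e0 : g (x + c • y) = x' + c • y' := hgu 0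
    have e1 : g (y - (B x y) • (x + c • y)) = y' - (B x' y') • (x' + c • y') := hgu 1
    have ey : g y = y' := by
      rw [map_sub, map_smul, e0, hxy] at e1
      simpa using e1
    refine ⟨g, hg, ?_, ey⟩
    rw [map_add, map_smul, ey] at e0
    simpa using e0
  · have hyx : B y x = B x y := hs y x
    have hyx' : B y' x' = B x' y' := hs y' x'
    have h' : B y' y' ≠ 0 := hy ▸ h
    obtain ⟨g, hg, hgu⟩ := exists_isometry_of_orthogonal h2 B hs 2
      ![y, x - (B x y / B y y) • y] ![y', x' - (B x' y' / B y' y') • y']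
      (by
        intro i j hij
        fin_cases i <;> fin_cases j <;> simp [hyx] at hij ⊢ <;> field_simp <;> ring)
      (by
        intro i j hij
        fin_cases i <;> fin_cases j <;> simp [hyx'] at hij ⊢ <;> field_simp <;> ring)
      (by
        intro i
        fin_cases i
        · simpa using h
        · have : B (x - (B x y / B y y) • y) (x - (B x y / B y y) • y) =
              (B x x * B y y - B x y ^ 2) / B y y := by
            simp [hyx]; field_simp; ring
          simp only [Fin.mk_one, Matrix.cons_val_one, Matrix.cons_val_zero, this]
          exact div_ne_zero hd h)
      (by
        intro i
        fin_cases i <;> simp [hyx, hyx', hx, hy, hxy])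
    have e0 : g y = y' := hgu 0
    have e1 : g (x - (B x y / B y y) • y) = x' - (B x' y' / B y' y') • y' := hgu 1
    refine ⟨g, hg, ?_, e0⟩
    rw [map_sub, map_smul, e0, hxy, hy] at e1
    simpa using e1

/-- A nondegenerate form has vectors with prescribed products with a linearly independent pair. -/
theorem exists_bilin_eq [FiniteDimensional F V] (B : LinearMap.BilinForm F V)
    (hs : ∀ x y, B x y = B y x) (hn : ∀ x, (∀ y, B x y = 0) → x = 0)
    {ι : Type*} (u : ι → V) (hu : LinearIndependent F u) (c : ι → F) :
    ∃ v, ∀ i, B (u i) v = c i := by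
  have hinj : Function.Injective B := by
    rw [injective_iff_map_eq_zero]
    intro x hx
    exact hn x fun y => by rw [hx]; rfl
  have hsurj : Function.Surjective B :=
    (LinearMap.injective_iff_surjective_of_finrank_eq_finrank
      (Subspace.dual_finrank_eq (K := F) (V := V)).symm).1 hinj
  let b := Module.Basis.span hu
  obtain ⟨φ, hφ⟩ := LinearMap.exists_extend (b.constr F c)
  obtain ⟨v, hv⟩ := hsurj φ
  refine ⟨v, fun i => ?_⟩
  rw [hs, hv]
  have h1 : φ (u i) = (φ ∘ₗ (Submodule.span F (Set.range u)).subtype) (b i) := by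
    simp [b, Module.Basis.span_apply]
  rw [h1, hφ, Module.Basis.constr_basis]

/-- A singular vector has a singular partner with which it spans a hyperbolic plane. -/
theorem exists_hyperbolic_partner [FiniteDimensional F V] (h2 : (2 : F) ≠ 0)
    (B : LinearMap.BilinForm F V)
    (hs : ∀ x y, B x y = B y x) (hn : ∀ x, (∀ y, B x y = 0) → x = 0) (e : V) (he : e ≠ 0)
    (hee : B e e = 0) : ∃ f, B e f = 1 ∧ B f f = 0 := by
  obtain ⟨v, hv⟩ := exists_bilin_eq B hs hn (fun _ : Unit => e)
    (linearIndependent_unique_iff.2 he) (fun _ => 1)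
  have hv := hv ()
  -- Subtracting a multiple of the singular vector `e` does not change the product with `e`, and
  -- this multiple cancels the norm of `v`.
  refine ⟨v - (B v v / 2) • e, by simp [hee, hv], ?_⟩
  have := hs v e
  simp only [map_sub, map_smul, LinearMap.sub_apply, LinearMap.smul_apply, smul_eq_mul, hee,
    this, hv]
  field_simp; ring

/-- Two linearly independent orthogonal singular vectors lie in the orthogonal sum of two
hyperbolic planes. -/
theorem exists_hyperbolic_partners [FiniteDimensional F V] (h2 : (2 : F) ≠ 0)
    (B : LinearMap.BilinForm F V)
    (hs : ∀ x y, B x y = B y x) (hn : ∀ x, (∀ y, B x y = 0) → x = 0) (x y : V)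
    (hi : LinearIndependent F ![x, y]) (hx : B x x = 0) (hy : B y y = 0) (hxy : B x y = 0) :
    ∃ x' y', B x x' = 1 ∧ B x y' = 0 ∧ B y x' = 0 ∧ B y y' = 1 ∧ B x' x' = 0 ∧ B y' y' = 0 ∧
      B x' y' = 0 := by
  obtain ⟨v, hv⟩ := exists_bilin_eq B hs hn _ hi ![1, 0]
  obtain ⟨w, hw⟩ := exists_bilin_eq B hs hn _ hi ![0, 1]
  have v0 : B x v = 1 := hv 0
  have v1 : B y v = 0 := hv 1
  have w0 : B x w = 0 := hw 0
  have w1 : B y w = 1 := hw 1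
  have hyx : B y x = 0 := by rw [hs, hxy]
  have v0' : B v x = 1 := by rw [hs, v0]
  have v1' : B v y = 0 := by rw [hs, v1]
  have w0' : B w x = 0 := by rw [hs, w0]
  have w1' : B w y = 1 := by rw [hs, w1]
  refine ⟨v - (B v v / 2) • x, w - (B v w) • x - (B w w / 2) • y, ?_, ?_, ?_, ?_, ?_, ?_, ?_⟩ <;>
    simp only [map_sub, map_smul, LinearMap.sub_apply, LinearMap.smul_apply, smul_eq_mul, hx, hy,
      hxy, hyx, v0, v1, w0, w1, v0', v1', w0', w1'] <;> field_simp <;> ring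

/-- Isometries act transitively on bases of totally singular planes. -/
theorem exists_isometry_of_singular_pair [FiniteDimensional F V] (h2 : (2 : F) ≠ 0)
    (B : LinearMap.BilinForm F V)
    (hs : ∀ x y, B x y = B y x) (hn : ∀ x, (∀ y, B x y = 0) → x = 0) (x y x' y' : V)
    (hi : LinearIndependent F ![x, y]) (hx : B x x = 0) (hy : B y y = 0) (hxy : B x y = 0)
    (hi' : LinearIndependent F ![x', y']) (hx' : B x' x' = 0) (hy' : B y' y' = 0)
    (hxy' : B x' y' = 0) :
    ∃ g : V ≃ₗ[F] V, (∀ x y, B (g x) (g y) = B x y) ∧ g x = x' ∧ g y = y' := by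
  obtain ⟨a, b, h1, h3, h4, h5, h6, h7, h8⟩ :=
    exists_hyperbolic_partners h2 B hs hn x y hi hx hy hxy
  obtain ⟨a', b', h1', h3', h4', h5', h6', h7', h8'⟩ :=
    exists_hyperbolic_partners h2 B hs hn x' y' hi' hx' hy' hxy'
  -- The vectors `x ± a`, `y ± b` form an orthogonal family with norms `±2`, which brings singular
  -- vectors within reach of Witt's theorem for orthogonal families.
  have key : ∀ x y a b : V, B x x = 0 → B y y = 0 → B x y = 0 → B x a = 1 → B x b = 0 →
      B y a = 0 → B y b = 1 → B a a = 0 → B b b = 0 → B a b = 0 →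
      (∀ i j : Fin 4, i ≠ j → B (![x + a, x - a, y + b, y - b] i)
        (![x + a, x - a, y + b, y - b] j) = 0) ∧
      ∀ i, B (![x + a, x - a, y + b, y - b] i) (![x + a, x - a, y + b, y - b] i) =
        ![2, -2, 2, -2] i := by
    intro x y a b h1 h2 h3 h4 h5 h6 h7 h8 h9 h10
    have h3' : B y x = 0 := by rw [hs, h3]
    have h4' : B a x = 1 := by rw [hs, h4]
    have h5' : B b x = 0 := by rw [hs, h5]
    have h6' : B a y = 0 := by rw [hs, h6]
    have h7' : B b y = 1 := by rw [hs, h7]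
    have h10' : B b a = 0 := by rw [hs, h10]
    constructor
    · intro i j hij
      fin_cases i <;> fin_cases j <;>
        first
        | exact absurd rfl hij
        | simp [h1, h2, h3, h4, h5, h6, h7, h8, h9, h10, h3', h4', h5', h6', h7', h10']
    · intro i
      fin_cases i <;>
        simp [h1, h2, h4, h7, h8, h9, h4', h7'] <;> ring
  obtain ⟨k1, k2⟩ := key x y a b hx hy hxy h1 h3 h4 h5 h6 h7 h8
  obtain ⟨k1', k2'⟩ := key x' y' a' b' hx' hy' hxy' h1' h3' h4' h5' h6' h7' h8'
  obtain ⟨g, hg, hgu⟩ := exists_isometry_of_orthogonal h2 B hs 4 _ _ k1 k1'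
    (fun i => by rw [k2]; fin_cases i <;> simp [h2]) (fun i => by rw [k2, k2'])
  have e0 : g (x + a) = x' + a' := hgu 0
  have e1 : g (x - a) = x' - a' := hgu 1
  have e2 : g (y + b) = y' + b' := hgu 2
  have e3 : g (y - b) = y' - b' := hgu 3
  have half : ∀ s t : V, (2 : F) • s = (2 : F) • t → s = t := fun s t h =>
    smul_right_injective V h2 h
  refine ⟨g, hg, half _ _ ?_, half _ _ ?_⟩
  · have : (2 : F) • g x = g (x + a) + g (x - a) := by rw [map_add, map_sub]; module
    rw [this, e0, e1]; module
  · have : (2 : F) • g y = g (y + b) + g (y - b) := by rw [map_add, map_sub]; module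
    rw [this, e2, e3]; module

/-- Vectors forming a Witt decomposition into hyperbolic planes `⟨e i, f i⟩` and a line `⟨g⟩`. -/
structure HypFrame {ι : Type*} [DecidableEq ι] (B : LinearMap.BilinForm F V) (e f : ι → V)
    (g : V) : Prop where
  ee : ∀ i j, B (e i) (e j) = 0
  ff : ∀ i j, B (f i) (f j) = 0
  ef : ∀ i j, B (e i) (f j) = if i = j then 1 else 0
  eg : ∀ i, B (e i) g = 0
  fg : ∀ i, B (f i) g = 0
  gg : B g g ≠ 0

/-- A nondegenerate symmetric form in at least three variables over a finite field of odd order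
has a nonzero singular vector. -/
theorem exists_singular [Finite F] [FiniteDimensional F V] (h2 : (2 : F) ≠ 0)
    (B : LinearMap.BilinForm F V)
    (hs : ∀ x y, B x y = B y x) (hn : ∀ x, (∀ y, B x y = 0) → x = 0)
    (h3 : 3 ≤ Module.finrank F V) : ∃ e, e ≠ 0 ∧ B e e = 0 := by
  classical
  have := Fintype.ofFinite F
  have : Invertible (2 : F) := invertibleOfNonzero h2
  obtain ⟨v, hv⟩ := LinearMap.BilinForm.exists_orthogonal_basis (B := B) ⟨hs⟩
  have hv' : ∀ i j, i ≠ j → B (v i) (v j) = 0 := fun i j hij => hv hij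
  let i0 : Fin (Module.finrank F V) := ⟨0, by omega⟩
  let i1 : Fin (Module.finrank F V) := ⟨1, by omega⟩
  let i2 : Fin (Module.finrank F V) := ⟨2, by omega⟩
  have h01 : i0 ≠ i1 := by simp [i0, i1]
  have h02 : i0 ≠ i2 := by simp [i0, i2]
  have h12 : i1 ≠ i2 := by simp [i1, i2]
  have hne : ∀ i, B (v i) (v i) ≠ 0 := by
    intro i hi
    refine v.ne_zero i (hn _ fun y => ?_)
    have : B (v i) = 0 := v.ext fun j => by
      by_cases hij : i = j
      · subst hij; simpa using hi
      · simpa using hv' i j hij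
    rw [this]; rfl
  have hodd : Fintype.card F % 2 = 1 :=
    FiniteField.odd_card_of_char_ne_two (fun h => h2 (by
      have := CharP.cast_eq_zero F (ringChar F); rw [h] at this; exact_mod_cast this))
  -- In an orthogonal basis, three coordinates suffice: two quadratic polynomials in one variable
  -- each take more than half of the values in `F`, so some pair of values sums to zero. The third
  -- coordinate is `1`, which makes the vector nonzero.
  obtain ⟨a, b, hab⟩ := FiniteField.exists_root_sum_quadratic
    (f := Polynomial.C (B (v i0) (v i0)) * Polynomial.X ^ 2 + Polynomial.C 0 * Polynomial.X
      + Polynomial.C 0)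
    (g := Polynomial.C (B (v i1) (v i1)) * Polynomial.X ^ 2 + Polynomial.C 0 * Polynomial.X
      + Polynomial.C (B (v i2) (v i2)))
    (Polynomial.degree_quadratic (hne i0)) (Polynomial.degree_quadratic (hne i1)) hodd
  refine ⟨a • v i0 + b • v i1 + v i2, ?_, ?_⟩
  · intro h
    have : (v.repr (a • v i0 + b • v i1 + v i2)) i2 = 0 := by rw [h]; simp
    simp [h02, h12] at this
  · simp at hab
    simp [hv' _ _ h01, hv' _ _ h02, hv' _ _ h12, hv' _ _ h01.symm, hv' _ _ h02.symm,
      hv' _ _ h12.symm]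
    linear_combination hab

end Orthogonal

/-- Every nondegenerate symmetric form in an odd number of variables over a finite field of odd
order has a Witt decomposition with an anisotropic part of dimension one. -/
theorem exists_hypFrame {F : Type*} [Field F] [Finite F] (h2 : (2 : F) ≠ 0) (m : ℕ) :
    ∀ {V : Type*} [AddCommGroup V] [Module F V] [FiniteDimensional F V]
      (B : LinearMap.BilinForm F V) (_ : ∀ x y, B x y = B y x)
      (_ : ∀ x, (∀ y, B x y = 0) → x = 0) (_ : Module.finrank F V = 2 * m + 1),
      ∃ (e f : Fin m → V) (g : V), HypFrame B e f g := by
  induction m with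
  | zero =>
    intro V _ _ _ B hs hn hd
    obtain ⟨g, hg, hgen⟩ := finrank_eq_one_iff'.1 hd
    refine ⟨Fin.elim0, Fin.elim0, g, ⟨fun i => i.elim0, fun i => i.elim0, fun i => i.elim0,
      fun i => i.elim0, fun i => i.elim0, fun h => hg (hn g fun y => ?_)⟩⟩
    obtain ⟨c, rfl⟩ := hgen y
    simp [h]
  | succ m ih =>
    intro V _ _ _ B hs hn hd
    obtain ⟨e0, he0, hee⟩ := exists_singular h2 B hs hn (by omega)
    obtain ⟨f0, hef, hff⟩ := exists_hyperbolic_partner h2 B hs hn e0 he0 hee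
    have hfe : B f0 e0 = 1 := by rw [hs, hef]
    let φ : V →ₗ[F] F × F := (B e0).prod (B f0)
    have hφ : Function.Surjective φ := fun ⟨a, b⟩ => ⟨b • e0 + a • f0, by
      simp [φ, hee, hff, hef, hfe]⟩
    let W := LinearMap.ker φ
    have hW : ∀ w : W, B e0 w = 0 ∧ B f0 w = 0 := fun w => by
      have := w.2
      simpa [W, φ] using this
    have hdW : Module.finrank F W = 2 * m + 1 := by
      have h := LinearMap.finrank_range_add_finrank_ker φ
      rw [LinearMap.range_eq_top.2 hφ, finrank_top, Module.finrank_prod, Module.finrank_self] at h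
      change _ + Module.finrank F W = _ at h
      omega
    -- `W` is the orthogonal complement of the hyperbolic plane. Every `y` differs from its
    -- projection to `W` by a combination of `e0` and `f0`, so a vector of `W` orthogonal to `W` is
    -- orthogonal to everything.
    obtain ⟨e, f, g, H⟩ := ih (B.restrict W) (fun x y => hs x y) (fun x hx => by
      refine Subtype.ext (hn x fun y => ?_)
      have hy : y - B f0 y • e0 - B e0 y • f0 ∈ W := by
        simp [W, φ, hee, hff, hef, hfe]
      have h := hx ⟨_, hy⟩
      have h1 := (hW x).1
      have h3 := (hW x).2
      rw [hs] at h1 h3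
      change B x (y - B f0 y • e0 - B e0 y • f0) = 0 at h
      simpa [h1, h3] using h) hdW
    refine ⟨Fin.cons e0 fun i => e i, Fin.cons f0 fun i => f i, g, ⟨?_, ?_, ?_, ?_, ?_, H.gg⟩⟩
    · intro i j
      refine Fin.cases ?_ (fun i => ?_) i <;> refine Fin.cases ?_ (fun j => ?_) j
      · exact hee
      · exact (hW (e j)).1
      · rw [hs]; exact (hW (e i)).1
      · exact H.ee i j
    · intro i j
      refine Fin.cases ?_ (fun i => ?_) i <;> refine Fin.cases ?_ (fun j => ?_) j
      · exact hff
      · exact (hW (f j)).2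
      · rw [hs]; exact (hW (f i)).2
      · exact H.ff i j
    · intro i j
      refine Fin.cases ?_ (fun i => ?_) i <;> refine Fin.cases ?_ (fun j => ?_) j
      · simpa using hef
      · simpa [Fin.succ_ne_zero, eq_comm] using (hW (f j)).1
      · rw [hs]; simpa [Fin.succ_ne_zero] using (hW (e i)).2
      · simpa using H.ef i j
    · intro i
      refine Fin.cases ?_ (fun i => ?_) i
      · exact (hW g).1
      · exact H.eg i
    · intro i
      refine Fin.cases ?_ (fun i => ?_) i
      · exact (hW g).2
      · exact H.fg i

/-! ### The quadratic extension and its Frobenius involution. -/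

section Frobenius

variable (F K : Type*) [Field F] [Field K] [Algebra F K] [Finite F]

/-- The Frobenius map `x ↦ x ^ |F|` of an algebra over the finite field `F`. -/
def frob : K →ₐ[F] K :=
  letI := Fintype.ofFinite F
  FiniteField.frobeniusAlgHom F K

variable {F K}

theorem frob_apply (x : K) : frob F K x = x ^ Nat.card F := by
  let := Fintype.ofFinite F
  rw [Nat.card_eq_fintype_card]
  rfl

variable (F K) in
/-- `K` is a quadratic extension of the finite field `F` of odd order, and `δ` is an element of
trace zero with square `d ∈ F`. -/
structure QuadExt (δ : K) (d : F) : Prop where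
  two_ne : (2 : F) ≠ 0
  card : Nat.card K = Nat.card F ^ 2
  sq : δ * δ = algebraMap F K d
  frob : frob F K δ = -δ
  d_ne : d ≠ 0

/-- Euler's criterion: `(q² - 1) / 2 = (q - 1) * ((q + 1) / 2)` is a multiple of `q - 1`. This is
what makes square classes of `K` insensitive to factors from `F`. -/
theorem isSquare_algebraMap [Finite K] (h2 : (2 : F) ≠ 0) (hK : Nat.card K = Nat.card F ^ 2)
    (a : F) : IsSquare (algebraMap F K a) := by
  classical
  let := Fintype.ofFinite F
  let := Fintype.ofFinite K
  by_cases ha : a = 0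
  · subst ha; exact ⟨0, by simp⟩
  have h2K : ringChar K ≠ 2 := fun h => h2 (by
    have h' := CharP.cast_eq_zero K (ringChar K)
    rw [h] at h'
    apply (algebraMap F K).injective
    rw [map_zero, ← h']
    exact map_ofNat _ 2)
  have h2F : ringChar F ≠ 2 := fun h => h2 (by
    have h' := CharP.cast_eq_zero F (ringChar F)
    rw [h] at h'
    exact_mod_cast h')
  have hodd : Fintype.card F % 2 = 1 := FiniteField.odd_card_of_char_ne_two h2F
  rw [FiniteField.isSquare_iff h2K (by simpa using ha), ← map_pow]
  rw [Nat.card_eq_fintype_card, Nat.card_eq_fintype_card] at hK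
  have h1 : 1 ≤ Fintype.card F := Fintype.card_pos
  have hexp : Fintype.card K / 2 = (Fintype.card F - 1) * ((Fintype.card F + 1) / 2) := by
    rw [hK]
    obtain ⟨k, hk⟩ : ∃ k, Fintype.card F = 2 * k + 1 := ⟨Fintype.card F / 2, by omega⟩
    rw [hk]
    have e1 : (2 * k + 1) ^ 2 = 2 * (2 * k * (k + 1)) + 1 := by ring
    have e2 : (2 * k + 1 + 1) / 2 = k + 1 := by omega
    rw [e1, e2]
    simp only [Nat.add_sub_cancel]
    omega
  rw [hexp, pow_mul, FiniteField.pow_card_sub_one_eq_one a ha, one_pow, map_one]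

/-- Let `δ` be a square root in `K` of a nonsquare `d` of `F`. Frobenius sends it to `δ` or `-δ`; if
it fixed `δ`, then `δ^(q - 1) = 1`, hence `d^((q - 1) / 2) = 1` and `d` would be a square in `F`. -/
theorem exists_quadExt [Finite K] (h2 : (2 : F) ≠ 0) (hK : Nat.card K = Nat.card F ^ 2) :
    ∃ (δ : K) (d : F), QuadExt F K δ d := by
  classical
  let := Fintype.ofFinite F
  have h2F : ringChar F ≠ 2 := fun h => h2 (by
    have h' := CharP.cast_eq_zero F (ringChar F)
    rw [h] at h'
    exact_mod_cast h')
  obtain ⟨d, hd⟩ := FiniteField.exists_nonsquare h2F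
  have hd0 : d ≠ 0 := by rintro rfl; exact hd ⟨0, by simp⟩
  obtain ⟨δ, hδ⟩ := isSquare_algebraMap (K := K) h2 hK d
  refine ⟨δ, d, h2, hK, hδ.symm, ?_, hd0⟩
  have h1 : frob F K δ * frob F K δ = δ * δ := by rw [← map_mul, ← hδ, AlgHom.commutes]
  rcases mul_self_eq_mul_self_iff.1 h1 with h | h
  · exfalso
    have hδ0 : δ ≠ 0 := by rintro rfl; exact hd0 (by simpa using hδ)
    have h3 : δ ^ (Fintype.card F - 1) = 1 := by
      rw [frob_apply, Nat.card_eq_fintype_card] at h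
      have : δ ^ (Fintype.card F - 1) * δ = 1 * δ := by
        rw [← pow_succ, Nat.sub_add_cancel Fintype.card_pos, h, one_mul]
      exact mul_right_cancel₀ hδ0 this
    have hodd : Fintype.card F % 2 = 1 := FiniteField.odd_card_of_char_ne_two h2F
    refine hd ((FiniteField.isSquare_iff h2F hd0).2 ((algebraMap F K).injective ?_))
    rw [map_pow, hδ, map_one, ← h3, ← pow_two, ← pow_mul]
    congr 1
    omega
  · exact h

namespace QuadExt

variable {δ : K} {d : F} (Δ : QuadExt F K δ d)
include Δ

theorem two_ne' : (2 : K) ≠ 0 := fun h => Δ.two_ne (by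
  apply (algebraMap F K).injective
  rw [map_zero, ← h]; exact map_ofNat _ 2)

theorem ne_zero : δ ≠ 0 := by
  rintro rfl
  exact Δ.d_ne (by simpa using Δ.sq.symm)

theorem frob_frob [Finite K] (x : K) : HermTight.frob F K (HermTight.frob F K x) = x := by
  let := Fintype.ofFinite K
  have h := FiniteField.pow_card x
  rw [frob_apply, frob_apply, ← pow_mul, ← pow_two, ← Δ.card, Nat.card_eq_fintype_card, h]

/-- Frobenius changes the sign of `δ`, so adding the conjugate equation leaves `2 a = 0`. -/
theorem eq_zero {a b : F} (h : algebraMap F K a + δ * algebraMap F K b = 0) : a = 0 ∧ b = 0 := by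
  have h' := congrArg (HermTight.frob F K) h
  simp only [map_add, map_mul, AlgHom.commutes, Δ.frob, map_zero] at h'
  have ha : algebraMap F K a = 0 := by
    have : 2 * algebraMap F K a = 0 := by linear_combination h + h'
    simpa [Δ.two_ne'] using this
  refine ⟨by simpa using ha, ?_⟩
  rw [ha, zero_add] at h
  simpa [Δ.ne_zero] using h

theorem ext {a b a' b' : F} (h : algebraMap F K a + δ * algebraMap F K b =
    algebraMap F K a' + δ * algebraMap F K b') : a = a' ∧ b = b' := by
  have := Δ.eq_zero (a := a - a') (b := b - b') (by
    simp only [map_sub]; linear_combination h)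
  exact ⟨sub_eq_zero.1 this.1, sub_eq_zero.1 this.2⟩

theorem bijective [Finite K] :
    Function.Bijective (fun p : F × F => algebraMap F K p.1 + δ * algebraMap F K p.2) := by
  let := Fintype.ofFinite F
  let := Fintype.ofFinite K
  rw [Fintype.bijective_iff_injective_and_card]
  refine ⟨fun p p' h => Prod.ext (Δ.ext h).1 (Δ.ext h).2, ?_⟩
  rw [Fintype.card_prod, ← Nat.card_eq_fintype_card (α := K), Δ.card, Nat.card_eq_fintype_card,
    pow_two]

theorem exists_eq [Finite K] (z : K) : ∃ a b : F, z = algebraMap F K a + δ * algebraMap F K b := by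
  obtain ⟨p, hp⟩ := Δ.bijective.2 z
  exact ⟨p.1, p.2, hp.symm⟩

end QuadExt

end Frobenius

/-! ### The bilinear and the Hermitian form in the coordinates `x + δ y`. -/

section Vectors

variable {F : Type*} (K : Type*) [Field F] [Field K] [Algebra F K] {r : ℕ}

/-- The symmetric bilinear form of a Gram matrix over `F`. -/
def formF (A : Matrix (Fin (r + 1)) (Fin (r + 1)) F) : LinearMap.BilinForm F (Fin (r + 1) → F) :=
  Matrix.toBilin' A

/-- The extension to `K` of the symmetric bilinear form of a Gram matrix over `F`. -/
def formK (A : Matrix (Fin (r + 1)) (Fin (r + 1)) F) : LinearMap.BilinForm K (Fin (r + 1) → K) :=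
  Matrix.toBilin' (A.map (algebraMap F K))

theorem formF_apply (A : Matrix (Fin (r + 1)) (Fin (r + 1)) F) (x y : Fin (r + 1) → F) :
    formF A x y = x ⬝ᵥ A.mulVec y := Matrix.toBilin'_apply' A x y

theorem formK_apply (A : Matrix (Fin (r + 1)) (Fin (r + 1)) F) (x y : Fin (r + 1) → K) :
    formK K A x y = x ⬝ᵥ (A.map (algebraMap F K)).mulVec y := Matrix.toBilin'_apply' _ x y

theorem formF_symm {A : Matrix (Fin (r + 1)) (Fin (r + 1)) F} (hA : A.IsSymm)
    (x y : Fin (r + 1) → F) : formF A x y = formF A y x := by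
  rw [formF_apply, formF_apply, Matrix.dotProduct_mulVec, dotProduct_comm,
    ← Matrix.mulVec_transpose, hA.eq]

theorem formK_symm {A : Matrix (Fin (r + 1)) (Fin (r + 1)) F} (hA : A.IsSymm)
    (x y : Fin (r + 1) → K) : formK K A x y = formK K A y x := by
  rw [formK_apply, formK_apply, Matrix.dotProduct_mulVec, dotProduct_comm,
    ← Matrix.mulVec_transpose, ← Matrix.transpose_map, hA.eq]

theorem formF_nondegenerate {A : Matrix (Fin (r + 1)) (Fin (r + 1)) F} (hdet : A.det ≠ 0)
    (x : Fin (r + 1) → F) (h : ∀ y, formF A x y = 0) : x = 0 :=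
  (Matrix.nondegenerate_of_det_ne_zero hdet).eq_zero_of_ortho fun y => by
    rw [← formF_apply]; exact h y

theorem formK_incl (A : Matrix (Fin (r + 1)) (Fin (r + 1)) F) (x y : Fin (r + 1) → F) :
    formK K A (incl F K r x) (incl F K r y) = algebraMap F K (formF A x y) := by
  simp [formK_apply, formF_apply, dotProduct, Matrix.mulVec, incl]

variable {K} [Finite F]

variable (F) in
/-- The coordinatewise Frobenius map. -/
def tau (X : Fin (r + 1) → K) : Fin (r + 1) → K := fun i => frob F K (X i)

theorem herm_eq (A : Matrix (Fin (r + 1)) (Fin (r + 1)) F) (X Y : Fin (r + 1) → K) :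
    herm K A X Y = formK K A X (tau F Y) := by
  rw [formK_apply, herm]
  congr 2
  funext i
  rw [tau, frob_apply]

theorem tau_add (X Y : Fin (r + 1) → K) : tau F (X + Y) = tau F X + tau F Y := by
  funext i; simp [tau]

theorem tau_smul (c : K) (X : Fin (r + 1) → K) : tau F (c • X) = frob F K c • tau F X := by
  funext i; simp [tau]

theorem tau_incl (x : Fin (r + 1) → F) : tau F (incl F K r x) = incl F K r x := by
  funext i; simp [tau, incl]

theorem formK_tau (A : Matrix (Fin (r + 1)) (Fin (r + 1)) F) (X Y : Fin (r + 1) → K) :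
    formK K A (tau F X) (tau F Y) = frob F K (formK K A X Y) := by
  simp [formK_apply, dotProduct, Matrix.mulVec, tau]

theorem herm_add_left (A : Matrix (Fin (r + 1)) (Fin (r + 1)) F) (X Y Z : Fin (r + 1) → K) :
    herm K A (X + Y) Z = herm K A X Z + herm K A Y Z := by simp [herm_eq]

theorem herm_smul_left (A : Matrix (Fin (r + 1)) (Fin (r + 1)) F) (c : K)
    (X Y : Fin (r + 1) → K) : herm K A (c • X) Y = c * herm K A X Y := by simp [herm_eq]

theorem herm_add_right (A : Matrix (Fin (r + 1)) (Fin (r + 1)) F) (X Y Z : Fin (r + 1) → K) :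
    herm K A X (Y + Z) = herm K A X Y + herm K A X Z := by simp [herm_eq, tau_add]

theorem herm_smul_right (A : Matrix (Fin (r + 1)) (Fin (r + 1)) F) (c : K)
    (X Y : Fin (r + 1) → K) : herm K A X (c • Y) = frob F K c * herm K A X Y := by
  simp [herm_eq, tau_smul]

theorem herm_incl (A : Matrix (Fin (r + 1)) (Fin (r + 1)) F) (x y : Fin (r + 1) → F) :
    herm K A (incl F K r x) (incl F K r y) = algebraMap F K (formF A x y) := by
  rw [herm_eq, tau_incl, formK_incl]

variable {δ : K} {d : F} (Δ : QuadExt F K δ d) {A : Matrix (Fin (r + 1)) (Fin (r + 1)) F}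
include Δ

theorem herm_swap [Finite K] (hA : A.IsSymm) (X Y : Fin (r + 1) → K) :
    herm K A Y X = frob F K (herm K A X Y) := by
  rw [herm_eq, herm_eq, ← formK_tau, formK_symm K hA]
  congr 1
  funext i
  simp [tau, Δ.frob_frob]

theorem herm_comm [Finite K] (hA : A.IsSymm) (X Y : Fin (r + 1) → K) :
    herm K A Y X = 0 ↔ herm K A X Y = 0 := by
  rw [herm_swap Δ hA]
  exact map_eq_zero_iff (frob F K) (frob F K).injective

theorem exists_incl_add [Finite K] (Z : Fin (r + 1) → K) :
    ∃ x y : Fin (r + 1) → F, Z = incl F K r x + δ • incl F K r y := by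
  choose x y h using fun i => Δ.exists_eq (Z i)
  exact ⟨x, y, funext h⟩

theorem incl_add_ext {x y x' y' : Fin (r + 1) → F}
    (h : incl F K r x + δ • incl F K r y = incl F K r x' + δ • incl F K r y') :
    x = x' ∧ y = y' :=
  ⟨funext fun i => (Δ.ext (congrFun h i)).1, funext fun i => (Δ.ext (congrFun h i)).2⟩

/-- The cross terms cancel because conjugation negates `δ`. Together with `formK_incl_add` this
recovers the whole Gram matrix of `x, y` from the two values of the forms. -/
theorem herm_incl_add (hA : A.IsSymm) (x y : Fin (r + 1) → F) :
    herm K A (incl F K r x + δ • incl F K r y) (incl F K r x + δ • incl F K r y) =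
      algebraMap F K (formF A x x - d * formF A y y) := by
  simp only [herm_add_left, herm_add_right, herm_smul_left, herm_smul_right, herm_incl, Δ.frob,
    map_sub, map_mul, formF_symm hA y x, ← Δ.sq]
  ring

theorem formK_incl_add (hA : A.IsSymm) (x y : Fin (r + 1) → F) :
    formK K A (incl F K r x + δ • incl F K r y) (incl F K r x + δ • incl F K r y) =
      algebraMap F K (formF A x x + d * formF A y y) + δ * algebraMap F K (2 * formF A x y) := by
  simp only [map_add, map_smul, LinearMap.add_apply, LinearMap.smul_apply, smul_eq_mul, formK_incl,
    map_mul, formF_symm hA y x, ← Δ.sq, map_ofNat]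
  ring

end Vectors

/-! ### The four classes of isotropic vectors and their description by lines of `Σ`. -/

section Classes

variable {F K : Type*} [Field F] [Field K] [Algebra F K] {r : ℕ}

/-- Nonzero isotropic vectors of the Hermitian form. -/
def VecH (A : Matrix (Fin (r + 1)) (Fin (r + 1)) F) (Z : Fin (r + 1) → K) : Prop :=
  Z ≠ 0 ∧ herm K A Z Z = 0

/-- Nonzero multiples of singular vectors with coordinates in `F`. -/
def VecQ (A : Matrix (Fin (r + 1)) (Fin (r + 1)) F) (Z : Fin (r + 1) → K) : Prop :=
  Z ≠ 0 ∧ ∃ (c : K) (x : Fin (r + 1) → F), Z = c • incl F K r x ∧ formF A x x = 0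

/-- Vectors that are singular for both forms but not multiples of vectors over `F`. -/
def VecO (A : Matrix (Fin (r + 1)) (Fin (r + 1)) F) (Z : Fin (r + 1) → K) : Prop :=
  Z ≠ 0 ∧ herm K A Z Z = 0 ∧ formK K A Z Z = 0 ∧ ¬ VecQ A Z

/-- Isotropic vectors that are not singular, of square type. -/
def VecS (δ : K) (A : Matrix (Fin (r + 1)) (Fin (r + 1)) F) (Z : Fin (r + 1) → K) : Prop :=
  herm K A Z Z = 0 ∧ formK K A Z Z ≠ 0 ∧ IsSquare (2 * δ * formK K A Z Z)

/-- Isotropic vectors that are not singular, of nonsquare type. -/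
def VecE (δ : K) (A : Matrix (Fin (r + 1)) (Fin (r + 1)) F) (Z : Fin (r + 1) → K) : Prop :=
  herm K A Z Z = 0 ∧ formK K A Z Z ≠ 0 ∧ ¬ IsSquare (2 * δ * formK K A Z Z)

/-- The points with a representative satisfying a predicate. -/
def pointsOf (p : (Fin (r + 1) → K) → Prop) : Set (ℙ K (Fin (r + 1) → K)) := {P | p P.rep}

/-- A predicate on nonzero vectors that is invariant under nonzero scalars. -/
structure Homogeneous (p : (Fin (r + 1) → K) → Prop) : Prop where
  ne_zero : ∀ Z, p Z → Z ≠ 0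
  smul : ∀ (c : K) (Z), c ≠ 0 → p Z → p (c • Z)

theorem Homogeneous.smul_iff {p : (Fin (r + 1) → K) → Prop} (hp : Homogeneous p) {c : K}
    (hc : c ≠ 0) (Z : Fin (r + 1) → K) : p (c • Z) ↔ p Z := by
  refine ⟨fun h => ?_, hp.smul c Z hc⟩
  have := hp.smul c⁻¹ _ (inv_ne_zero hc) h
  rwa [smul_smul, inv_mul_cancel₀ hc, one_smul] at this

theorem mk_mem_pointsOf {p : (Fin (r + 1) → K) → Prop} (hp : Homogeneous p)
    (Z : Fin (r + 1) → K) (hZ : Z ≠ 0) : Projectivization.mk K Z hZ ∈ pointsOf p ↔ p Z := by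
  obtain ⟨a, ha⟩ := Projectivization.exists_smul_eq_mk_rep K Z hZ
  change p (Projectivization.mk K Z hZ).rep ↔ _
  rw [← ha]
  exact hp.smul_iff a.ne_zero Z

variable [Finite F] {A : Matrix (Fin (r + 1)) (Fin (r + 1)) F}

omit [Finite F] in
theorem formK_smul_smul (c : K) (Z : Fin (r + 1) → K) :
    formK K A (c • Z) (c • Z) = c * c * formK K A Z Z := by
  simp [mul_assoc]

theorem herm_smul_smul (c : K) (Z : Fin (r + 1) → K) :
    herm K A (c • Z) (c • Z) = c * frob F K c * herm K A Z Z := by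
  rw [herm_smul_left, herm_smul_right, mul_assoc]

omit [Finite F] in
theorem isSquare_smul_iff {c : K} (hc : c ≠ 0) (δ : K) (Z : Fin (r + 1) → K) :
    IsSquare (2 * δ * formK K A (c • Z) (c • Z)) ↔ IsSquare (2 * δ * formK K A Z Z) := by
  rw [formK_smul_smul]
  constructor
  · rintro ⟨s, hs⟩
    exact ⟨s / c, by field_simp; linear_combination hs⟩
  · rintro ⟨s, hs⟩
    exact ⟨c * s, by linear_combination (c * c) * hs⟩

omit [Finite F] in
theorem homogeneous_vecQ : Homogeneous (VecQ (K := K) A) :=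
  ⟨fun _ h => h.1, fun c Z hc ⟨h1, a, x, h2, h3⟩ => ⟨smul_ne_zero hc h1, c * a, x, by
    rw [h2, smul_smul], h3⟩⟩

theorem homogeneous_vecO : Homogeneous (VecO (K := K) A) :=
  ⟨fun _ h => h.1, fun c Z hc h => ⟨smul_ne_zero hc h.1, by rw [herm_smul_smul, h.2.1, mul_zero],
    by rw [formK_smul_smul, h.2.2.1, mul_zero],
    fun h' => h.2.2.2 ((homogeneous_vecQ.smul_iff hc Z).1 h')⟩⟩

theorem homogeneous_vecS (δ : K) : Homogeneous (VecS δ A) :=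
  ⟨fun Z h hZ => h.2.1 (by rw [hZ]; simp), fun c Z hc h => ⟨by rw [herm_smul_smul, h.1, mul_zero],
    by rw [formK_smul_smul]; exact mul_ne_zero (mul_ne_zero hc hc) h.2.1,
    (isSquare_smul_iff hc δ Z).2 h.2.2⟩⟩

theorem homogeneous_vecE (δ : K) : Homogeneous (VecE δ A) :=
  ⟨fun Z h hZ => h.2.1 (by rw [hZ]; simp), fun c Z hc h => ⟨by rw [herm_smul_smul, h.1, mul_zero],
    by rw [formK_smul_smul]; exact mul_ne_zero (mul_ne_zero hc hc) h.2.1,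
    fun h' => h.2.2 ((isSquare_smul_iff hc δ Z).1 h')⟩⟩

omit [Finite F] in
theorem hermVariety_eq : hermVariety K A = pointsOf (VecH A) :=
  Set.ext fun P => ⟨fun h => ⟨P.rep_nonzero, h⟩, fun h => h.2⟩

omit [Finite F] in
theorem mk_mem_quadric (x : Fin (r + 1) → F) (hx : x ≠ 0) :
    Projectivization.mk F x hx ∈ quadric A ↔ formF A x x = 0 := by
  obtain ⟨a, ha⟩ := Projectivization.exists_smul_eq_mk_rep F x hx
  change (Projectivization.mk F x hx).rep ⬝ᵥ A.mulVec (Projectivization.mk F x hx).rep = 0 ↔ _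
  rw [← formF_apply, ← ha, Units.smul_def]
  simp

omit [Finite F] in
theorem mem_quadric (P : ℙ F (Fin (r + 1) → F)) : P ∈ quadric A ↔ formF A P.rep P.rep = 0 := by
  rw [formF_apply]; rfl

omit [Finite F] in
theorem mk_mem_quadricOn (x : Fin (r + 1) → F) (hx : x ≠ 0)
    (l : Submodule F (Fin (r + 1) → F)) :
    Projectivization.mk F x hx ∈ quadricOn A l ↔ formF A x x = 0 ∧ x ∈ l := by
  rw [← mk_mem_quadric x hx, quadricOn, Set.mem_ofPred_eq, Projectivization.submodule_mk,
    Submodule.span_singleton_le_iff_mem]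

theorem rep_mem_iff {L : Type*} [Field L] (P : ℙ L (Fin (r + 1) → L))
    (l : Submodule L (Fin (r + 1) → L)) : P.submodule ≤ l ↔ P.rep ∈ l := by
  rw [Projectivization.submodule_eq, Submodule.span_singleton_le_iff_mem]

omit [Finite F] in
theorem incl_ne_zero {x : Fin (r + 1) → F} (hx : x ≠ 0) : incl F K r x ≠ 0 := fun h =>
  hx (incl_injective F K r (by rw [h, map_zero]))

omit [Finite F] in
theorem mk_mem_range_embed (Z : Fin (r + 1) → K) (hZ : Z ≠ 0) :
    Projectivization.mk K Z hZ ∈ Set.range (embed (F := F) K) ↔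
      ∃ (c : K) (x : Fin (r + 1) → F), Z = c • incl F K r x := by
  constructor
  · rintro ⟨R, hR⟩
    induction R using Projectivization.ind with
    | h x hx =>
      rw [embed, Projectivization.map_mk, Projectivization.mk_eq_mk_iff'] at hR
      obtain ⟨a, ha⟩ := hR
      have ha0 : a ≠ 0 := by rintro rfl; exact incl_ne_zero hx (by rw [← ha, zero_smul])
      exact ⟨a⁻¹, x, by rw [← ha, smul_smul, inv_mul_cancel₀ ha0, one_smul]⟩
  · rintro ⟨c, x, h⟩
    have hx : x ≠ 0 := by rintro rfl; exact hZ (by rw [h, map_zero, smul_zero])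
    have hc : c ≠ 0 := by rintro rfl; exact hZ (by rw [h, zero_smul])
    refine ⟨Projectivization.mk F x hx, ?_⟩
    rw [embed, Projectivization.map_mk, Projectivization.mk_eq_mk_iff']
    exact ⟨c⁻¹, by rw [h, smul_smul, inv_mul_cancel₀ hc, one_smul]⟩

omit [Finite F] in
theorem setQ_eq : setQ K A = pointsOf (VecQ A) := by
  ext P
  constructor
  · rintro ⟨R, hR, rfl⟩
    induction R using Projectivization.ind with
    | h x hx =>
      rw [mk_mem_quadric] at hR
      rw [embed, Projectivization.map_mk, mk_mem_pointsOf homogeneous_vecQ]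
      exact ⟨incl_ne_zero hx, 1, x, by rw [one_smul], hR⟩
  · intro h
    obtain ⟨h0, c, x, h1, h2⟩ := h
    have hx : x ≠ 0 := by rintro rfl; exact h0 (by rw [h1, map_zero, smul_zero])
    have hc : c ≠ 0 := by rintro rfl; exact h0 (by rw [h1, zero_smul])
    refine ⟨Projectivization.mk F x hx, (mk_mem_quadric x hx).2 h2, ?_⟩
    rw [embed, Projectivization.map_mk, ← Projectivization.mk_rep P,
      Projectivization.mk_eq_mk_iff']
    exact ⟨c⁻¹, by rw [h1, smul_smul, inv_mul_cancel₀ hc, one_smul]⟩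

theorem VecQ.vecH {Z : Fin (r + 1) → K} (h : VecQ A Z) : VecH A Z := by
  obtain ⟨h0, c, x, rfl, h2⟩ := h
  exact ⟨h0, by rw [herm_smul_smul, herm_incl, h2, map_zero, mul_zero]⟩

omit [Finite F] in
theorem VecQ.formK_eq {Z : Fin (r + 1) → K} (h : VecQ A Z) : formK K A Z Z = 0 := by
  obtain ⟨h0, c, x, rfl, h2⟩ := h
  rw [formK_smul_smul, formK_incl, h2, map_zero, mul_zero]

variable {δ : K} {d : F} (Δ : QuadExt F K δ d)

omit [Finite F] in
theorem VecO.vecH {Z : Fin (r + 1) → K} (h : VecO A Z) : VecH A Z := ⟨h.1, h.2.1⟩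
theorem VecS.vecH {Z : Fin (r + 1) → K} (h : VecS δ A Z) : VecH A Z :=
  ⟨(homogeneous_vecS δ).ne_zero Z h, h.1⟩
theorem VecE.vecH {Z : Fin (r + 1) → K} (h : VecE δ A Z) : VecH A Z :=
  ⟨(homogeneous_vecE δ).ne_zero Z h, h.1⟩

include Δ

omit Δ in
/-- A multiple of a vector over `F` that is isotropic is a multiple of a singular vector. -/
theorem vecQ_of_smul_incl {Z : Fin (r + 1) → K} (h : VecH A Z) (c : K) (x : Fin (r + 1) → F)
    (hZ : Z = c • incl F K r x) : VecQ A Z := by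
  have hc : c ≠ 0 := by rintro rfl; exact h.1 (by rw [hZ, zero_smul])
  refine ⟨h.1, c, x, hZ, ?_⟩
  have h2 := h.2
  rw [hZ, herm_smul_smul, herm_incl] at h2
  have hc' : frob F K c ≠ 0 := (map_ne_zero_iff (frob F K) (frob F K).injective).2 hc
  simpa [hc, hc'] using h2

-- If `x` and `y` were dependent, `x + δ y` would be a `K`-multiple of a single vector over `F`. So
-- an isotropic point outside `Q` comes with the line of `Σ` spanned by `x` and `y`.
omit Δ in
theorem linearIndependent_of_not_vecQ {x y : Fin (r + 1) → F}
    (h : VecH A (incl F K r x + δ • incl F K r y))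
    (hQ : ¬ VecQ A (incl F K r x + δ • incl F K r y)) : LinearIndependent F ![x, y] := by
  by_contra hli
  by_cases hy : y = 0
  · exact hQ (vecQ_of_smul_incl h 1 x (by rw [hy, map_zero]; simp))
  · have : ∃ a : F, a • y = x := by
      by_contra hne
      push Not at hne
      exact hli ((LinearIndependent.pair_symm_iff).1 ((LinearIndependent.pair_iff' hy).2 hne))
    obtain ⟨a, rfl⟩ := this
    refine hQ (vecQ_of_smul_incl h (algebraMap F K a + δ) y ?_)
    rw [map_smulₛₗ, add_smul]

/-- Because `δ²` lies in `F`, the vectors `x + δ y` with `x, y` in `l` are already closed under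
scalars from `K`. -/
theorem mem_extend [Finite K] (l : Submodule F (Fin (r + 1) → F)) (Z : Fin (r + 1) → K) :
    Z ∈ extend K l ↔ ∃ x ∈ l, ∃ y ∈ l, Z = incl F K r x + δ • incl F K r y := by
  constructor
  · intro h
    refine Submodule.span_induction (p := fun Z _ => ∃ x ∈ l, ∃ y ∈ l,
      Z = incl F K r x + δ • incl F K r y) ?_ ?_ ?_ ?_ h
    · rintro _ ⟨x, hx, rfl⟩
      exact ⟨x, hx, 0, l.zero_mem, by simp⟩
    · exact ⟨0, l.zero_mem, 0, l.zero_mem, by simp⟩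
    · rintro _ _ _ _ ⟨x, hx, y, hy, rfl⟩ ⟨x', hx', y', hy', rfl⟩
      exact ⟨x + x', l.add_mem hx hx', y + y', l.add_mem hy hy', by
        rw [map_add, map_add]; module⟩
    · rintro c _ _ ⟨x, hx, y, hy, rfl⟩
      obtain ⟨a, b, rfl⟩ := Δ.exists_eq c
      refine ⟨a • x + (d * b) • y, l.add_mem (l.smul_mem _ hx) (l.smul_mem _ hy), a • y + b • x,
        l.add_mem (l.smul_mem _ hy) (l.smul_mem _ hx), ?_⟩
      simp only [map_add, map_smulₛₗ, map_mul, ← Δ.sq]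
      module
  · rintro ⟨x, hx, y, hy, rfl⟩
    have hi : ∀ v ∈ l, incl F K r v ∈ extend K l := fun v hv =>
      Submodule.subset_span ⟨v, hv, rfl⟩
    exact add_mem (hi x hx) ((extend K l).smul_mem _ (hi y hy))

/-- Isotropy gives `B(x, x) = d B(y, y)`, and the vanishing of the `F`-part of the bilinear value
gives `B(x, x) = -d B(y, y)`. The case `c = 0` detects totally singular pairs, `c = 1` hyperbolic
pairs. -/
theorem forms_eq_zero (hA : A.IsSymm) {x y : Fin (r + 1) → F}
    (h : herm K A (incl F K r x + δ • incl F K r y) (incl F K r x + δ • incl F K r y) = 0)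
    {c : F} (h' : formK K A (incl F K r x + δ • incl F K r y) (incl F K r x + δ • incl F K r y)
      = δ * algebraMap F K (2 * c)) :
    formF A x x = 0 ∧ formF A y y = 0 ∧ formF A x y = c := by
  rw [herm_incl_add Δ hA, map_eq_zero_iff _ (algebraMap F K).injective] at h
  have h1 : algebraMap F K (formF A x x + d * formF A y y) +
      δ * algebraMap F K (2 * formF A x y) = algebraMap F K 0 + δ * algebraMap F K (2 * c) := by
    rw [← formK_incl_add Δ hA, h', map_zero, zero_add]
  obtain ⟨h2, h3⟩ := Δ.ext h1
  have h4 : 2 * formF A x x = 0 := by linear_combination h + h2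
  have h5 : formF A x x = 0 := by simpa [Δ.two_ne] using h4
  refine ⟨h5, ?_, mul_left_cancel₀ Δ.two_ne h3⟩
  rw [h5] at h2
  simpa [Δ.d_ne] using h2

omit Δ [Finite F] in
theorem finrank_span_pair {x y : Fin (r + 1) → F} (hi : LinearIndependent F ![x, y]) :
    Module.finrank F (Submodule.span F {x, y}) = 2 := by
  have h := finrank_span_eq_card hi
  rw [Matrix.range_cons_cons_empty] at h
  simpa using h

/-- For isotropic `x + δ y`, singularity over `K` amounts to `x` and `y` being singular and
orthogonal, that is, to their span being totally singular; not being a point of `Σ` makes that span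
a line. -/
theorem setO_eq [Finite K] (hA : A.IsSymm) : setO K A = pointsOf (VecO A) := by
  ext P
  rw [setO, Set.mem_ofPred_eq]
  conv_lhs => rw [← Projectivization.mk_rep P]
  rw [mk_mem_range_embed, Projectivization.mk_rep]
  simp only [rep_mem_iff]
  constructor
  · rintro ⟨hR, l, ⟨hl, hl'⟩, hP⟩
    obtain ⟨x, hx, y, hy, hZ⟩ := (mem_extend Δ l _).1 hP
    have hs : ∀ v ∈ l, formF A v v = 0 := fun v hv => by
      by_cases hv0 : v = 0
      · rw [hv0]; simp
      · rw [← mk_mem_quadric v hv0]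
        exact hl' _ (by rwa [Projectivization.submodule_mk,
          Submodule.span_singleton_le_iff_mem])
    have hxy : 2 * formF A x y = 0 := by
      have := hs _ (l.add_mem hx hy)
      simp only [map_add, LinearMap.add_apply, hs x hx, hs y hy, formF_symm hA y x] at this
      linear_combination this
    refine ⟨P.rep_nonzero, ?_, ?_, fun ⟨_, c, v, h, _⟩ => hR ⟨c, v, h⟩⟩
    · rw [hZ, herm_incl_add Δ hA, hs x hx, hs y hy]; simp
    · rw [hZ, formK_incl_add Δ hA, hs x hx, hs y hy, hxy]; simp
  · intro h
    obtain ⟨h0, h1, h2, h3⟩ := h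
    refine ⟨fun ⟨c, v, h⟩ => h3 (vecQ_of_smul_incl ⟨h0, h1⟩ c v h), ?_⟩
    obtain ⟨x, y, hZ⟩ := exists_incl_add Δ P.rep
    rw [hZ] at h0 h1 h2 h3
    have hi := linearIndependent_of_not_vecQ ⟨h0, h1⟩ h3
    obtain ⟨hx, hy, hxy⟩ := forms_eq_zero Δ hA h1 (c := 0) (by rw [h2]; simp)
    refine ⟨Submodule.span F {x, y}, ⟨?_, ?_⟩, ?_⟩
    · exact finrank_span_pair hi
    · intro R hR
      rw [rep_mem_iff, Submodule.mem_span_pair] at hR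
      obtain ⟨a, b, hab⟩ := hR
      rw [mem_quadric, ← hab]
      simp [hx, hy, hxy, formF_symm hA y x]
    · rw [mem_extend Δ]
      exact ⟨x, Submodule.subset_span (by simp), y, Submodule.subset_span (by simp), hZ⟩

/-- A vector of square type is a multiple of `p + δ p'` for a hyperbolic pair `p, p'`. -/
theorem VecS.exists_hyperbolic [Finite K] (hA : A.IsSymm) {Z : Fin (r + 1) → K}
    (h : VecS δ A Z) : ∃ (c : K) (x y : Fin (r + 1) → F), c ≠ 0 ∧
      c • Z = incl F K r x + δ • incl F K r y ∧
      formF A x x = 0 ∧ formF A y y = 0 ∧ formF A x y = 1 := by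
  obtain ⟨h1, h2, s, hs⟩ := h
  have h2' := Δ.two_ne'
  have hδ := Δ.ne_zero
  have hs0 : s ≠ 0 := by
    rintro rfl
    simp [h2', hδ, h2] at hs
  -- With `s² = 2 δ B(Z, Z)`, this scalar normalizes the bilinear value to `2 δ`, which is the case
  -- `c = 1` of `forms_eq_zero`.
  obtain ⟨x, y, hxy⟩ := exists_incl_add Δ ((2 * δ / s) • Z)
  refine ⟨2 * δ / s, x, y, div_ne_zero (mul_ne_zero h2' hδ) hs0, hxy, ?_⟩
  refine forms_eq_zero Δ hA (c := 1) (by rw [← hxy, herm_smul_smul, h1, mul_zero]) ?_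
  rw [← hxy, formK_smul_smul, mul_one, map_ofNat]
  field_simp
  linear_combination hs

/-- An isotropic, nonsingular vector `x + δ y` is of square type as soon as the plane spanned by
`x` and `y` contains a nonzero singular vector. -/
theorem vecS_of_singular [Finite K] (hA : A.IsSymm) {x y : Fin (r + 1) → F}
    (h : herm K A (incl F K r x + δ • incl F K r y) (incl F K r x + δ • incl F K r y) = 0)
    (h0 : formK K A (incl F K r x + δ • incl F K r y) (incl F K r x + δ • incl F K r y) ≠ 0)
    {p : Fin (r + 1) → F} (hp : p ≠ 0) (hpp : formF A p p = 0)
    (hpl : p ∈ Submodule.span F {x, y}) : VecS δ A (incl F K r x + δ • incl F K r y) := by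
  refine ⟨h, h0, ?_⟩
  obtain ⟨a, b, rfl⟩ := Submodule.mem_span_pair.1 hpl
  -- As `δ² = d`, multiplication by this scalar turns the `F`-part of `x + δ y` into the singular
  -- vector `a x + b y`. Isotropy then makes the `δ`-part singular too.
  let c : K := algebraMap F K a + δ * algebraMap F K (b / d)
  have hd := Δ.d_ne
  have hc : c ≠ 0 := fun hc => hp (by
    obtain ⟨h1, h2⟩ := Δ.eq_zero hc
    have : b = 0 := by simpa [hd] using h2
    rw [h1, this]; simp)
  have hcZ : c • (incl F K r x + δ • incl F K r y) =
      incl F K r (a • x + b • y) + δ • incl F K r (a • y + (b / d) • x) := by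
    have hb : algebraMap F K b = δ * δ * algebraMap F K (b / d) := by
      rw [Δ.sq, ← map_mul, mul_div_cancel₀ _ hd]
    simp only [map_add, map_smulₛₗ, hb, c]
    module
  rw [← isSquare_smul_iff hc, hcZ, formK_incl_add Δ hA]
  have h1 : herm K A (c • (incl F K r x + δ • incl F K r y))
      (c • (incl F K r x + δ • incl F K r y)) = 0 := by rw [herm_smul_smul, h, mul_zero]
  rw [hcZ, herm_incl_add Δ hA, map_eq_zero_iff _ (algebraMap F K).injective, hpp, zero_sub,
    neg_eq_zero] at h1
  rw [hpp, h1, add_zero, map_zero, zero_add]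
  -- The remaining bilinear value is `δ` times an element of `F`; the extra factor `δ` brings it
  -- into `F`, where everything is a square in `K`.
  have : 2 * δ * (δ * algebraMap F K (2 * formF A (a • x + b • y) (a • y + (b / d) • x))) =
      algebraMap F K (2 * d * (2 * formF A (a • x + b • y) (a • y + (b / d) • x))) := by
    rw [map_mul _ (2 * d), map_mul _ 2 d, ← Δ.sq, map_ofNat]; ring
  rw [this]
  exact isSquare_algebraMap Δ.two_ne Δ.card _

/-- On an external line no nonzero vector is singular. A square type would put the singular vector
`p` of `VecS.exists_hyperbolic` on it; conversely `vecS_of_singular` shows that a singular vector in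
the plane of `x, y` forces the square type. -/
theorem setE_eq [Finite K] (hA : A.IsSymm) : setE K A = pointsOf (VecE δ A) := by
  ext P
  rw [setE, hermVariety_eq, Set.mem_ofPred_eq]
  simp only [rep_mem_iff]
  constructor
  · rintro ⟨hP, l, ⟨hl, hl'⟩, hPl⟩
    have hP : VecH A P.rep := hP
    obtain ⟨x, hx, y, hy, hZ⟩ := (mem_extend Δ l _).1 hPl
    have hne : ∀ v ∈ l, formF A v v = 0 → v = 0 := fun v hv hvv => by
      by_contra hv0
      have : Projectivization.mk F v hv0 ∈ quadricOn A l := (mk_mem_quadricOn v hv0 l).2 ⟨hvv, hv⟩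
      rw [hl'] at this
      exact this
    refine ⟨hP.2, fun h0 => ?_, fun hsq => ?_⟩
    · have hP2 := hP.2
      rw [hZ] at h0 hP2
      obtain ⟨h1, h2, -⟩ := forms_eq_zero Δ hA hP2 (c := 0) (by rw [h0]; simp)
      exact P.rep_nonzero (by rw [hZ, hne x hx h1, hne y hy h2]; simp)
    · by_cases h0 : formK K A P.rep P.rep = 0
      · have hP2 := hP.2
        rw [hZ] at h0 hP2
        obtain ⟨h1, h2, -⟩ := forms_eq_zero Δ hA hP2 (c := 0) (by rw [h0]; simp)
        exact P.rep_nonzero (by rw [hZ, hne x hx h1, hne y hy h2]; simp)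
      obtain ⟨c, p, p', hc, hcZ, hp, hp', hpp⟩ := VecS.exists_hyperbolic Δ hA ⟨hP.2, h0, hsq⟩
      obtain ⟨u, hu, v, hv, huv⟩ := (mem_extend Δ l _).1 ((extend K l).smul_mem c hPl)
      have hpu := (incl_add_ext Δ (hcZ.symm.trans huv)).1
      have : p = 0 := hne p (hpu ▸ hu) hp
      rw [this] at hpp
      simp at hpp
  · intro h
    have hh := h
    obtain ⟨h1, h2, h3⟩ := h
    refine ⟨hh.vecH, ?_⟩
    obtain ⟨x, y, hZ⟩ := exists_incl_add Δ P.rep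
    have hH := VecE.vecH hh
    rw [hZ] at h1 h2 h3 hH
    have hi := linearIndependent_of_not_vecQ hH (fun hQ => h2 hQ.formK_eq)
    refine ⟨Submodule.span F {x, y}, ⟨?_, ?_⟩, ?_⟩
    · exact finrank_span_pair hi
    · rw [Set.eq_empty_iff_forall_notMem]
      rintro R ⟨hR, hRl⟩
      rw [rep_mem_iff] at hRl
      exact h3 (vecS_of_singular Δ hA h1 h2 R.rep_nonzero ((mem_quadric R).1 hR) hRl).2.2
    · rw [mem_extend Δ]
      exact ⟨x, Submodule.subset_span (by simp), y, Submodule.subset_span (by simp), hZ⟩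

/-- A hyperbolic pair `p, p'` spans a line on which `B(a p + b p', a p + b p') = 2 a b`, so its
singular points are exactly `p` and `p'`. -/
theorem setS_eq [Finite K] (hA : A.IsSymm) : setS K A = pointsOf (VecS δ A) := by
  ext P
  rw [setS, hermVariety_eq, setQ_eq, Set.mem_ofPred_eq]
  simp only [rep_mem_iff]
  constructor
  · rintro ⟨hP, hPQ, l, ⟨hl, hl'⟩, hPl⟩
    have hP : VecH A P.rep := hP
    have hPQ : ¬ VecQ A P.rep := hPQ
    obtain ⟨x, hx, y, hy, hZ⟩ := (mem_extend Δ l _).1 hPl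
    change VecS δ A P.rep
    rw [hZ] at hP hPQ ⊢
    have hi := linearIndependent_of_not_vecQ hP hPQ
    have hspan : Submodule.span F {x, y} = l := by
      refine Submodule.eq_of_le_of_finrank_eq
        (Submodule.span_le.2 (by rintro v (rfl | rfl) <;> assumption)) ?_
      rw [hl, finrank_span_pair hi]
    -- Otherwise `x`, `y` and `x + y` would be three different singular points on a secant line.
    have h0 : formK K A (incl F K r x + δ • incl F K r y) (incl F K r x + δ • incl F K r y) ≠ 0 := by
      intro h0
      obtain ⟨hxx, hyy, hxy⟩ := forms_eq_zero Δ hA hP.2 (c := 0) (by rw [h0]; simp)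
      have hi' := LinearIndependent.pair_iff.1 hi
      have hx0 : x ≠ 0 := fun h => by simpa using (hi' 1 0 (by simp [h])).1
      have hy0 : y ≠ 0 := fun h => by simpa using (hi' 0 1 (by simp [h])).2
      have hs0 : x + y ≠ 0 := fun h => by simpa using (hi' 1 1 (by simpa using h)).2
      have m1 := (mk_mem_quadricOn (A := A) x hx0 l).2 ⟨hxx, hx⟩
      have m2 := (mk_mem_quadricOn (A := A) y hy0 l).2 ⟨hyy, hy⟩
      have m3 := (mk_mem_quadricOn (A := A) (x + y) hs0 l).2 ⟨by
        simp [hxx, hyy, hxy, formF_symm hA y x], l.add_mem hx hy⟩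
      have n12 : Projectivization.mk F x hx0 ≠ Projectivization.mk F y hy0 := fun h => by
        obtain ⟨a, ha⟩ := (Projectivization.mk_eq_mk_iff' F _ _ _ _).1 h
        simpa using (hi' (-1) a (by rw [ha]; module)).1
      have n13 : Projectivization.mk F x hx0 ≠ Projectivization.mk F (x + y) hs0 := fun h => by
        obtain ⟨a, ha⟩ := (Projectivization.mk_eq_mk_iff' F _ _ _ _).1 h
        obtain ⟨k1, k2⟩ := hi' (a - 1) a (by
          rw [sub_smul, one_smul, sub_add_eq_add_sub, ← smul_add, ha, sub_self])
        rw [k2] at k1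
        simp at k1
      have n23 : Projectivization.mk F y hy0 ≠ Projectivization.mk F (x + y) hs0 := fun h => by
        obtain ⟨a, ha⟩ := (Projectivization.mk_eq_mk_iff' F _ _ _ _).1 h
        obtain ⟨k1, k2⟩ := hi' a (a - 1) (by
          rw [sub_smul, one_smul, ← add_sub_assoc, ← smul_add, ha, sub_self])
        rw [k1] at k2
        simp at k2
      obtain ⟨R, R', -, hRR⟩ := Set.ncard_eq_two.1 hl'
      rw [hRR] at m1 m2 m3
      rcases m1 with m1 | m1 <;> rcases m2 with m2 | m2 <;> rcases m3 with m3 | m3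
      · exact n12 (m1.trans m2.symm)
      · exact n12 (m1.trans m2.symm)
      · exact n13 (m1.trans m3.symm)
      · exact n23 (m2.trans m3.symm)
      · exact n23 (m2.trans m3.symm)
      · exact n13 (m1.trans m3.symm)
      · exact n12 (m1.trans m2.symm)
      · exact n12 (m1.trans m2.symm)
    obtain ⟨R, hR, hRl⟩ : (quadricOn A l).Nonempty :=
      Set.nonempty_of_ncard_ne_zero (by rw [hl']; norm_num)
    rw [rep_mem_iff] at hRl
    exact vecS_of_singular Δ hA hP.2 h0 R.rep_nonzero ((mem_quadric R).1 hR) (hspan ▸ hRl)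
  · intro h
    have h : VecS δ A P.rep := h
    obtain ⟨c, p, p', hc, hcZ, hp, hp', hpp⟩ := h.exists_hyperbolic Δ hA
    have hp'p : formF A p' p = 1 := by rw [formF_symm hA, hpp]
    refine ⟨h.vecH, fun hQ => h.2.1 (VecQ.formK_eq hQ), Submodule.span F {p, p'}, ⟨?_, ?_⟩, ?_⟩
    · have hi : LinearIndependent F ![p, p'] := by
        rw [LinearIndependent.pair_iff]
        intro s t hst
        have e1 : formF A (s • p + t • p') p = 0 := by rw [hst]; simp
        have e2 : formF A (s • p + t • p') p' = 0 := by rw [hst]; simp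
        simp [hp, hp', hpp, hp'p] at e1 e2
        exact ⟨e2, e1⟩
      exact finrank_span_pair hi
    · have hp0 : p ≠ 0 := by rintro rfl; simp at hpp
      have hp0' : p' ≠ 0 := by rintro rfl; simp at hpp
      have : quadricOn A (Submodule.span F {p, p'}) =
          {Projectivization.mk F p hp0, Projectivization.mk F p' hp0'} := by
        ext R
        induction R using Projectivization.ind with
        | h v hv =>
          rw [mk_mem_quadricOn, Set.mem_insert_iff, Set.mem_singleton_iff,
            Projectivization.mk_eq_mk_iff', Projectivization.mk_eq_mk_iff']
          constructor
          · rintro ⟨hvv, hvl⟩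
            obtain ⟨a, b, rfl⟩ := Submodule.mem_span_pair.1 hvl
            have h2 : 2 * (a * b) = 0 := by
              simp [hp, hp', hpp, hp'p] at hvv
              linear_combination hvv
            have : a = 0 ∨ b = 0 := by simpa [Δ.two_ne] using h2
            rcases this with rfl | rfl
            · exact Or.inr ⟨b, by simp⟩
            · exact Or.inl ⟨a, by simp⟩
          · rintro (⟨a, rfl⟩ | ⟨a, rfl⟩)
            · exact ⟨by simp [hp], Submodule.smul_mem _ _ (Submodule.subset_span (by simp))⟩
            · exact ⟨by simp [hp'], Submodule.smul_mem _ _ (Submodule.subset_span (by simp))⟩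
      rw [this, Set.ncard_pair]
      intro h
      obtain ⟨a, ha⟩ := (Projectivization.mk_eq_mk_iff' F _ _ _ _).1 h
      rw [← ha] at hpp
      simp [hp'] at hpp
    · have h1 : c • P.rep ∈ extend K (Submodule.span F {p, p'}) := by
        rw [mem_extend Δ]
        exact ⟨p, Submodule.subset_span (by simp), p', Submodule.subset_span (by simp), hcZ⟩
      have h2 := (extend K (Submodule.span F {p, p'})).smul_mem c⁻¹ h1
      rwa [smul_smul, inv_mul_cancel₀ hc, one_smul] at h2

end Classes

/-! ### The action of the similitudes and transitivity on each class. -/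

section Group

variable {F K : Type*} [Field F] [Field K] [Algebra F K] {r : ℕ}

/-- The action on `K ^ (r + 1)` of an invertible matrix over `F`. -/
def actK (g : GL (Fin (r + 1)) F) (Z : Fin (r + 1) → K) : Fin (r + 1) → K :=
  (g.val.map (algebraMap F K)).mulVec Z

theorem actK_eq_smul (g : GL (Fin (r + 1)) F) (Z : Fin (r + 1) → K) :
    actK g Z = Matrix.GeneralLinearGroup.map (algebraMap F K) g • Z := rfl

theorem actK_incl (g : GL (Fin (r + 1)) F) (x : Fin (r + 1) → F) :
    actK g (incl F K r x) = incl F K r (g.val.mulVec x) := by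
  funext i
  simp [actK, incl, Matrix.mulVec, dotProduct]

theorem actK_add (g : GL (Fin (r + 1)) F) (Z W : Fin (r + 1) → K) :
    actK g (Z + W) = actK g Z + actK g W := Matrix.mulVec_add _ _ _

theorem actK_smul (g : GL (Fin (r + 1)) F) (c : K) (Z : Fin (r + 1) → K) :
    actK g (c • Z) = c • actK g Z := Matrix.mulVec_smul _ _ _

theorem actK_inv_actK (g : GL (Fin (r + 1)) F) (Z : Fin (r + 1) → K) :
    actK g⁻¹ (actK g Z) = Z := by
  rw [actK_eq_smul, actK_eq_smul, map_inv, inv_smul_smul]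

theorem actK_injective (g : GL (Fin (r + 1)) F) :
    Function.Injective (actK (K := K) g) := fun Z W h => by
  rw [← actK_inv_actK g Z, h, actK_inv_actK]

theorem actK_ne_zero (g : GL (Fin (r + 1)) F) {Z : Fin (r + 1) → K} (hZ : Z ≠ 0) :
    actK g Z ≠ 0 := fun h => hZ (actK_injective g (by rw [h]; exact (Matrix.mulVec_zero _).symm))

variable {A : Matrix (Fin (r + 1)) (Fin (r + 1)) F}

theorem formF_mulVec {g : GL (Fin (r + 1)) F} {c : F}
    (h : g.val.transpose * A * g.val = c • A) (x y : Fin (r + 1) → F) :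
    formF A (g.val.mulVec x) (g.val.mulVec y) = c * formF A x y := by
  rw [formF_apply, formF_apply, ← smul_eq_mul, ← dotProduct_smul, ← Matrix.smul_mulVec, ← h,
    ← Matrix.mulVec_mulVec, ← Matrix.mulVec_mulVec, Matrix.dotProduct_mulVec _ g.val.transpose,
    Matrix.vecMul_transpose]

theorem formK_actK {g : GL (Fin (r + 1)) F} {c : F}
    (h : g.val.transpose * A * g.val = c • A) (Z W : Fin (r + 1) → K) :
    formK K A (actK g Z) (actK g W) = algebraMap F K c * formK K A Z W := by
  have h' : (g.val.map (algebraMap F K)).transpose * A.map (algebraMap F K) *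
      g.val.map (algebraMap F K) = algebraMap F K c • A.map (algebraMap F K) := by
    rw [← Matrix.transpose_map, ← Matrix.map_mul, ← Matrix.map_mul, h]
    ext i j; simp
  rw [formK_apply, formK_apply, ← smul_eq_mul, ← dotProduct_smul, ← Matrix.smul_mulVec, ← h',
    ← Matrix.mulVec_mulVec, ← Matrix.mulVec_mulVec, Matrix.dotProduct_mulVec _
    (g.val.map (algebraMap F K)).transpose, Matrix.vecMul_transpose]
  rfl

/-- A linear isometry is the action of a similitude matrix. -/
theorem exists_similitude (g : (Fin (r + 1) → F) ≃ₗ[F] (Fin (r + 1) → F))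
    (hg : ∀ x y, formF A (g x) (g y) = formF A x y) :
    ∃ G ∈ similitudes A, ∀ x, G.val.mulVec x = g x := by
  let G : GL (Fin (r + 1)) F := ⟨LinearMap.toMatrix' g.toLinearMap,
    LinearMap.toMatrix' g.symm.toLinearMap, by
      rw [← LinearMap.toMatrix'_comp]; simp, by rw [← LinearMap.toMatrix'_comp]; simp⟩
  have hG : ∀ x, G.val.mulVec x = g x := fun x => by
    change (LinearMap.toMatrix' g.toLinearMap).mulVec x = g x
    rw [LinearMap.toMatrix'_mulVec]; rfl
  refine ⟨G, ⟨1, one_ne_zero, ?_⟩, hG⟩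
  rw [one_smul]
  apply (Matrix.toBilin' (R₁ := F)).injective
  rw [← Matrix.toBilin'_comp]
  ext x y
  change formF A (Matrix.toLin' G.val _) (Matrix.toLin' G.val _) = formF A _ _
  rw [Matrix.toLin'_apply, Matrix.toLin'_apply, hG, hG, hg]

variable [Finite F]

theorem tau_actK (g : GL (Fin (r + 1)) F) (Z : Fin (r + 1) → K) :
    tau F (actK g Z) = actK g (tau F Z) := by
  funext i
  simp [tau, actK, Matrix.mulVec, dotProduct]

theorem herm_actK {g : GL (Fin (r + 1)) F} {c : F}
    (h : g.val.transpose * A * g.val = c • A) (Z W : Fin (r + 1) → K) :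
    herm K A (actK g Z) (actK g W) = algebraMap F K c * herm K A Z W := by
  rw [herm_eq, herm_eq, tau_actK, formK_actK h]

/-- A predicate preserved by the action of the similitudes. -/
def Invariant (A : Matrix (Fin (r + 1)) (Fin (r + 1)) F) (p : (Fin (r + 1) → K) → Prop) : Prop :=
  ∀ g ∈ similitudes A, ∀ Z, p Z → p (actK g Z)

omit [Finite F] in
theorem Invariant.iff {p : (Fin (r + 1) → K) → Prop} (hp : Invariant A p)
    {g : GL (Fin (r + 1)) F} (hg : g ∈ similitudes A) (Z : Fin (r + 1) → K) :
    p (actK g Z) ↔ p Z := by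
  refine ⟨fun h => ?_, hp g hg Z⟩
  have := hp g⁻¹ ((similitudes A).inv_mem hg) _ h
  rwa [actK_inv_actK] at this

omit [Finite F] in
theorem invariant_vecQ : Invariant (K := K) A (VecQ A) := by
  rintro g ⟨c, hc, hg⟩ Z ⟨h0, a, x, h1, h2⟩
  exact ⟨actK_ne_zero g h0, a, g.val.mulVec x, by rw [h1, actK_smul, actK_incl], by
    rw [formF_mulVec hg, h2, mul_zero]⟩

theorem invariant_vecO : Invariant (K := K) A (VecO A) := by
  intro g hg Z ⟨h0, h1, h2, h3⟩
  have h4 := invariant_vecQ.iff hg Z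
  obtain ⟨c, hc, hg⟩ := hg
  exact ⟨actK_ne_zero g h0, by rw [herm_actK hg, h1, mul_zero], by
    rw [formK_actK hg, h2, mul_zero], fun h => h3 (h4.1 h)⟩

/-- The similitude factor lies in `F` and is therefore a square in `K`. -/
theorem isSquare_actK_iff [Finite K] (h2 : (2 : F) ≠ 0) (hK : Nat.card K = Nat.card F ^ 2)
    {g : GL (Fin (r + 1)) F} {c : F} (hc : c ≠ 0)
    (h : g.val.transpose * A * g.val = c • A) (δ : K) (Z : Fin (r + 1) → K) :
    IsSquare (2 * δ * formK K A (actK g Z) (actK g Z)) ↔ IsSquare (2 * δ * formK K A Z Z) := by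
  obtain ⟨s, hs⟩ := isSquare_algebraMap (K := K) h2 hK c
  have hs0 : s ≠ 0 := by
    rintro rfl
    exact hc ((algebraMap F K).injective (by rw [hs]; simp))
  rw [formK_actK h, hs]
  constructor
  · rintro ⟨t, ht⟩
    exact ⟨t / s, by field_simp; linear_combination ht⟩
  · rintro ⟨t, ht⟩
    exact ⟨t * s, by linear_combination (s * s) * ht⟩

variable {δ : K} {d : F} (Δ : QuadExt F K δ d)
include Δ

theorem invariant_vecS [Finite K] : Invariant (K := K) A (VecS δ A) := by
  rintro g ⟨c, hc, hg⟩ Z ⟨h1, h2, h3⟩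
  exact ⟨by rw [herm_actK hg, h1, mul_zero], by
    rw [formK_actK hg]; exact mul_ne_zero (by simpa using hc) h2,
    (isSquare_actK_iff Δ.two_ne Δ.card hc hg δ Z).2 h3⟩

theorem invariant_vecE [Finite K] : Invariant (K := K) A (VecE δ A) := by
  rintro g ⟨c, hc, hg⟩ Z ⟨h1, h2, h3⟩
  exact ⟨by rw [herm_actK hg, h1, mul_zero], by
    rw [formK_actK hg]; exact mul_ne_zero (by simpa using hc) h2,
    fun h => h3 ((isSquare_actK_iff Δ.two_ne Δ.card hc hg δ Z).1 h)⟩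

/-- The similitudes act transitively on the points described by a predicate. -/
def Transitive (A : Matrix (Fin (r + 1)) (Fin (r + 1)) F) (p : (Fin (r + 1) → K) → Prop) : Prop :=
  ∀ Z W, p Z → p W → ∃ g ∈ similitudes A, ∃ c : K, c ≠ 0 ∧ actK g Z = c • W

/-- A singular vector alone spans a degenerate line, so each is first completed to a hyperbolic
pair; Witt's theorem for nondegenerate planes then applies. -/
theorem transitive_vecQ (hA : A.IsSymm) (hdet : A.det ≠ 0) :
    Transitive (K := K) A (VecQ A) := by
  rintro Z W ⟨hZ, a, x, rfl, hx⟩ ⟨hW, b, y, rfl, hy⟩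
  have ha : a ≠ 0 := by rintro rfl; simp at hZ
  have hb : b ≠ 0 := by rintro rfl; simp at hW
  have hx0 : x ≠ 0 := by rintro rfl; simp at hZ
  have hy0 : y ≠ 0 := by rintro rfl; simp at hW
  obtain ⟨x', h1, h2⟩ := exists_hyperbolic_partner Δ.two_ne (formF A) (formF_symm hA)
    (formF_nondegenerate hdet) x hx0 hx
  obtain ⟨y', h3, h4⟩ := exists_hyperbolic_partner Δ.two_ne (formF A) (formF_symm hA)
    (formF_nondegenerate hdet) y hy0 hy
  obtain ⟨g, hg, hgx, -⟩ := exists_isometry_pair Δ.two_ne (formF A) (formF_symm hA) x x' y y'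
    (by rw [hx, hy]) (by rw [h2, h4]) (by rw [h1, h3]) (by rw [hx, h1]; simp)
  obtain ⟨G, hG, hGg⟩ := exists_similitude g hg
  refine ⟨G, hG, a / b, div_ne_zero ha hb, ?_⟩
  rw [actK_smul, actK_incl, hGg, hgx, smul_smul, div_mul_cancel₀ _ hb]

theorem transitive_vecO [Finite K] (hA : A.IsSymm) (hdet : A.det ≠ 0) :
    Transitive (K := K) A (VecO A) := by
  intro Z W hZ hW
  obtain ⟨x, y, rfl⟩ := exists_incl_add Δ Z
  obtain ⟨x', y', rfl⟩ := exists_incl_add Δ W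
  obtain ⟨hx, hy, hxy⟩ := forms_eq_zero Δ hA hZ.2.1 (c := 0) (by rw [hZ.2.2.1]; simp)
  obtain ⟨hx', hy', hxy'⟩ := forms_eq_zero Δ hA hW.2.1 (c := 0) (by rw [hW.2.2.1]; simp)
  obtain ⟨g, hg, h1, h2⟩ := exists_isometry_of_singular_pair Δ.two_ne (formF A) (formF_symm hA)
    (formF_nondegenerate hdet) x y x' y' (linearIndependent_of_not_vecQ hZ.vecH hZ.2.2.2)
    hx hy hxy (linearIndependent_of_not_vecQ hW.vecH hW.2.2.2) hx' hy' hxy'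
  obtain ⟨G, hG, hGg⟩ := exists_similitude g hg
  refine ⟨G, hG, 1, one_ne_zero, ?_⟩
  rw [actK_add, actK_smul, actK_incl, actK_incl, hGg, hGg, h1, h2, one_smul]

theorem exists_similitude_of_formK_eq [Finite K] (hA : A.IsSymm)
    {Z W : Fin (r + 1) → K} (hZ : herm K A Z Z = 0) (hW : herm K A W W = 0)
    (h0 : formK K A Z Z ≠ 0) (h : formK K A Z Z = formK K A W W) :
    ∃ g ∈ similitudes A, actK g Z = W := by
  obtain ⟨x, y, rfl⟩ := exists_incl_add Δ Z
  obtain ⟨x', y', rfl⟩ := exists_incl_add Δ W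
  rw [formK_incl_add Δ hA, formK_incl_add Δ hA] at h
  rw [formK_incl_add Δ hA] at h0
  rw [herm_incl_add Δ hA, map_eq_zero_iff _ (algebraMap F K).injective] at hZ hW
  obtain ⟨h1, h2⟩ := Δ.ext h
  have hxx : formF A x x = formF A x' x' :=
    mul_left_cancel₀ Δ.two_ne (by linear_combination h1 + hZ - hW)
  have hyy : formF A y y = formF A y' y' :=
    mul_left_cancel₀ Δ.d_ne (by linear_combination hxx - hZ + hW)
  have hxy : formF A x y = formF A x' y' := mul_left_cancel₀ Δ.two_ne h2
  obtain ⟨g, hg, h3, h4⟩ := exists_isometry_pair Δ.two_ne (formF A) (formF_symm hA) x y x' y'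
    -- Since `B(x, x) = d B(y, y)`, the discriminant is minus the norm of `B(x, y) + δ B(y, y)`. It
    -- vanishes only if all three products do, which would make the `K`-bilinear value zero.
    hxx hyy hxy (by
      intro hd
      have e1 : (algebraMap F K (formF A x y) + δ * algebraMap F K (formF A y y)) *
          (algebraMap F K (formF A x y) + δ * algebraMap F K (- formF A y y)) = 0 := by
        have : formF A x y ^ 2 - d * formF A y y ^ 2 = 0 := by
          linear_combination (-1 : F) * hd + formF A y y * hZ
        have e := congrArg (algebraMap F K) this
        simp only [map_sub, map_mul, map_pow, ← Δ.sq, map_zero] at e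
        rw [map_neg]
        linear_combination e
      have e2 : formF A x y = 0 ∧ formF A y y = 0 := by
        rcases mul_eq_zero.1 e1 with e | e
        · exact Δ.eq_zero e
        · exact ⟨(Δ.eq_zero e).1, neg_eq_zero.1 (Δ.eq_zero e).2⟩
      apply h0
      have : formF A x x = 0 := by linear_combination hZ + d * e2.2
      rw [this, e2.1, e2.2]; simp)
  obtain ⟨G, hG, hGg⟩ := exists_similitude g hg
  refine ⟨G, hG, ?_⟩
  rw [actK_add, actK_smul, actK_incl, actK_incl, hGg, hGg, h3, h4]

theorem exists_similitude_of_isSquare [Finite K] (hA : A.IsSymm)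
    {Z W : Fin (r + 1) → K} (hZ : herm K A Z Z = 0) (hW : herm K A W W = 0)
    (hZ0 : formK K A Z Z ≠ 0) (hW0 : formK K A W W ≠ 0)
    (h : IsSquare ((2 * δ * formK K A Z Z) * (2 * δ * formK K A W W))) :
    ∃ g ∈ similitudes A, ∃ c : K, c ≠ 0 ∧ actK g Z = c • W := by
  obtain ⟨s, hs⟩ := h
  have h2 := Δ.two_ne'
  have hδ := Δ.ne_zero
  have hs0 : s ≠ 0 := by
    rintro rfl
    simp [h2, hδ, hZ0, hW0] at hs
  -- Chosen so that `c² B(W, W) = B(Z, Z)`, given that the product of the two values times `(2 δ)²`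
  -- is `s²`.
  let c := s / (2 * δ * formK K A W W)
  have hc : c ≠ 0 := div_ne_zero hs0 (mul_ne_zero (mul_ne_zero h2 hδ) hW0)
  obtain ⟨g, hg, h1⟩ := exists_similitude_of_formK_eq Δ hA (W := c • W) hZ
    (by rw [herm_smul_smul, hW, mul_zero]) hZ0 (by
      rw [formK_smul_smul]
      simp only [c]
      field_simp
      linear_combination hs)
  exact ⟨g, hg, c, hc, h1⟩

theorem transitive_vecS [Finite K] (hA : A.IsSymm) : Transitive (K := K) A (VecS δ A) :=
  fun _ _ hZ hW => exists_similitude_of_isSquare Δ hA hZ.1 hW.1 hZ.2.1 hW.2.1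
    (hZ.2.2.mul hW.2.2)

/-- The product of two nonsquares of a finite field is a square, so the previous criterion applies
here as well. -/
theorem transitive_vecE [Finite K] (hA : A.IsSymm) : Transitive (K := K) A (VecE δ A) := by
  classical
  intro Z W hZ hW
  let := Fintype.ofFinite K
  refine exists_similitude_of_isSquare Δ hA hZ.1 hW.1 hZ.2.1 hW.2.1 ?_
  have h2 : ringChar K ≠ 2 := fun h => Δ.two_ne' (by
    have h' := CharP.cast_eq_zero K (ringChar K)
    rw [h] at h'
    exact_mod_cast h')
  have e1 := quadraticChar_neg_one_iff_not_isSquare.2 hZ.2.2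
  have e2 := quadraticChar_neg_one_iff_not_isSquare.2 hW.2.2
  refine (quadraticChar_one_iff_isSquare ?_).1 (by rw [map_mul, e1, e2]; norm_num)
  exact mul_ne_zero (mul_ne_zero (mul_ne_zero Δ.two_ne' Δ.ne_zero) hZ.2.1)
    (mul_ne_zero (mul_ne_zero Δ.two_ne' Δ.ne_zero) hW.2.1)

omit Δ [Finite F] in
/-- A nonempty invariant predicate on which the similitudes are transitive describes an orbit. -/
theorem orbit_eq_pointsOf {p : (Fin (r + 1) → K) → Prop} (hp : Homogeneous p)
    (hinv : Invariant A p) (htr : Transitive A p) (P : ℙ K (Fin (r + 1) → K))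
    (hP : P ∈ pointsOf p) : MulAction.orbit (groupG K A) P = pointsOf p := by
  have hP : p P.rep := hP
  ext R
  constructor
  · rintro ⟨⟨_, g, hg, rfl⟩, rfl⟩
    rw [← Projectivization.mk_rep P]
    have := (mk_mem_pointsOf hp _ (actK_ne_zero g P.rep_nonzero)).2 (hinv g hg _ hP)
    exact this
  · intro hR
    obtain ⟨g, hg, c, hc, h⟩ := htr P.rep R.rep hP hR
    refine ⟨⟨_, g, hg, rfl⟩, ?_⟩
    have : Projectivization.mk K (actK g P.rep) (actK_ne_zero g P.rep_nonzero) = R := by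
      conv_rhs => rw [← Projectivization.mk_rep R]
      rw [Projectivization.mk_eq_mk_iff']
      exact ⟨c, h.symm⟩
    rw [← this]
    conv_lhs => rw [← Projectivization.mk_rep P]
    rfl

end Group

/-! ### Counting by fibres and passing between vectors and points. -/

section Counting

theorem card_prod_subtype {α β : Type*} [Fintype α] [Finite β] (P : α → β → Prop) :
    Nat.card {p : α × β // P p.1 p.2} = ∑ a, Nat.card {b // P a b} := by
  rw [Nat.card_congr (Equiv.subtypeProdEquivSigmaSubtype P), Nat.card_sigma]

theorem sum_card_comm {α β : Type*} [Fintype α] [Fintype β] (P : α → β → Prop) :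
    ∑ a, Nat.card {b // P a b} = ∑ b, Nat.card {a // P a b} := by
  rw [← card_prod_subtype, ← card_prod_subtype]
  exact Nat.card_congr ((Equiv.prodComm α β).subtypeEquiv fun p => Iff.rfl)

theorem card_true {α : Type*} : Nat.card {_x : α // True} = Nat.card α :=
  Nat.card_congr (Equiv.subtypeUnivEquiv fun _ => trivial)

theorem card_fiber {G H : Type*} [AddGroup G] [AddGroup H] (φ : G →+ H)
    (hφ : Function.Surjective φ) (c : H) :
    Nat.card {x // φ x = c} * Nat.card H = Nat.card G := by
  obtain ⟨x₀, hx₀⟩ := hφ c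
  have h1 : Nat.card {x // φ x = c} = Nat.card φ.ker :=
    Nat.card_congr ⟨fun x => ⟨x - x₀, by rw [AddMonoidHom.mem_ker, map_sub, x.2, hx₀, sub_self]⟩,
      fun y => ⟨y + x₀, by rw [map_add, (AddMonoidHom.mem_ker).1 y.2, hx₀, zero_add]⟩,
      fun x => by simp, fun y => by simp⟩
  have h2 := AddSubgroup.card_mul_index φ.ker
  rw [AddSubgroup.index_ker, AddMonoidHom.range_eq_top.2 hφ, AddSubgroup.card_top] at h2
  rw [h1, h2]

theorem card_dotProduct_eq {L : Type*} [Field L] [Finite L] {ι : Type*} [Fintype ι]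
    (Y : ι → L) (hY : Y ≠ 0) (c : L) :
    Nat.card {X : ι → L // X ⬝ᵥ Y = c} * Nat.card L = Nat.card L ^ Fintype.card ι := by
  classical
  let φ : (ι → L) →+ L :=
    { toFun := fun X => X ⬝ᵥ Y, map_zero' := zero_dotProduct Y,
      map_add' := fun X X' => add_dotProduct X X' Y }
  have hφ : Function.Surjective φ := fun c => by
    obtain ⟨i, hi⟩ := Function.ne_iff.1 hY
    have hi : Y i ≠ 0 := hi
    refine ⟨Pi.single i (c / Y i), ?_⟩
    change Pi.single i (c / Y i) ⬝ᵥ Y = c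
    rw [single_dotProduct, div_mul_cancel₀ _ hi]
  have := card_fiber φ hφ c
  rw [Nat.card_fun, Nat.card_eq_fintype_card (α := ι)] at this
  exact this

variable {K : Type*} [Field K] {r : ℕ}

/-- The number of vectors satisfying a homogeneous predicate. -/
theorem card_homogeneous [Finite K] {p : (Fin (r + 1) → K) → Prop} (hp : Homogeneous p) :
    Nat.card {Z // p Z} = (Nat.card K - 1) * (pointsOf p).ncard := by
  classical
  let f : (pointsOf p × {c : K // c ≠ 0}) ≃ {Z // p Z} :=
    Equiv.ofBijective (fun x => ⟨x.2.1 • x.1.1.rep, hp.smul _ _ x.2.2 x.1.2⟩) (by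
      constructor
      · rintro ⟨⟨P, hP⟩, c, hc⟩ ⟨⟨R, hR⟩, c', hc'⟩ h
        have h1 : c • P.rep = c' • R.rep := congrArg Subtype.val h
        have hPR : P = R := by
          rw [← Projectivization.mk_rep P, ← Projectivization.mk_rep R,
            Projectivization.mk_eq_mk_iff']
          exact ⟨c⁻¹ * c', by rw [← smul_smul, ← h1, smul_smul, inv_mul_cancel₀ hc, one_smul]⟩
        subst hPR
        have hcc : c = c' := smul_left_injective K P.rep_nonzero h1
        subst hcc
        rfl
      · rintro ⟨Z, hZ⟩
        obtain ⟨a, ha⟩ := Projectivization.exists_smul_eq_mk_rep K Z (hp.ne_zero _ hZ)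
        refine ⟨(⟨Projectivization.mk K Z (hp.ne_zero _ hZ),
          (mk_mem_pointsOf hp _ _).2 hZ⟩, ⟨(a : K)⁻¹, inv_ne_zero a.ne_zero⟩), Subtype.ext ?_⟩
        change (a : K)⁻¹ • (Projectivization.mk K Z (hp.ne_zero _ hZ)).rep = Z
        rw [← ha, Units.smul_def, smul_smul, inv_mul_cancel₀ a.ne_zero, one_smul])
  rw [← Nat.card_congr f, Nat.card_prod, mul_comm, Nat.card_coe_set_eq]
  congr 1
  rw [Nat.card_congr unitsEquivNeZero.symm, Nat.card_units]

variable {F : Type*} [Field F] [Algebra F K]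

theorem embed_injective : Function.Injective (embed (F := F) (r := r) K) := by
  intro P R h
  induction P using Projectivization.ind with
  | h x hx =>
    induction R using Projectivization.ind with
    | h y hy =>
      rw [embed, Projectivization.map_mk, Projectivization.map_mk,
        Projectivization.mk_eq_mk_iff'] at h
      obtain ⟨a, ha⟩ := h
      obtain ⟨i, hi⟩ := Function.ne_iff.1 hy
      have hi : algebraMap F K (y i) ≠ 0 := by simpa using hi
      have hai : a * algebraMap F K (y i) = algebraMap F K (x i) := congrFun ha i
      have ha' : a = algebraMap F K (x i / y i) := by
        rw [map_div₀, eq_div_iff hi, hai]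
      rw [Projectivization.mk_eq_mk_iff']
      refine ⟨x i / y i, incl_injective F K r ?_⟩
      rw [map_smulₛₗ, ← ha', ha]

/-- Counting the scalar multiples over `K` of the vectors over `F` with a homogeneous property. -/
theorem card_smul_incl [Finite F] [Finite K] {p : (Fin (r + 1) → F) → Prop} (hp : Homogeneous p) :
    Nat.card {Z : Fin (r + 1) → K // ∃ (c : K) (x : Fin (r + 1) → F),
      c ≠ 0 ∧ p x ∧ Z = c • incl F K r x} * (Nat.card F - 1) =
      (Nat.card K - 1) * Nat.card {x // p x} := by
  have hp' : Homogeneous (fun Z : Fin (r + 1) → K => ∃ (c : K) (x : Fin (r + 1) → F),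
      c ≠ 0 ∧ p x ∧ Z = c • incl F K r x) := by
    refine ⟨?_, ?_⟩
    · rintro _ ⟨c, x, hc, hx, rfl⟩
      exact smul_ne_zero hc (incl_ne_zero (hp.ne_zero x hx))
    · rintro a _ ha ⟨c, x, hc, hx, rfl⟩
      exact ⟨a * c, x, mul_ne_zero ha hc, hx, smul_smul _ _ _⟩
  have himg : pointsOf (fun Z : Fin (r + 1) → K => ∃ (c : K) (x : Fin (r + 1) → F),
      c ≠ 0 ∧ p x ∧ Z = c • incl F K r x) = embed K '' pointsOf p := by
    ext P
    constructor
    · rintro ⟨c, x, hc, hx, h⟩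
      refine ⟨Projectivization.mk F x (hp.ne_zero x hx), (mk_mem_pointsOf hp _ _).2 hx, ?_⟩
      rw [embed, Projectivization.map_mk, ← Projectivization.mk_rep P,
        Projectivization.mk_eq_mk_iff']
      exact ⟨c⁻¹, by rw [h, smul_smul, inv_mul_cancel₀ hc, one_smul]⟩
    · rintro ⟨R, hR, rfl⟩
      have hR : p R.rep := hR
      rw [← Projectivization.mk_rep R, embed, Projectivization.map_mk, mk_mem_pointsOf hp']
      exact ⟨1, R.rep, one_ne_zero, hR, (one_smul _ _).symm⟩
  rw [card_homogeneous hp', card_homogeneous hp, himg,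
    Set.ncard_image_of_injective _ embed_injective]
  ring

end Counting

/-! ### Hyperbolic coordinates and the count of singular vectors. -/

section Frame

variable {L V : Type*} [Field L] [AddCommGroup V] [Module L V] {ι : Type*} [Fintype ι]

/-- The linear combinations of the vectors of a frame. -/
def frameMap (e f : ι → V) (g : V) : ((ι → L) × (ι → L) × L) →ₗ[L] V :=
  (Fintype.linearCombination L e).coprod
    ((Fintype.linearCombination L f).coprod (LinearMap.toSpanSingleton L V g))

theorem frameMap_apply (e f : ι → V) (g : V) (p : (ι → L) × (ι → L) × L) :
    frameMap e f g p = ∑ i, p.1 i • e i + (∑ i, p.2.1 i • f i + p.2.2 • g) := by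
  simp [frameMap, Fintype.linearCombination_apply]

variable [DecidableEq ι] {B : LinearMap.BilinForm L V} {e f : ι → V} {g : V}

theorem HypFrame.form_frameMap (H : HypFrame B e f g) (hs : ∀ x y, B x y = B y x)
    (p p' : (ι → L) × (ι → L) × L) :
    B (frameMap e f g p) (frameMap e f g p') =
      p.1 ⬝ᵥ p'.2.1 + p.2.1 ⬝ᵥ p'.1 + p.2.2 * p'.2.2 * B g g := by
  have fe : ∀ i j, B (f i) (e j) = if j = i then 1 else 0 := fun i j => by rw [hs, H.ef]
  have ge : ∀ i, B g (e i) = 0 := fun i => by rw [hs, H.eg]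
  have gf : ∀ i, B g (f i) = 0 := fun i => by rw [hs, H.fg]
  simp only [frameMap_apply, map_add, map_sum, map_smul, LinearMap.add_apply, LinearMap.sum_apply,
    LinearMap.smul_apply, smul_eq_mul, H.ee, H.ff, H.ef, H.eg, H.fg, fe, ge, gf, mul_zero,
    Finset.sum_const_zero, mul_ite, mul_one, Finset.sum_ite_eq, Finset.sum_ite_eq',
    Finset.mem_univ, if_true, add_zero, zero_add, dotProduct]
  have : ∀ (a b : ι → L), ∑ i, a i * b i = ∑ i, b i * a i := fun a b =>
    Finset.sum_congr rfl fun i _ => mul_comm _ _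
  rw [this p.1, this p.2.1]
  ring

/-- The coordinates of a vector are recovered, up to the factor `B(g, g)`, from its products with `f
i`, `e i` and `g`; surjectivity follows by dimension. -/
theorem HypFrame.bijective [FiniteDimensional L V] (H : HypFrame B e f g)
    (hs : ∀ x y, B x y = B y x)
    (hd : Module.finrank L V = 2 * Fintype.card ι + 1) :
    Function.Bijective (frameMap (L := L) e f g) := by
  have hinj : Function.Injective (frameMap (L := L) e f g) := by
    rw [injective_iff_map_eq_zero]
    intro p hp
    have h : ∀ p' : (ι → L) × (ι → L) × L, p.1 ⬝ᵥ p'.2.1 + p.2.1 ⬝ᵥ p'.1 + p.2.2 * p'.2.2 * B g g = 0 := fun p' => by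
      rw [← H.form_frameMap hs, hp]; simp
    refine Prod.ext (funext fun i => ?_) (Prod.ext (funext fun i => ?_) ?_)
    · simpa using h (0, Pi.single i 1, 0)
    · simpa using h (Pi.single i 1, 0, 0)
    · simpa [H.gg] using h (0, 0, 1)
  refine ⟨hinj, (LinearMap.injective_iff_surjective_of_finrank_eq_finrank ?_).1 hinj⟩
  rw [hd, Module.finrank_prod, Module.finrank_prod, Module.finrank_self,
    Module.finrank_fintype_fun_eq_card]
  ring

/-- For `Y = 0` the scalar is forced to be zero and the vector is free; for `Y ≠ 0` the scalar is
free and the vector runs over an affine hyperplane. Both cases give the same number, so the count of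
singular vectors does not depend on `Y`. -/
theorem card_quadratic [Finite L] [Nonempty ι] (h2 : (2 : L) ≠ 0) (a : L) (ha : a ≠ 0)
    (Y : ι → L) :
    Nat.card {p : L × (ι → L) // p.2 ⬝ᵥ Y + Y ⬝ᵥ p.2 + p.1 * p.1 * a = 0} =
      Nat.card L ^ Fintype.card ι := by
  classical
  let := Fintype.ofFinite L
  rw [card_prod_subtype (fun (t : L) (X : ι → L) => X ⬝ᵥ Y + Y ⬝ᵥ X + t * t * a = 0)]
  by_cases hY : Y = 0
  · subst hY
    rw [Finset.sum_eq_single 0]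
    · simp only [dotProduct_zero, zero_dotProduct, mul_zero, zero_mul, add_zero]
      rw [card_true, Nat.card_fun, Nat.card_eq_fintype_card (α := ι)]
    · intro t _ ht
      have : IsEmpty {X : ι → L // X ⬝ᵥ 0 + 0 ⬝ᵥ X + t * t * a = 0} :=
        ⟨fun X => by have := X.2; simp [ht, ha] at this⟩
      exact Nat.card_of_isEmpty
    · simp
  · have hL : 0 < Nat.card L := Nat.card_pos
    have key : ∀ t : L, Nat.card {X : ι → L // X ⬝ᵥ Y + Y ⬝ᵥ X + t * t * a = 0} * Nat.card L =
        Nat.card L ^ Fintype.card ι := fun t => by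
      rw [← card_dotProduct_eq Y hY (-(t * t * a) / 2)]
      congr 1
      refine Nat.card_congr (Equiv.subtypeEquivRight fun X => ?_)
      rw [dotProduct_comm Y X, eq_div_iff h2]
      constructor <;> intro h <;> linear_combination h
    refine Nat.eq_of_mul_eq_mul_right hL ?_
    rw [Finset.sum_mul, Finset.sum_congr rfl fun t _ => key t, Finset.sum_const, Finset.card_univ,
      smul_eq_mul, Nat.card_eq_fintype_card, mul_comm]

/-- The number of singular vectors with a prescribed condition on their products with the vectors
of one totally singular half of the frame. -/
theorem HypFrame.card_singular [Finite L] [FiniteDimensional L V] [Nonempty ι]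
    (H : HypFrame B e f g) (h2 : (2 : L) ≠ 0) (hs : ∀ x y, B x y = B y x)
    (hd : Module.finrank L V = 2 * Fintype.card ι + 1) (P : (ι → L) → Prop) :
    Nat.card {x // B x x = 0 ∧ P (fun i => B (e i) x)} =
      Nat.card {Y // P Y} * Nat.card L ^ Fintype.card ι := by
  classical
  let := Fintype.ofFinite L
  -- The `f`-coordinates `Y` are put first: `Y i = B(e i, x)` is what `P` constrains, and the fibre
  -- over each `Y` is counted by `card_quadratic`.
  let φ : ((ι → L) × (L × (ι → L))) ≃ V :=
    ((Equiv.prodAssoc _ _ _).symm.trans (Equiv.prodComm _ _)).trans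
      ((Equiv.prodCongr (Equiv.refl (ι → L)) (Equiv.refl ((ι → L) × L))).trans
      (Equiv.ofBijective _ (H.bijective hs hd)))
  have hφ : ∀ p, φ p = frameMap e f g (p.2.2, p.1, p.2.1) := fun p => rfl
  have h1 : ∀ p : (ι → L) × (L × (ι → L)), (B (φ p) (φ p) = 0 ∧ P (fun i => B (e i) (φ p))) ↔
      (P p.1 ∧ p.2.2 ⬝ᵥ p.1 + p.1 ⬝ᵥ p.2.2 + p.2.1 * p.2.1 * B g g = 0) := fun p => by
    have : (fun i => B (e i) (φ p)) = p.1 := funext fun i => by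
      have he : e i = frameMap (L := L) e f g (Pi.single i 1, 0, 0) := by
        simp [frameMap_apply, Pi.single_apply]
      rw [he, hφ, H.form_frameMap hs]
      simp
    rw [this, hφ, H.form_frameMap hs, and_comm]
  rw [← Nat.card_congr (φ.subtypeEquiv (q := fun x => B x x = 0 ∧ P (fun i => B (e i) x))
    fun p => (h1 p).symm),
    card_prod_subtype (fun (Y : ι → L) (p : L × (ι → L)) =>
      P Y ∧ p.2 ⬝ᵥ Y + Y ⬝ᵥ p.2 + p.1 * p.1 * B g g = 0)]
  have h3 : ∀ Y : ι → L, Nat.card {p : L × (ι → L) //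
      P Y ∧ p.2 ⬝ᵥ Y + Y ⬝ᵥ p.2 + p.1 * p.1 * B g g = 0} =
      if P Y then Nat.card L ^ Fintype.card ι else 0 := fun Y => by
    split_ifs with hY
    · simp only [hY, true_and]
      exact card_quadratic h2 _ H.gg Y
    · have : IsEmpty {p : L × (ι → L) //
        P Y ∧ p.2 ⬝ᵥ Y + Y ⬝ᵥ p.2 + p.1 * p.1 * B g g = 0} := ⟨fun p => hY p.2.1⟩
      exact Nat.card_of_isEmpty
  rw [Finset.sum_congr rfl fun Y _ => h3 Y, ← Finset.sum_filter, Finset.sum_const, smul_eq_mul,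
    Nat.card_eq_fintype_card (α := {Y // P Y}), Fintype.card_subtype]

end Frame

theorem card_eq_card_ne_zero_add_one {V : Type*} [Zero V] [Finite V] (p : V → Prop) (h : p 0) :
    Nat.card {x // p x} = Nat.card {x // x ≠ 0 ∧ p x} + 1 := by
  classical
  have e : {x // p x} ≃ Option {x // x ≠ 0 ∧ p x} :=
    { toFun := fun x => if hx : x.1 = 0 then none else some ⟨x.1, hx, x.2⟩
      invFun := fun o => o.elim ⟨0, h⟩ fun x => ⟨x.1, x.2.2⟩
      left_inv := fun x => by
        by_cases hx : x.1 = 0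
        · simp only [hx, dite_true]; exact Subtype.ext hx.symm
        · simp [hx]
      right_inv := fun o => by
        cases o with
        | none => simp
        | some x => simp [x.2.1] }
  rw [Nat.card_congr e, Finite.card_option]

section SingularVectors

variable {F : Type*} [Field F] [Finite F] {r m : ℕ} {A : Matrix (Fin (r + 1)) (Fin (r + 1)) F}

theorem exists_frame (h2 : (2 : F) ≠ 0) (hA : A.IsSymm) (hdet : A.det ≠ 0) (hr : r = 2 * m) :
    ∃ (e f : Fin m → (Fin (r + 1) → F)) (g : Fin (r + 1) → F), HypFrame (formF A) e f g :=
  exists_hypFrame h2 m (formF A) (formF_symm hA) (formF_nondegenerate hdet) (by simp [hr])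

/-- The number of singular vectors of the quadratic form. -/
theorem card_singular_vectors (h2 : (2 : F) ≠ 0) (hA : A.IsSymm) (hdet : A.det ≠ 0)
    (hr : r = 2 * m) (hm : 0 < m) :
    Nat.card {x // formF A x x = 0} = Nat.card F ^ r := by
  have : Nonempty (Fin m) := ⟨⟨0, hm⟩⟩
  obtain ⟨e, f, g, H⟩ := exists_frame h2 hA hdet hr
  have h := H.card_singular h2 (formF_symm hA) (by simp [hr]) (fun _ => True)
  simp only [and_true] at h
  rw [h, card_true, Nat.card_fun, Nat.card_eq_fintype_card (α := Fin m), Fintype.card_fin, hr,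
    ← pow_add, two_mul]

/-- The number of singular vectors with a prescribed product with a given singular vector. -/
theorem card_singular_eq (h2 : (2 : F) ≠ 0) (hA : A.IsSymm) (hdet : A.det ≠ 0)
    (hr : r = 2 * m) (hm : 0 < m) (x : Fin (r + 1) → F) (hx0 : x ≠ 0) (hx : formF A x x = 0)
    (c : F) :
    Nat.card {y // formF A y y = 0 ∧ formF A x y = c} * Nat.card F = Nat.card F ^ r := by
  have : Nonempty (Fin m) := ⟨⟨0, hm⟩⟩
  obtain ⟨e, f, g, H⟩ := exists_frame h2 hA hdet hr
  let i : Fin m := ⟨0, hm⟩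
  obtain ⟨x', h3, h4⟩ := exists_hyperbolic_partner h2 (formF A) (formF_symm hA)
    (formF_nondegenerate hdet) x hx0 hx
  have h5 := H.ef i i
  rw [if_pos rfl] at h5
  -- An isometry moves `x` to the frame vector `e i`, so that the prescribed product becomes one
  -- coordinate of `Y`.
  obtain ⟨s, hs, hsx, -⟩ := exists_isometry_pair h2 (formF A) (formF_symm hA) x x' (e i) (f i)
    (by rw [hx, H.ee]) (by rw [h4, H.ff]) (by rw [h3, h5]) (by rw [hx, h3]; simp)
  have h := H.card_singular h2 (formF_symm hA) (by simp [hr]) (fun Y => Y i = c)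
  have h6 := card_dotProduct_eq (L := F) (Pi.single i 1 : Fin m → F)
    (fun h => by simpa using congrFun h i) c
  simp only [dotProduct_single, mul_one] at h6
  rw [Nat.card_congr (s.toEquiv.subtypeEquiv (q := fun y => formF A y y = 0 ∧ formF A (e i) y = c)
    fun y => by
      change _ ↔ formF A (s y) (s y) = 0 ∧ formF A (e i) (s y) = c
      rw [hs, ← hsx, hs]), h, mul_right_comm, h6, hr, ← pow_add, Fintype.card_fin, two_mul]

end SingularVectors

/-! ### The number of isotropic vectors of the Hermitian form. -/

section Isotropic

variable {F K : Type*} [Field F] [Field K] [Algebra F K] [Finite F] {r m : ℕ}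
  {A : Matrix (Fin (r + 1)) (Fin (r + 1)) F}
  {ι : Type*} [DecidableEq ι] {e f : ι → Fin (r + 1) → F} {g : Fin (r + 1) → F}

omit [Finite F] in
theorem HypFrame.incl (H : HypFrame (formF A) e f g) :
    HypFrame (formK K A) (fun i => incl F K r (e i)) (fun i => incl F K r (f i))
      (incl F K r g) where
  ee i j := by rw [formK_incl, H.ee, map_zero]
  ff i j := by rw [formK_incl, H.ff, map_zero]
  ef i j := by rw [formK_incl, H.ef]; split_ifs <;> simp
  eg i := by rw [formK_incl, H.eg, map_zero]
  fg i := by rw [formK_incl, H.fg, map_zero]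
  gg := by rw [formK_incl]; simpa using H.gg

variable [Fintype ι]

/-- The coordinates over `K` with respect to a frame over `F`. -/
def frameK (K : Type*) [Field K] [Algebra F K] (e f : ι → Fin (r + 1) → F) (g : Fin (r + 1) → F) :
    ((ι → K) × (ι → K) × K) →ₗ[K] (Fin (r + 1) → K) :=
  frameMap (fun i => HermTight.incl F K r (e i)) (fun i => HermTight.incl F K r (f i))
    (HermTight.incl F K r g)

omit [DecidableEq ι] in
theorem tau_frameK (p : (ι → K) × (ι → K) × K) :
    tau F (frameK K e f g p) = frameK K e f g
      (fun i => frob F K (p.1 i), fun i => frob F K (p.2.1 i), frob F K p.2.2) := by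
  have hsum : ∀ (X : ι → K) (v : ι → Fin (r + 1) → F),
      tau F (∑ i, X i • HermTight.incl F K r (v i)) =
        ∑ i, frob F K (X i) • HermTight.incl F K r (v i) := fun X v => by
    funext j
    simp [tau, HermTight.incl, Finset.sum_apply]
  simp only [frameK, frameMap_apply, tau_add, hsum, tau_smul, tau_incl]

omit [Finite F] in
theorem formK_frameK (hA : A.IsSymm) (H : HypFrame (formF A) e f g)
    (p p' : (ι → K) × (ι → K) × K) :
    formK K A (frameK K e f g p) (frameK K e f g p') =
      p.1 ⬝ᵥ p'.2.1 + p.2.1 ⬝ᵥ p'.1 + p.2.2 * p'.2.2 * algebraMap F K (formF A g g) := by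
  rw [← formK_incl]
  exact H.incl.form_frameMap (formK_symm K hA) p p'

theorem herm_frameK (hA : A.IsSymm) (H : HypFrame (formF A) e f g)
    (p p' : (ι → K) × (ι → K) × K) :
    herm K A (frameK K e f g p) (frameK K e f g p') =
      p.1 ⬝ᵥ (fun i => frob F K (p'.2.1 i)) + p.2.1 ⬝ᵥ (fun i => frob F K (p'.1 i)) +
        p.2.2 * frob F K p'.2.2 * algebraMap F K (formF A g g) := by
  rw [herm_eq, tau_frameK, formK_frameK hA H]

omit [Finite F] in
theorem frameK_bijective (hA : A.IsSymm) (H : HypFrame (formF A) e f g)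
    (hr : r = 2 * Fintype.card ι) : Function.Bijective (frameK K e f g) :=
  H.incl.bijective (formK_symm K hA) (by simp [hr])

variable {δ : K} {d : F} (Δ : QuadExt F K δ d)

-- The trace condition fixes the `F`-part of `X ⬝ᵥ W` to be `c / 2` and leaves its `δ`-part free, so
-- the solutions fill `|F|` parallel affine hyperplanes.
omit [DecidableEq ι] in
include Δ in
theorem card_trace_eq [Finite K] (W : ι → K) (hW : W ≠ 0) (c : F) :
    Nat.card {X : ι → K // X ⬝ᵥ W + frob F K (X ⬝ᵥ W) = algebraMap F K c} * Nat.card F =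
      Nat.card K ^ Fintype.card ι := by
  classical
  let := Fintype.ofFinite F
  have hpos : 0 < Nat.card F := Nat.card_pos
  have h1 : ∀ b : F, Nat.card {X : ι → K // X ⬝ᵥ W = algebraMap F K (c / 2) + δ * algebraMap F K b}
      * Nat.card K = Nat.card K ^ Fintype.card ι := fun b => card_dotProduct_eq W hW _
  have h2 : Nat.card {X : ι → K // X ⬝ᵥ W + frob F K (X ⬝ᵥ W) = algebraMap F K c} =
      ∑ b : F, Nat.card {X : ι → K // X ⬝ᵥ W = algebraMap F K (c / 2) + δ * algebraMap F K b} := by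
    rw [← card_prod_subtype (fun (b : F) (X : ι → K) =>
      X ⬝ᵥ W = algebraMap F K (c / 2) + δ * algebraMap F K b)]
    have htwo := Δ.two_ne
    symm
    refine Nat.card_congr (Equiv.ofBijective (fun p => ⟨p.1.2, ?_⟩) ⟨?_, ?_⟩)
    · rw [p.2]
      simp only [map_add, map_mul, AlgHom.commutes, Δ.frob]
      have : algebraMap F K c = algebraMap F K (c / 2) + algebraMap F K (c / 2) := by
        rw [← map_add, ← mul_two, div_mul_cancel₀ _ htwo]
      rw [this]; ring
    · rintro ⟨⟨b, X⟩, h⟩ ⟨⟨b', X'⟩, h'⟩ hXX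
      have hX : X = X' := congrArg Subtype.val hXX
      subst hX
      have := (Δ.ext (h.symm.trans h')).2
      subst this
      rfl
    · rintro ⟨X, hX⟩
      obtain ⟨a, b, hab⟩ := Δ.exists_eq (X ⬝ᵥ W)
      refine ⟨⟨(b, X), ?_⟩, rfl⟩
      rw [hab] at hX
      simp only [map_add, map_mul, AlgHom.commutes, Δ.frob] at hX
      have h3 : algebraMap F K (2 * a) = algebraMap F K c := by
        rw [map_mul, map_ofNat, ← hX]; ring
      have h4 := (algebraMap F K).injective h3
      change X ⬝ᵥ W = _
      rw [hab, ← h4, mul_div_cancel_left₀ _ htwo]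
  have hK : Nat.card K = Nat.card F * Nat.card F := by rw [Δ.card, pow_two]
  refine Nat.eq_of_mul_eq_mul_right hpos ?_
  rw [mul_assoc, ← hK, h2, Finset.sum_mul, Finset.sum_congr rfl fun b _ => h1 b, Finset.sum_const,
    Finset.card_univ, smul_eq_mul, Nat.card_eq_fintype_card (α := F), mul_comm]

include Δ in
theorem exists_norm_eq [Finite K] (t : K) : ∃ c : F, t * frob F K t = algebraMap F K c := by
  obtain ⟨a, b, rfl⟩ := Δ.exists_eq t
  refine ⟨a * a - d * (b * b), ?_⟩
  simp only [map_add, map_sub, map_mul, AlgHom.commutes, Δ.frob, ← Δ.sq]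
  ring

include Δ in
/-- The number of isotropic vectors of the Hermitian form. -/
theorem card_isotropic [Finite K] (hA : A.IsSymm) (hdet : A.det ≠ 0) (hr : r = 2 * m) :
    (Nat.card {Z : Fin (r + 1) → K // herm K A Z Z = 0} : ℤ) =
      (Nat.card F : ℤ) ^ r + ((Nat.card F : ℤ) ^ r - 1) * (Nat.card F : ℤ) ^ (r + 1) := by
  classical
  let := Fintype.ofFinite K
  obtain ⟨e, f, g, H⟩ := exists_frame Δ.two_ne hA hdet hr
  have hbij := frameK_bijective (K := K) hA H (by simpa using hr)
  let φ : ((Fin m → K) × (K × (Fin m → K))) ≃ (Fin (r + 1) → K) :=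
    ((Equiv.prodAssoc _ _ _).symm.trans (Equiv.prodComm _ _)).trans (Equiv.ofBijective _ hbij)
  have hφ : ∀ p, φ p = frameK K e f g (p.2.2, p.1, p.2.1) := fun p => rfl
  let a := algebraMap F K (formF A g g)
  have ha : a ≠ 0 := by simpa [a] using H.gg
  let τ : (Fin m → K) → (Fin m → K) := fun Y i => frob F K (Y i)
  have hτ : ∀ Y X : Fin m → K, Y ⬝ᵥ τ X = frob F K (X ⬝ᵥ τ Y) := fun Y X => by
    simp only [τ, dotProduct, map_sum, map_mul, Δ.frob_frob]
    exact Finset.sum_congr rfl fun i _ => mul_comm _ _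
  rw [← Nat.card_congr (φ.subtypeEquiv (p := fun p => p.2.2 ⬝ᵥ τ p.1 + frob F K (p.2.2 ⬝ᵥ τ p.1) +
      p.2.1 * frob F K p.2.1 * a = 0) fun p => by
        rw [hφ, herm_frameK hA H, ← hτ]),
    card_prod_subtype (fun (Y : Fin m → K) (p : K × (Fin m → K)) =>
      p.2 ⬝ᵥ τ Y + frob F K (p.2 ⬝ᵥ τ Y) + p.1 * frob F K p.1 * a = 0)]
  -- Here, unlike for the quadric, the fibres differ: `Y = 0` forces `t = 0` with `X` free, giving
  -- `q^r`; for `Y ≠ 0` each of the `q²` values of `t` leaves a trace condition with `q^(r - 1)`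
  -- solutions.
  have h1 : ∀ Y : Fin m → K, (Nat.card {p : K × (Fin m → K) //
      p.2 ⬝ᵥ τ Y + frob F K (p.2 ⬝ᵥ τ Y) + p.1 * frob F K p.1 * a = 0} : ℤ) =
      (Nat.card F : ℤ) ^ (r + 1) + if Y = 0 then
        (Nat.card F : ℤ) ^ r - (Nat.card F : ℤ) ^ (r + 1) else 0 := by
    intro Y
    rw [card_prod_subtype (fun (t : K) (X : Fin m → K) =>
      X ⬝ᵥ τ Y + frob F K (X ⬝ᵥ τ Y) + t * frob F K t * a = 0)]
    by_cases hY : Y = 0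
    · have hτY : τ Y = 0 := by funext i; simp [τ, hY]
      rw [if_pos hY, Finset.sum_eq_single 0]
      · simp only [hτY, dotProduct_zero, map_zero, mul_zero, zero_mul, add_zero]
        rw [card_true, Nat.card_fun, Nat.card_eq_fintype_card (α := Fin m), Fintype.card_fin,
          Δ.card, hr]
        push_cast
        ring
      · intro t _ ht
        have ht' : frob F K t ≠ 0 := (map_ne_zero_iff (frob F K) (frob F K).injective).2 ht
        have : IsEmpty {X : Fin m → K //
            X ⬝ᵥ τ Y + frob F K (X ⬝ᵥ τ Y) + t * frob F K t * a = 0} :=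
          ⟨fun X => by have := X.2; simp [hτY, ht, ha, ht'] at this⟩
        exact Nat.card_of_isEmpty
      · simp
    · have hτY : τ Y ≠ 0 := fun h => hY (funext fun i =>
        (map_eq_zero_iff (frob F K) (frob F K).injective).1 (congrFun h i))
      have hpos : 0 < Nat.card F := Nat.card_pos
      have h3 : ∀ t : K, Nat.card {X : Fin m → K //
          X ⬝ᵥ τ Y + frob F K (X ⬝ᵥ τ Y) + t * frob F K t * a = 0} * Nat.card F =
          Nat.card F ^ r := by
        intro t
        obtain ⟨c, hc⟩ := exists_norm_eq Δ t
        have h4 := card_trace_eq Δ (τ Y) hτY (-(c * formF A g g))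
        rw [Fintype.card_fin, Δ.card, ← pow_mul, ← hr] at h4
        rw [← h4]
        congr 1
        refine Nat.card_congr (Equiv.subtypeEquivRight fun X => ?_)
        rw [hc, map_neg, map_mul, add_eq_zero_iff_eq_neg]
      rw [if_neg hY, add_zero]
      norm_cast
      refine Nat.eq_of_mul_eq_mul_right hpos ?_
      rw [Finset.sum_mul, Finset.sum_congr rfl fun t _ => h3 t, Finset.sum_const,
        Finset.card_univ, smul_eq_mul, ← Nat.card_eq_fintype_card, Δ.card]
      ring
  push_cast
  rw [Finset.sum_congr rfl fun Y _ => h1 Y, Finset.sum_add_distrib, Finset.sum_const,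
    Finset.card_univ, Finset.sum_ite_eq' Finset.univ (0 : Fin m → K),
    if_pos (Finset.mem_univ _), ← Nat.card_eq_fintype_card, Nat.card_fun,
    Nat.card_eq_fintype_card (α := Fin m), Fintype.card_fin, Δ.card, ← pow_mul, ← hr]
  simp only [nsmul_eq_mul]
  push_cast
  ring

end Isotropic

theorem one_lt_card {L : Type*} [Field L] [Finite L] : (1 : ℤ) < Nat.card L := by
  exact_mod_cast Finite.one_lt_card

theorem card_sub_one_cast {L : Type*} [Field L] [Finite L] :
    ((Nat.card L - 1 : ℕ) : ℤ) = (Nat.card L : ℤ) - 1 := by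
  have : 0 < Nat.card L := Nat.card_pos
  omega

theorem card_or {α : Type*} [Finite α] (p q : α → Prop) (h : ∀ x, p x → ¬ q x) :
    Nat.card {x // p x ∨ q x} = Nat.card {x // p x} + Nat.card {x // q x} := by
  classical
  let := Fintype.ofFinite α
  rw [Nat.card_eq_fintype_card, Nat.card_eq_fintype_card, Nat.card_eq_fintype_card]
  refine Fintype.card_subtype_or_disjoint p q ?_
  rw [Pi.disjoint_iff]
  exact fun x => disjoint_iff_inf_le.2 fun hx => h x hx.1 hx.2

/-! ### The sizes of the four classes. -/

section Sizes

variable {F K : Type*} [Field F] [Field K] [Algebra F K] [Finite F] [Finite K] {r m : ℕ}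
  {A : Matrix (Fin (r + 1)) (Fin (r + 1)) F} {δ : K} {d : F} (Δ : QuadExt F K δ d)

omit [Finite F] [Finite K] in
theorem vecQ_iff (Z : Fin (r + 1) → K) : VecQ A Z ↔ ∃ (c : K) (x : Fin (r + 1) → F),
    c ≠ 0 ∧ (x ≠ 0 ∧ formF A x x = 0) ∧ Z = c • incl F K r x := by
  constructor
  · rintro ⟨h0, c, x, rfl, hx⟩
    refine ⟨c, x, ?_, ⟨?_, hx⟩, rfl⟩
    · rintro rfl; simp at h0
    · rintro rfl; simp at h0
  · rintro ⟨c, x, hc, ⟨hx0, hx⟩, rfl⟩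
    exact ⟨smul_ne_zero hc (incl_ne_zero hx0), c, x, rfl, hx⟩

include Δ

/-- There are `q^r - 1` nonzero singular vectors over `F`, and each point they define carries `q² -
1` vectors over `K` instead of `q - 1` over `F`. -/
theorem card_vecQ (hA : A.IsSymm) (hdet : A.det ≠ 0) (hr : r = 2 * m) (hm : 0 < m) :
    (Nat.card {Z : Fin (r + 1) → K // VecQ A Z} : ℤ) =
      ((Nat.card F : ℤ) + 1) * ((Nat.card F : ℤ) ^ r - 1) := by
  have hp : Homogeneous (fun x : Fin (r + 1) → F => x ≠ 0 ∧ formF A x x = 0) :=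
    ⟨fun _ h => h.1, fun c x hc h => ⟨smul_ne_zero hc h.1, by simp [h.2]⟩⟩
  have h1 := card_smul_incl (K := K) hp
  rw [← Nat.card_congr (Equiv.subtypeEquivRight vecQ_iff)] at h1
  have h2 := card_eq_card_ne_zero_add_one (fun x : Fin (r + 1) → F => formF A x x = 0) (by simp)
  rw [card_singular_vectors Δ.two_ne hA hdet hr hm] at h2
  have h3 := one_lt_card (L := F)
  zify at h1 h2
  rw [card_sub_one_cast, card_sub_one_cast, Δ.card] at h1
  push_cast at h1
  refine mul_right_cancel₀ (sub_ne_zero.2 h3.ne') ?_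
  rw [h1]
  linear_combination (-((Nat.card F : ℤ) ^ 2 - 1)) * h2

/-- This is the only intersection number that is computed directly; it supplies `ε 0 0 = 0`. -/
theorem card_vecQ_perp (hA : A.IsSymm) (hdet : A.det ≠ 0) (hr : r = 2 * m) (hm : 0 < m)
    (x : Fin (r + 1) → F) (hx0 : x ≠ 0) (hx : formF A x x = 0) :
    (Nat.card {Z : Fin (r + 1) → K // VecQ A Z ∧ herm K A Z (incl F K r x) = 0} : ℤ) =
      ((Nat.card F : ℤ) + 1) * ((Nat.card F : ℤ) ^ (r - 1) - 1) := by
  have hp : Homogeneous (fun y : Fin (r + 1) → F =>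
      y ≠ 0 ∧ formF A y y = 0 ∧ formF A x y = 0) :=
    ⟨fun _ h => h.1, fun c y hc h => ⟨smul_ne_zero hc h.1, by simp [h.2.1], by simp [h.2.2]⟩⟩
  have h1 := card_smul_incl (K := K) hp
  rw [← Nat.card_congr (Equiv.subtypeEquivRight
    (p := fun Z : Fin (r + 1) → K => VecQ A Z ∧ herm K A Z (incl F K r x) = 0) fun Z => by
      rw [vecQ_iff]
      constructor
      · rintro ⟨⟨c, y, hc, ⟨hy0, hy⟩, rfl⟩, h⟩
        rw [herm_smul_left, herm_incl] at h
        refine ⟨c, y, hc, ⟨hy0, hy, ?_⟩, rfl⟩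
        rw [formF_symm hA]
        simpa [hc] using h
      · rintro ⟨c, y, hc, ⟨hy0, hy, hxy⟩, rfl⟩
        refine ⟨⟨c, y, hc, ⟨hy0, hy⟩, rfl⟩, ?_⟩
        rw [herm_smul_left, herm_incl, formF_symm hA, hxy]; simp)] at h1
  have h2 := card_eq_card_ne_zero_add_one
    (fun y : Fin (r + 1) → F => formF A y y = 0 ∧ formF A x y = 0) (by simp)
  have h4 := card_singular_eq Δ.two_ne hA hdet hr hm x hx0 hx 0
  have h3 := one_lt_card (L := F)
  have h5 : Nat.card F ^ r = Nat.card F ^ (r - 1) * Nat.card F := by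
    rw [← pow_succ]; congr 1; omega
  rw [h5] at h4
  have h4 := Nat.eq_of_mul_eq_mul_right Nat.card_pos h4
  rw [h4] at h2
  zify at h1 h2
  rw [card_sub_one_cast, card_sub_one_cast, Δ.card] at h1
  push_cast at h1
  refine mul_right_cancel₀ (sub_ne_zero.2 h3.ne') ?_
  rw [h1]
  linear_combination (-((Nat.card F : ℤ) ^ 2 - 1)) * h2

/-- Coordinates with respect to the basis `1, δ` of `K` over `F`. -/
def inclAddEquiv (r : ℕ) : ((Fin (r + 1) → F) × (Fin (r + 1) → F)) ≃ (Fin (r + 1) → K) :=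
  Equiv.ofBijective (fun p => incl F K r p.1 + δ • incl F K r p.2)
    ⟨fun _ _ h => Prod.ext (incl_add_ext Δ h).1 (incl_add_ext Δ h).2, fun Z => by
      obtain ⟨x, y, h⟩ := exists_incl_add Δ Z
      exact ⟨(x, y), h.symm⟩⟩

omit [Finite K] in
theorem forms_iff (hA : A.IsSymm) (x y : Fin (r + 1) → F) (c : F) :
    (formF A x x = 0 ∧ formF A y y = 0 ∧ formF A x y = c) ↔
    (herm K A (incl F K r x + δ • incl F K r y) (incl F K r x + δ • incl F K r y) = 0 ∧
      formK K A (incl F K r x + δ • incl F K r y) (incl F K r x + δ • incl F K r y)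
        = δ * algebraMap F K (2 * c)) := by
  constructor
  · rintro ⟨h1, h2, h3⟩
    rw [herm_incl_add Δ hA, formK_incl_add Δ hA, h1, h2, h3]
    simp
  · rintro ⟨h1, h2⟩
    exact forms_eq_zero Δ hA h1 h2

theorem card_singular_pairs (hA : A.IsSymm) (c : F) :
    Nat.card {Z : Fin (r + 1) → K //
      herm K A Z Z = 0 ∧ formK K A Z Z = δ * algebraMap F K (2 * c)} =
    Nat.card {p : (Fin (r + 1) → F) × (Fin (r + 1) → F) //
      formF A p.1 p.1 = 0 ∧ formF A p.2 p.2 = 0 ∧ formF A p.1 p.2 = c} :=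
  (Nat.card_congr ((inclAddEquiv Δ r).subtypeEquiv fun p => forms_iff Δ hA p.1 p.2 c)).symm

-- Each nonzero singular first vector has `q^(r - 1)` partners, whatever `c` is. The first vector
-- zero is kept as a separate term, which is nonempty only for `c = 0`.
omit [Finite K] in
theorem sum_singular_pairs (hA : A.IsSymm) (hdet : A.det ≠ 0) (hr : r = 2 * m) (hm : 0 < m)
    (c : F) :
    Nat.card {p : (Fin (r + 1) → F) × (Fin (r + 1) → F) //
      formF A p.1 p.1 = 0 ∧ formF A p.2 p.2 = 0 ∧ formF A p.1 p.2 = c} =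
    Nat.card {y : Fin (r + 1) → F // formF A y y = 0 ∧ 0 = c} +
      (Nat.card F ^ r - 1) * Nat.card F ^ (r - 1) := by
  classical
  let := Fintype.ofFinite F
  rw [card_prod_subtype (fun x y : Fin (r + 1) → F =>
    formF A x x = 0 ∧ formF A y y = 0 ∧ formF A x y = c),
    ← Finset.add_sum_erase _ _ (Finset.mem_univ 0)]
  have h5 : Nat.card F ^ r = Nat.card F ^ (r - 1) * Nat.card F := by
    rw [← pow_succ]; congr 1; omega
  have h1 : ∀ x ∈ Finset.univ.erase (0 : Fin (r + 1) → F), Nat.card {y : Fin (r + 1) → F //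
      formF A x x = 0 ∧ formF A y y = 0 ∧ formF A x y = c} =
      if formF A x x = 0 then Nat.card F ^ (r - 1) else 0 := by
    intro x hx
    split_ifs with h
    · have h4 := card_singular_eq Δ.two_ne hA hdet hr hm x (Finset.ne_of_mem_erase hx) h c
      rw [h5] at h4
      simp only [h, true_and]
      exact Nat.eq_of_mul_eq_mul_right Nat.card_pos h4
    · have : IsEmpty {y : Fin (r + 1) → F //
        formF A x x = 0 ∧ formF A y y = 0 ∧ formF A x y = c} := ⟨fun y => h y.2.1⟩
      exact Nat.card_of_isEmpty
  rw [Finset.sum_congr rfl h1, ← Finset.sum_filter, Finset.sum_const, smul_eq_mul]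
  have h2 := card_eq_card_ne_zero_add_one (fun x : Fin (r + 1) → F => formF A x x = 0) (by simp)
  rw [card_singular_vectors Δ.two_ne hA hdet hr hm] at h2
  have h3 : (Finset.filter (fun x => formF A x x = 0)
      (Finset.univ.erase (0 : Fin (r + 1) → F))).card = Nat.card F ^ r - 1 := by
    rw [h2, Nat.add_sub_cancel, Nat.card_eq_fintype_card, Fintype.card_subtype]
    congr 1
    ext x
    simp
  rw [h3]
  simp

/-- The nonzero vectors singular for both forms correspond to the pairs counted for `c = 0`, with
the pair of zero vectors removed. -/
theorem card_vecQ_add_card_vecO (hA : A.IsSymm) (hdet : A.det ≠ 0) (hr : r = 2 * m)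
    (hm : 0 < m) :
    (Nat.card {Z : Fin (r + 1) → K // VecQ A Z} : ℤ) +
      Nat.card {Z : Fin (r + 1) → K // VecO A Z} =
      ((Nat.card F : ℤ) ^ r - 1) * ((Nat.card F : ℤ) ^ (r - 1) + 1) := by
  classical
  have h1 := (card_singular_pairs Δ (r := r) hA 0).trans
    (sum_singular_pairs Δ hA hdet hr hm 0)
  simp only [and_true, mul_zero, map_zero] at h1
  rw [card_singular_vectors Δ.two_ne hA hdet hr hm, card_eq_card_ne_zero_add_one _ (by
    simp [herm_eq])] at h1
  rw [Nat.card_congr (Equiv.subtypeEquivRight (q := fun Z => VecQ A Z ∨ VecO A Z) fun Z => by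
      constructor
      · intro h
        by_cases hQ : VecQ A Z
        · exact Or.inl hQ
        · exact Or.inr ⟨h.1, h.2.1, h.2.2, hQ⟩
      · rintro (h | h)
        · exact ⟨h.1, h.vecH.2, h.formK_eq⟩
        · exact ⟨h.1, h.2.1, h.2.2.1⟩), card_or _ _ fun Z h h' => h'.2.2.2 h] at h1
  have h3 : 0 < Nat.card F ^ r := pow_pos Nat.card_pos _
  zify [h3] at h1
  linear_combination h1

omit Δ [Finite K] in
theorem card_sq_mul_eq (h2 : (2 : K) ≠ 0) (b u : K) (hb : b ≠ 0) (hu : u ≠ 0)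
    (h : IsSquare (u * b)) : Nat.card {c : K // c * c * b = u} = 2 := by
  obtain ⟨s, hs⟩ := h
  have hs0 : s ≠ 0 := by
    rintro rfl
    simp [hb, hu] at hs
  have : {c : K | c * c * b = u} = {s / b, -(s / b)} := by
    ext c
    rw [Set.mem_ofPred_eq, Set.mem_insert_iff, Set.mem_singleton_iff, ← mul_self_eq_mul_self_iff]
    field_simp
    rw [pow_two s, ← hs, pow_two c]
    constructor
    · intro h; rw [← h]; ring
    · intro h; exact mul_right_cancel₀ hb (by linear_combination h)
  change Nat.card ({c : K | c * c * b = u} : Set K) = 2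
  rw [this, Nat.card_coe_set_eq, Set.ncard_pair]
  intro h
  have h3 : 2 * (s / b) = 0 := by linear_combination h
  simp [h2, hs0, hb] at h3

/-- Count the pairs `(c, Z)` with `Z` of square type and `c² B(Z, Z) = 2 δ`. Every `Z` admits two
values of `c`, and for every `c ≠ 0` the vectors `c Z` correspond to the hyperbolic pairs. -/
theorem card_vecS (hA : A.IsSymm) (hdet : A.det ≠ 0) (hr : r = 2 * m) (hm : 0 < m) :
    2 * (Nat.card {Z : Fin (r + 1) → K // VecS δ A Z} : ℤ) =
      ((Nat.card F : ℤ) ^ 2 - 1) * (((Nat.card F : ℤ) ^ r - 1) * (Nat.card F : ℤ) ^ (r - 1)) := by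
  classical
  let := Fintype.ofFinite K
  have hne : 2 * δ ≠ 0 := mul_ne_zero Δ.two_ne' Δ.ne_zero
  have h1 := (card_singular_pairs Δ (r := r) hA 1).trans
    (sum_singular_pairs Δ hA hdet hr hm 1)
  have hempty : IsEmpty {y : Fin (r + 1) → F // formF A y y = 0 ∧ (0 : F) = 1} :=
    ⟨fun y => zero_ne_one y.2.2⟩
  rw [Nat.card_of_isEmpty (α := {y : Fin (r + 1) → F // _}), zero_add, mul_one, map_ofNat,
    mul_comm δ 2] at h1
  have h3 := sum_card_comm (fun (c : K) (Z : Fin (r + 1) → K) =>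
    VecS δ A Z ∧ c * c * formK K A Z Z = 2 * δ)
  have h4 : ∀ Z : Fin (r + 1) → K, Nat.card {c : K // VecS δ A Z ∧ c * c * formK K A Z Z = 2 * δ}
      = if VecS δ A Z then 2 else 0 := fun Z => by
    split_ifs with h
    · simp only [h, true_and]
      exact card_sq_mul_eq Δ.two_ne' _ _ h.2.1 hne h.2.2
    · have : IsEmpty {c : K // VecS δ A Z ∧ c * c * formK K A Z Z = 2 * δ} := ⟨fun c => h c.2.1⟩
      exact Nat.card_of_isEmpty
  have h5 : ∀ c : K, Nat.card {Z : Fin (r + 1) → K //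
      VecS δ A Z ∧ c * c * formK K A Z Z = 2 * δ} =
      if c ≠ 0 then (Nat.card F ^ r - 1) * Nat.card F ^ (r - 1) else 0 := fun c => by
    split_ifs with hc
    · rw [← h1]
      refine Nat.card_congr ((MulAction.toPerm (Units.mk0 c hc)).subtypeEquiv fun Z => ?_)
      change _ ↔ herm K A (c • Z) (c • Z) = 0 ∧ formK K A (c • Z) (c • Z) = 2 * δ
      rw [← (homogeneous_vecS δ).smul_iff hc, ← formK_smul_smul]
      constructor
      · rintro ⟨h, h'⟩
        exact ⟨h.1, h'⟩
      · rintro ⟨h, h'⟩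
        exact ⟨⟨h, by rw [h']; exact hne, by rw [h']; exact ⟨_, rfl⟩⟩, h'⟩
    · have : IsEmpty {Z : Fin (r + 1) → K // VecS δ A Z ∧ c * c * formK K A Z Z = 2 * δ} :=
        ⟨fun ⟨Z, _, h⟩ => hne (by
          rw [not_not.1 hc, zero_mul, zero_mul] at h
          exact h.symm)⟩
      exact Nat.card_of_isEmpty
  rw [Finset.sum_congr rfl fun c _ => h5 c, Finset.sum_congr rfl fun Z _ => h4 Z,
    ← Finset.sum_filter, ← Finset.sum_filter, Finset.sum_const, Finset.sum_const, smul_eq_mul,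
    smul_eq_mul, ← Fintype.card_subtype, ← Fintype.card_subtype, ← Nat.card_eq_fintype_card,
    ← Nat.card_eq_fintype_card, Nat.card_congr unitsEquivNeZero.symm, Nat.card_units, Δ.card] at h3
  have h6 : 0 < Nat.card F ^ r := pow_pos Nat.card_pos _
  have h7 : 0 < Nat.card F ^ 2 := pow_pos Nat.card_pos _
  zify [h6, h7] at h3
  linear_combination -h3

omit Δ [Finite K] in
/-- Isotropic vectors fall into at least one of four classes. -/
theorem vecH_iff (Z : Fin (r + 1) → K) :
    VecH A Z ↔ VecQ A Z ∨ VecO A Z ∨ VecE δ A Z ∨ VecS δ A Z := by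
  constructor
  · intro h
    by_cases hQ : VecQ A Z
    · exact Or.inl hQ
    by_cases h0 : formK K A Z Z = 0
    · exact Or.inr (Or.inl ⟨h.1, h.2, h0, hQ⟩)
    by_cases hs : IsSquare (2 * δ * formK K A Z Z)
    · exact Or.inr (Or.inr (Or.inr ⟨h.2, h0, hs⟩))
    · exact Or.inr (Or.inr (Or.inl ⟨h.2, h0, hs⟩))
  · rintro (h | h | h | h)
    exacts [h.vecH, h.vecH, h.vecH, h.vecH]

end Sizes

/-! ### The excess: constancy on orbits, generator sums and symmetry. -/

section Tight

variable {F K : Type*} [Field F] [Field K] [Algebra F K] {r m : ℕ}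

/-- The four classes of isotropic vectors. -/
def vecClass (δ : K) (A : Matrix (Fin (r + 1)) (Fin (r + 1)) F) :
    Fin 4 → (Fin (r + 1) → K) → Prop := ![VecQ A, VecO A, VecE δ A, VecS δ A]

variable {A : Matrix (Fin (r + 1)) (Fin (r + 1)) F} {δ : K}

/-- The number of vectors with property `p` orthogonal to `Z`. -/
def perpCount (A : Matrix (Fin (r + 1)) (Fin (r + 1)) F) (p : (Fin (r + 1) → K) → Prop)
    (Z : Fin (r + 1) → K) : ℤ := Nat.card {R // p R ∧ herm K A R Z = 0}

open Classical in
/-- The difference between `perpCount` and its value for a tight set of parameter `i`. -/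
def excess (A : Matrix (Fin (r + 1)) (Fin (r + 1)) F) (m : ℕ) (p : (Fin (r + 1) → K) → Prop)
    (i : ℤ) (Z : Fin (r + 1) → K) : ℤ :=
  perpCount A p Z - i * ((Nat.card K : ℤ) ^ (m - 1) - 1) -
    if p Z then ((Nat.card K : ℤ) - 1) * (Nat.card K : ℤ) ^ (m - 1) else 0

/-- A maximal totally isotropic subspace of dimension `m`, parametrized by `K ^ m`. -/
structure IsGenerator (A : Matrix (Fin (r + 1)) (Fin (r + 1)) F)
    (ψ : (Fin m → K) →ₗ[K] (Fin (r + 1) → K)) : Prop where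
  inj : Function.Injective ψ
  isotropic : ∀ X Y, herm K A (ψ X) (ψ Y) = 0
  maximal : ∀ Z, herm K A Z Z = 0 → (∀ X, herm K A (ψ X) Z = 0) → Z ∈ Set.range ψ

variable [Finite F]

theorem vecClass_homogeneous (j : Fin 4) : Homogeneous (vecClass δ A j) := by
  fin_cases j
  exacts [homogeneous_vecQ, homogeneous_vecO, homogeneous_vecE δ, homogeneous_vecS δ]

theorem vecClass_vecH {j : Fin 4} {Z : Fin (r + 1) → K} (h : vecClass δ A j Z) : VecH A Z := by
  fin_cases j
  exacts [VecQ.vecH h, VecO.vecH h, VecE.vecH h, VecS.vecH h]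

/-- Every isotropic vector is in exactly one class. -/
theorem exists_vecClass_iff {Z : Fin (r + 1) → K} (h : VecH A Z) :
    ∃ i, ∀ j, vecClass δ A j Z ↔ i = j := by
  have hQ : VecQ A Z → formK K A Z Z = 0 := fun h => h.formK_eq
  rcases (vecH_iff (δ := δ) Z).1 h with h | h | h | h
  · refine ⟨0, fun j => ?_⟩
    fin_cases j
    · simpa [vecClass] using h
    · simpa [vecClass, VecO] using fun _ _ _ => h
    · simpa [vecClass, VecE] using fun _ h' => absurd h.formK_eq h'
    · simpa [vecClass, VecS] using fun _ h' => absurd h.formK_eq h'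
  · refine ⟨1, fun j => ?_⟩
    fin_cases j
    · simpa [vecClass] using h.2.2.2
    · simpa [vecClass] using h
    · simpa [vecClass, VecE] using fun _ h' => absurd h.2.2.1 h'
    · simpa [vecClass, VecS] using fun _ h' => absurd h.2.2.1 h'
  · refine ⟨2, fun j => ?_⟩
    fin_cases j
    · simpa [vecClass] using fun h' => h.2.1 (hQ h')
    · simpa [vecClass, VecO] using fun _ _ h' => absurd h' h.2.1
    · simpa [vecClass] using h
    · simpa [vecClass, VecS] using fun _ _ h' => h.2.2 h'
  · refine ⟨3, fun j => ?_⟩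
    fin_cases j
    · simpa [vecClass] using fun h' => h.2.1 (hQ h')
    · simpa [vecClass, VecO] using fun _ _ h' => absurd h' h.2.1
    · simpa [vecClass, VecE] using fun _ _ => h.2.2
    · simpa [vecClass] using h

open Classical in
/-- Splitting a sum over isotropic vectors into the four classes. -/
theorem sum_eq_sum_vecClass {α : Type*} (s : Finset α) (ψ : α → Fin (r + 1) → K)
    (hs : ∀ x ∈ s, VecH A (ψ x)) (h : (Fin (r + 1) → K) → ℤ) (ε : Fin 4 → ℤ)
    (hε : ∀ i Z, vecClass δ A i Z → h Z = ε i) :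
    ∑ x ∈ s, h (ψ x) =
      ∑ i, ((s.filter fun x => vecClass δ A i (ψ x)).card : ℤ) * ε i := by
  have h1 : ∀ x ∈ s, h (ψ x) = ∑ i, if vecClass δ A i (ψ x) then ε i else 0 := fun x hx => by
    obtain ⟨i, hi⟩ := exists_vecClass_iff (δ := δ) (hs x hx)
    simp only [hi, Finset.sum_ite_eq, Finset.mem_univ, if_true]
    exact hε i _ ((hi i).2 rfl)
  rw [Finset.sum_congr rfl h1, Finset.sum_comm]
  refine Finset.sum_congr rfl fun i _ => ?_
  rw [← Finset.sum_filter, Finset.sum_const, nsmul_eq_mul]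

theorem perpCount_actK {p : (Fin (r + 1) → K) → Prop} (hinv : Invariant A p)
    {g : GL (Fin (r + 1)) F} (hg : g ∈ similitudes A) (Z : Fin (r + 1) → K) :
    perpCount A p (actK g Z) = perpCount A p Z := by
  have hbij : Function.Bijective (actK (K := K) g) := ⟨actK_injective g, fun W =>
    ⟨actK g⁻¹ W, by simpa using actK_inv_actK g⁻¹ W⟩⟩
  rw [perpCount, perpCount]
  congr 1
  refine (Nat.card_congr ((Equiv.ofBijective _ hbij).subtypeEquiv fun R => ?_)).symm
  change _ ↔ p (actK g R) ∧ herm K A (actK g R) (actK g Z) = 0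
  rw [hinv.iff hg]
  obtain ⟨c, hc, hg⟩ := hg
  rw [herm_actK hg]
  simp [hc]

theorem perpCount_smul (p : (Fin (r + 1) → K) → Prop) {c : K} (hc : c ≠ 0)
    (Z : Fin (r + 1) → K) : perpCount A p (c • Z) = perpCount A p Z := by
  have hc' : frob F K c ≠ 0 := (map_ne_zero_iff (frob F K) (frob F K).injective).2 hc
  rw [perpCount, perpCount]
  congr 1
  refine Nat.card_congr (Equiv.subtypeEquivRight fun R => ?_)
  rw [herm_smul_right]
  simp [hc']

theorem perpCount_eq {p p' : (Fin (r + 1) → K) → Prop} (hinv : Invariant A p)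
    (htr : Transitive A p') {Z W : Fin (r + 1) → K} (hZ : p' Z) (hW : p' W) :
    perpCount A p Z = perpCount A p W := by
  obtain ⟨g, hg, c, hc, h⟩ := htr Z W hZ hW
  rw [← perpCount_actK hinv hg, h, perpCount_smul p hc]

variable {d : F} (Δ : QuadExt F K δ d)

omit [Finite F] in
theorem excess_eq {i j : Fin 4} (n : ℤ) {Z : Fin (r + 1) → K} (hdisj : vecClass δ A j Z ↔ i = j) :
    excess A m (vecClass δ A j) n Z =
      perpCount A (vecClass δ A j) Z - n * ((Nat.card K : ℤ) ^ (m - 1) - 1) -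
    if i = j then ((Nat.card K : ℤ) - 1) * (Nat.card K : ℤ) ^ (m - 1) else 0 := by
  simp only [excess, hdisj]

include Δ

theorem vecClass_invariant [Finite K] (j : Fin 4) : Invariant A (vecClass δ A j) := by
  fin_cases j
  exacts [invariant_vecQ, invariant_vecO, invariant_vecE Δ, invariant_vecS Δ]

theorem vecClass_transitive [Finite K] (hA : A.IsSymm) (hdet : A.det ≠ 0) (j : Fin 4) :
    Transitive A (vecClass δ A j) := by
  fin_cases j
  exacts [transitive_vecQ Δ hA hdet, transitive_vecO Δ hA hdet, transitive_vecE Δ hA,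
    transitive_vecS Δ hA]

omit Δ in
theorem vecClass_iff_of {i : Fin 4} {Z : Fin (r + 1) → K} (h : vecClass δ A i Z) (j : Fin 4) :
    vecClass δ A j Z ↔ i = j := by
  obtain ⟨k, hk⟩ := exists_vecClass_iff (δ := δ) (vecClass_vecH h)
  rw [hk j, (hk i).1 h]

/-- Similitudes and scalars preserve both the classes and orthogonality, and they act transitively
on each class. -/
theorem exists_excess_const [Finite K] (hA : A.IsSymm) (hdet : A.det ≠ 0) (n : Fin 4 → ℤ) :
    ∃ ε : Fin 4 → Fin 4 → ℤ, ∀ i j Z, vecClass δ A i Z →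
      excess A m (vecClass δ A j) (n j) Z = ε i j := by
  have : ∀ i j : Fin 4, ∃ e : ℤ, ∀ Z, vecClass δ A i Z →
      excess A m (vecClass δ A j) (n j) Z = e := by
    intro i j
    by_cases h : ∃ Z, vecClass δ A i Z
    · obtain ⟨W, hW⟩ := h
      refine ⟨excess A m (vecClass δ A j) (n j) W, fun Z hZ => ?_⟩
      rw [excess_eq _ (vecClass_iff_of hZ j), excess_eq _ (vecClass_iff_of hW j),
        perpCount_eq (vecClass_invariant Δ j) (vecClass_transitive Δ hA hdet i) hZ hW]
    -- On an empty class any value would do.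
    · exact ⟨0, fun Z hZ => absurd ⟨Z, hZ⟩ h⟩
  choose ε hε using this
  exact ⟨ε, fun i j Z h => hε i j Z h⟩

-- By maximality, an isotropic `R` outside the generator is not orthogonal to all of it, so it cuts
-- out a hyperplane of the generator; inside, it is orthogonal to everything.
open Classical in
theorem card_perp_generator [Finite K] (hA : A.IsSymm) (hm : 0 < m)
    {ψ : (Fin m → K) →ₗ[K] (Fin (r + 1) → K)} (hψ : IsGenerator A ψ) {R : Fin (r + 1) → K}
    (hR : herm K A R R = 0) :
    (Nat.card {X // herm K A R (ψ X) = 0} : ℤ) = (Nat.card K : ℤ) ^ (m - 1) +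
      if R ∈ Set.range ψ then ((Nat.card K : ℤ) - 1) * (Nat.card K : ℤ) ^ (m - 1) else 0 := by
  have hpow : Nat.card K ^ m = Nat.card K ^ (m - 1) * Nat.card K := by
    rw [← pow_succ]; congr 1; omega
  split_ifs with h
  · obtain ⟨Y, rfl⟩ := h
    simp only [hψ.isotropic]
    rw [card_true, Nat.card_fun, Nat.card_eq_fintype_card (α := Fin m), Fintype.card_fin, hpow]
    push_cast
    ring
  · let φ : (Fin m → K) →+ K :=
      { toFun := fun X => herm K A (ψ X) R
        map_zero' := by rw [map_zero, herm_eq]; simp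
        map_add' := fun X Y => by rw [map_add, herm_add_left] }
    have hφ : Function.Surjective φ := fun c => by
      have : ¬ ∀ X, herm K A (ψ X) R = 0 := fun h' => h (hψ.maximal R hR h')
      push Not at this
      obtain ⟨X, hX⟩ := this
      refine ⟨(c / herm K A (ψ X) R) • X, ?_⟩
      change herm K A (ψ _) R = c
      rw [map_smul, herm_smul_left, div_mul_cancel₀ _ hX]
    have h1 := card_fiber φ hφ 0
    rw [Nat.card_fun, Nat.card_eq_fintype_card (α := Fin m), Fintype.card_fin, hpow] at h1
    have h2 := Nat.eq_of_mul_eq_mul_right Nat.card_pos h1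
    rw [add_zero]
    rw [Nat.card_congr (Equiv.subtypeEquivRight (q := fun X => φ X = 0) fun X =>
      (herm_comm Δ hA (ψ X) R)), h2]
    push_cast
    rfl

open Classical in
/-- The excess of a set of the right size sums to zero over every generator. -/
theorem sum_excess_generator [Finite K] (hA : A.IsSymm) (hm : 0 < m)
    {ψ : (Fin m → K) →ₗ[K] (Fin (r + 1) → K)} (hψ : IsGenerator A ψ)
    {p : (Fin (r + 1) → K) → Prop} (hp : ∀ Z, p Z → VecH A Z) (n : ℤ)
    (hn : (Nat.card {Z // p Z} : ℤ) = n * ((Nat.card K : ℤ) ^ m - 1))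
    (s : Finset (Fin m → K)) (hs : ∀ X, X ∈ s ↔ X ≠ 0) :
    ∑ X ∈ s, excess A m p n (ψ X) = 0 := by
  let := Fintype.ofFinite K
  have hs' : s = Finset.univ.erase 0 := by ext X; simp [hs]
  have hpow : (Nat.card K : ℤ) ^ m = (Nat.card K : ℤ) ^ (m - 1) * Nat.card K := by
    rw [← pow_succ]; congr 1; omega
  have hcard : (s.card : ℤ) = (Nat.card K : ℤ) ^ m - 1 := by
    rw [hs', Finset.card_erase_of_mem (Finset.mem_univ _), Finset.card_univ,
      ← Nat.card_eq_fintype_card, Nat.card_fun, Nat.card_eq_fintype_card (α := Fin m),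
      Fintype.card_fin]
    have : 0 < Nat.card K ^ m := pow_pos Nat.card_pos _
    push_cast [Nat.cast_sub this]
    rfl
  have hp0 : ¬ p 0 := fun h => (hp 0 h).1 rfl
  -- Orthogonal pairs `(X, R)` with `R` in the set are counted by `R`, using `card_perp_generator`.
  have h1 : ∑ X, perpCount A p (ψ X) =
      n * ((Nat.card K : ℤ) ^ m - 1) * (Nat.card K : ℤ) ^ (m - 1) +
      (Nat.card {X // p (ψ X)} : ℤ) * (((Nat.card K : ℤ) - 1) * (Nat.card K : ℤ) ^ (m - 1)) := by
    have h2 := sum_card_comm (fun (X : Fin m → K) R => p R ∧ herm K A R (ψ X) = 0)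
    have h3 : ∀ R, (Nat.card {X // p R ∧ herm K A R (ψ X) = 0} : ℤ) =
        (if p R then (Nat.card K : ℤ) ^ (m - 1) else 0) +
        if p R ∧ R ∈ Set.range ψ then ((Nat.card K : ℤ) - 1) * (Nat.card K : ℤ) ^ (m - 1)
          else 0 := by
      intro R
      by_cases hR : p R
      · simp only [hR, true_and, if_true]
        convert card_perp_generator Δ hA hm hψ (hp R hR).2
      · have : IsEmpty {X // p R ∧ herm K A R (ψ X) = 0} := ⟨fun X => hR X.2.1⟩
        simp [hR]
    have h4 : Nat.card {R // p R ∧ R ∈ Set.range ψ} = Nat.card {X // p (ψ X)} := by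
      symm
      refine Nat.card_congr (Equiv.ofBijective (fun X => ⟨ψ X.1, X.2, X.1, rfl⟩) ⟨?_, ?_⟩)
      · intro X Y h
        exact Subtype.ext (hψ.inj (congrArg Subtype.val h))
      · rintro ⟨_, h, X, rfl⟩
        exact ⟨⟨X, h⟩, rfl⟩
    simp only [perpCount]
    zify at h2
    rw [h2, Finset.sum_congr rfl fun R _ => h3 R, Finset.sum_add_distrib, ← Finset.sum_filter,
      ← Finset.sum_filter, Finset.sum_const, Finset.sum_const, nsmul_eq_mul, nsmul_eq_mul,
      ← Fintype.card_subtype, ← Fintype.card_subtype, ← Nat.card_eq_fintype_card,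
      ← Nat.card_eq_fintype_card, hn, h4]
  -- The zero vector is orthogonal to the whole set. Removing its term turns the factor `|K|^(m -
  -- 1)` of the main term into `|K|^(m - 1) - 1`, exactly what the definition of `excess` subtracts.
  have h0 : perpCount A p (ψ 0) = n * ((Nat.card K : ℤ) ^ m - 1) := by
    rw [perpCount, map_zero, ← hn]
    congr 1
    refine Nat.card_congr (Equiv.subtypeEquivRight fun R => ?_)
    have : herm K A R 0 = 0 := by
      have := herm_smul_right A (0 : K) R 0
      simpa using this
    simp [this]
  rw [← Finset.add_sum_erase _ _ (Finset.mem_univ (0 : Fin m → K)), h0, ← hs'] at h1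
  simp only [excess]
  rw [Finset.sum_sub_distrib, Finset.sum_sub_distrib, Finset.sum_const, nsmul_eq_mul, hcard,
    ← Finset.sum_filter, Finset.sum_const, nsmul_eq_mul]
  have h5 : (s.filter fun X => p (ψ X)).card = Nat.card {X // p (ψ X)} := by
    rw [Nat.card_eq_fintype_card, Fintype.card_subtype]
    congr 1
    ext X
    simp only [Finset.mem_filter, hs, Finset.mem_univ, true_and, and_iff_right_iff_imp]
    rintro h rfl
    rw [map_zero] at h
    exact hp0 h
  rw [h5]
  linear_combination h1

/-- Double counting of orthogonal pairs. -/
theorem card_mul_excess [Finite K] (hA : A.IsSymm) (n : Fin 4 → ℤ)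
    (hn : ∀ j, (Nat.card {Z // vecClass δ A j Z} : ℤ) = n j * ((Nat.card K : ℤ) ^ m - 1))
    (ε : Fin 4 → Fin 4 → ℤ) (hε : ∀ i j Z, vecClass δ A i Z →
      excess A m (vecClass δ A j) (n j) Z = ε i j) (i j : Fin 4) :
    (Nat.card {Z // vecClass δ A i Z} : ℤ) * ε i j =
      (Nat.card {Z // vecClass δ A j Z} : ℤ) * ε j i := by
  classical
  let := Fintype.ofFinite K
  have h1 : ∀ i j : Fin 4, ∑ Z, (Nat.card {R // vecClass δ A i Z ∧ vecClass δ A j R ∧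
      herm K A R Z = 0} : ℤ) = (Nat.card {Z // vecClass δ A i Z} : ℤ) *
        (ε i j + n j * ((Nat.card K : ℤ) ^ (m - 1) - 1) +
          if i = j then ((Nat.card K : ℤ) - 1) * (Nat.card K : ℤ) ^ (m - 1) else 0) := by
    intro i j
    have h2 : ∀ Z, (Nat.card {R // vecClass δ A i Z ∧ vecClass δ A j R ∧
        herm K A R Z = 0} : ℤ) = if vecClass δ A i Z then
        (ε i j + n j * ((Nat.card K : ℤ) ^ (m - 1) - 1) +
          if i = j then ((Nat.card K : ℤ) - 1) * (Nat.card K : ℤ) ^ (m - 1) else 0) else 0 := by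
      intro Z
      split_ifs with h h'
      · have h3 := hε i j Z h
        rw [excess_eq _ (vecClass_iff_of h j), if_pos h'] at h3
        simp only [h, true_and]
        rw [perpCount] at h3
        linear_combination h3
      · have h3 := hε i j Z h
        rw [excess_eq _ (vecClass_iff_of h j), if_neg h'] at h3
        simp only [h, true_and]
        rw [perpCount] at h3
        linear_combination h3
      · have : IsEmpty {R // vecClass δ A i Z ∧ vecClass δ A j R ∧ herm K A R Z = 0} :=
          ⟨fun R => h R.2.1⟩
        simp
    rw [Finset.sum_congr rfl fun Z _ => h2 Z, ← Finset.sum_filter, Finset.sum_const, nsmul_eq_mul,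
      ← Fintype.card_subtype, ← Nat.card_eq_fintype_card]
  have h4 := sum_card_comm (fun Z R : Fin (r + 1) → K =>
    vecClass δ A i Z ∧ vecClass δ A j R ∧ herm K A R Z = 0)
  have h5 : ∀ R, Nat.card {Z // vecClass δ A i Z ∧ vecClass δ A j R ∧ herm K A R Z = 0} =
      Nat.card {Z // vecClass δ A j R ∧ vecClass δ A i Z ∧ herm K A Z R = 0} := fun R =>
    Nat.card_congr (Equiv.subtypeEquivRight fun Z => by
      rw [herm_comm Δ hA Z R]; tauto)
  rw [Finset.sum_congr rfl fun R _ => h5 R] at h4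
  zify at h4
  rw [h1 i j, h1 j i] at h4
  by_cases hij : i = j
  · subst hij; rfl
  · rw [if_neg hij, if_neg (Ne.symm hij)] at h4
    -- The sizes being proportional to the parameters, the main terms are symmetric in `i` and `j`
    -- and cancel; only the excesses remain.
    rw [hn i, hn j] at h4 ⊢
    linear_combination h4

end Tight

/-! ### Two explicit families of generators. -/

section Generators

variable {F K : Type*} [Field F] [Field K] [Algebra F K] [Finite F] {r m : ℕ}
  {A : Matrix (Fin (r + 1)) (Fin (r + 1)) F} {δ : K} {d : F} (Δ : QuadExt F K δ d)
  {e f : Fin m → Fin (r + 1) → F} {g : Fin (r + 1) → F}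

theorem frob_single (i : Fin m) (c : K) :
    (fun j => frob F K ((Pi.single i c : Fin m → K) j)) = Pi.single i (frob F K c) := by
  funext j
  by_cases h : j = i
  · subst h; simp
  · simp [h]

/-- The extension of the totally singular subspace spanned by half of a frame. -/
def extendedGenerator (K : Type*) [Field K] [Algebra F K] (e f : Fin m → Fin (r + 1) → F)
    (g : Fin (r + 1) → F) : (Fin m → K) →ₗ[K] (Fin (r + 1) → K) :=
  (frameK K e f g).comp (LinearMap.inl K (Fin m → K) ((Fin m → K) × K))

omit [Finite F] in
theorem extendedGenerator_apply (X : Fin m → K) :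
    extendedGenerator K e f g X = frameK K e f g (X, 0, 0) := rfl

theorem extendedGenerator_isGenerator (hA : A.IsSymm) (H : HypFrame (formF A) e f g)
    (hr : r = 2 * m) : IsGenerator A (extendedGenerator K e f g) where
  inj X Y h := by
    have := (frameK_bijective (K := K) hA H (by simpa using hr)).1 h
    exact congrArg Prod.fst this
  isotropic X Y := by
    rw [extendedGenerator_apply, extendedGenerator_apply, herm_frameK hA H]
    simp [dotProduct]
  maximal Z hZ h := by
    obtain ⟨⟨X, Y, t⟩, rfl⟩ := (frameK_bijective (K := K) hA H (by simpa using hr)).2 Z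
    have hY : Y = 0 := funext fun i => by
      have := h (Pi.single i 1)
      rw [extendedGenerator_apply, herm_frameK hA H] at this
      simpa using this
    subst hY
    rw [herm_frameK hA H] at hZ
    have ht : t = 0 := by simpa [H.gg, dotProduct] using hZ
    subst ht
    exact ⟨X, rfl⟩

omit [Finite F] in
theorem extendedGenerator_singular (hA : A.IsSymm) (H : HypFrame (formF A) e f g)
    (X : Fin m → K) :
    formK K A (extendedGenerator K e f g X) (extendedGenerator K e f g X) = 0 := by
  rw [extendedGenerator_apply, formK_frameK hA H]
  simp

-- The vector `e i + δ e j` has coordinates in the ratio `1 : δ`, which no multiple of a vector over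
-- `F` has. Two indices are needed, hence `2 ≤ m`.
include Δ in
theorem exists_vecO (hA : A.IsSymm) (H : HypFrame (formF A) e f g) (hr : r = 2 * m)
    (hm : 2 ≤ m) : ∃ X, X ≠ 0 ∧ VecO A (extendedGenerator K e f g X) := by
  let i : Fin m := ⟨0, by omega⟩
  let j : Fin m := ⟨1, by omega⟩
  have hij : i ≠ j := by simp [i, j]
  let X : Fin m → K := Pi.single i 1 + δ • Pi.single j 1
  have hψ := extendedGenerator_isGenerator (K := K) hA H hr
  have hX : extendedGenerator K e f g X = incl F K r (e i) + δ • incl F K r (e j) := by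
    simp [X, extendedGenerator_apply, frameK, frameMap_apply, add_smul, Finset.sum_add_distrib,
      Pi.single_apply]
  have hX0 : X ≠ 0 := fun h => by simpa [X, hij] using congrFun h i
  refine ⟨X, hX0, fun h => hX0 (hψ.inj (by rw [h, map_zero])), hψ.isotropic X X,
    extendedGenerator_singular hA H X, fun ⟨_, c, x, hc, _⟩ => ?_⟩
  have h1 : ∀ k, formK K A (extendedGenerator K e f g X) (incl F K r (f k)) =
      c * algebraMap F K (formF A x (f k)) := fun k => by
    rw [hc, map_smul, LinearMap.smul_apply, smul_eq_mul, formK_incl]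
  have h2 : ∀ k, formK K A (extendedGenerator K e f g X) (incl F K r (f k)) =
      algebraMap F K (formF A (e i) (f k)) + δ * algebraMap F K (formF A (e j) (f k)) := fun k => by
    rw [hX, map_add, map_smul, LinearMap.add_apply, LinearMap.smul_apply, smul_eq_mul, formK_incl,
      formK_incl]
  have hi := (h1 i).symm.trans (h2 i)
  have hj := (h1 j).symm.trans (h2 j)
  rw [H.ef, H.ef, if_pos rfl, if_neg hij.symm, map_one, map_zero, mul_zero, add_zero] at hi
  rw [H.ef, H.ef, if_pos rfl, if_neg hij, map_one, map_zero, mul_one, zero_add] at hj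
  have h3 : algebraMap F K (formF A x (f j)) +
      δ * algebraMap F K (- formF A x (f i)) = 0 := by
    rw [map_neg]
    linear_combination algebraMap F K (formF A x (f i)) * hj -
      algebraMap F K (formF A x (f j)) * hi
  rw [neg_eq_zero.1 (Δ.eq_zero h3).2] at hi
  simp at hi

/-- The span of all but one vector of half of a frame and an isotropic vector of the remaining
three-dimensional space. -/
def mixedGenerator (e f : Fin m → Fin (r + 1) → F) (g : Fin (r + 1) → F) (i₀ : Fin m) (s δ : K) :
    (Fin m → K) →ₗ[K] (Fin (r + 1) → K) :=
  (frameK K e f g).comp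
    ({
      toFun := fun X => (Function.update X i₀ (s * X i₀), Pi.single i₀ (X i₀), δ * X i₀)
      map_add' := fun X Y => by
        refine Prod.ext (funext fun j => ?_) (Prod.ext (funext fun j => ?_) ?_)
        · by_cases h : j = i₀
          · subst h; simp [mul_add]
          · simp [h]
        · by_cases h : j = i₀
          · subst h; simp
          · simp [h]
        · simp [mul_add]
      map_smul' := fun c X => by
        refine Prod.ext (funext fun j => ?_) (Prod.ext (funext fun j => ?_) ?_)
        · by_cases h : j = i₀
          · subst h; simp; ring
          · simp [h]
        · by_cases h : j = i₀
          · subst h; simp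
          · simp [h]
        · simp; ring } : (Fin m → K) →ₗ[K] ((Fin m → K) × (Fin m → K) × K))

omit [Finite F] in
theorem mixedGenerator_apply (i₀ : Fin m) (s : K) (X : Fin m → K) :
    mixedGenerator e f g i₀ s δ X =
      frameK K e f g (Function.update X i₀ (s * X i₀), Pi.single i₀ (X i₀), δ * X i₀) := rfl

include Δ

/-- The condition on `s` says that `s e + f + δ g`, with `e, f` at the index `i₀`, is isotropic. The
space is maximal because its orthogonal complement modulo itself is an anisotropic line. -/
theorem mixedGenerator_isGenerator [Finite K] (hA : A.IsSymm) (H : HypFrame (formF A) e f g)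
    (hr : r = 2 * m) (i₀ : Fin m) (s : K)
    (hs : s + frob F K s = algebraMap F K (formF A g g) * algebraMap F K d) :
    IsGenerator A (mixedGenerator e f g i₀ s δ) where
  inj X Y h := by
    have h1 := (frameK_bijective (K := K) hA H (by simpa using hr)).1 h
    have h2 := congrArg Prod.fst h1
    have h3 := congrArg (fun p => p.2.1) h1
    funext j
    by_cases hj : j = i₀
    · subst hj
      simpa using congrFun h3 j
    · simpa [hj] using congrFun h2 j
  isotropic X Y := by
    rw [mixedGenerator_apply, mixedGenerator_apply, herm_frameK hA H]
    simp only [frob_single, dotProduct_single, single_dotProduct, Function.update_self, map_mul,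
      Δ.frob]
    rw [← Δ.sq] at hs
    linear_combination (X i₀ * frob F K (Y i₀)) * hs
  maximal Z hZ h := by
    obtain ⟨⟨X, Y, t⟩, rfl⟩ := (frameK_bijective (K := K) hA H (by simpa using hr)).2 Z
    have hY : Y = Pi.single i₀ (Y i₀) := funext fun i => by
      by_cases hi : i = i₀
      · subst hi; simp
      · have := h (Pi.single i 1)
        rw [mixedGenerator_apply, herm_frameK hA H] at this
        have hup : Function.update (Pi.single i 1 : Fin m → K) i₀
            (s * (Pi.single i 1 : Fin m → K) i₀) = Pi.single i 1 := by
          funext j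
          by_cases hj : j = i₀
          · subst hj; simp [Ne.symm hi]
          · simp [hj]
        rw [hup] at this
        simpa [Ne.symm hi, hi] using this
    have h0 := h (Pi.single i₀ 1)
    rw [mixedGenerator_apply, herm_frameK hA H] at h0
    have hup : Function.update (Pi.single i₀ 1 : Fin m → K) i₀
        (s * (Pi.single i₀ 1 : Fin m → K) i₀) = Pi.single i₀ s := by
      funext j
      by_cases hj : j = i₀
      · subst hj; simp
      · simp [hj]
    rw [hup] at h0
    simp only [single_dotProduct, Pi.single_eq_same, one_mul, mul_one] at h0
    have h0' := congrArg (frob F K) h0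
    simp only [map_add, map_mul, Δ.frob_frob, Δ.frob, AlgHom.commutes, map_zero] at h0'
    rw [herm_frameK hA H] at hZ
    have hXY : X ⬝ᵥ (fun i => frob F K (Y i)) = X i₀ * frob F K (Y i₀) := by
      rw [hY, frob_single, dotProduct_single]; simp
    have hYX : Y ⬝ᵥ (fun i => frob F K (X i)) = Y i₀ * frob F K (X i₀) := by
      rw [hY, single_dotProduct]; simp
    simp only [hXY, hYX] at hZ
    -- Subtracting an element of the generator leaves `t - δ * Y i₀` as the coordinate on the
    -- anisotropic line; isotropy makes its norm vanish.
    have hu : (t - δ * Y i₀) * frob F K (t - δ * Y i₀) = 0 := by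
      have hg : algebraMap F K (formF A g g) ≠ 0 := by simpa using H.gg
      refine mul_right_cancel₀ hg ?_
      rw [← Δ.sq] at hs
      simp only [map_sub, map_mul, Δ.frob]
      linear_combination hZ - (frob F K (Y i₀)) * h0' - (Y i₀) * h0 +
        (Y i₀ * frob F K (Y i₀)) * hs
    have ht : t = δ * Y i₀ := by
      rcases mul_eq_zero.1 hu with h | h
      · exact sub_eq_zero.1 h
      · exact sub_eq_zero.1 ((map_eq_zero_iff (frob F K) (frob F K).injective).1 h)
    have hX : X i₀ = s * Y i₀ := by
      rw [ht] at h0'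
      rw [← Δ.sq] at hs
      linear_combination h0' - Y i₀ * hs
    refine ⟨Function.update X i₀ (Y i₀), ?_⟩
    rw [mixedGenerator_apply, Function.update_self, Function.update_idem, ← hX,
      Function.update_eq_self, ← hY, ht]

-- Only the coordinate at `i₀` enters, and it enters through a square. So all vectors off the
-- hyperplane `X i₀ = 0` have the same type, governed by `c + δ B(g, g)`.
omit Δ [Finite F] in
theorem formK_mixedGenerator (hA : A.IsSymm) (H : HypFrame (formF A) e f g) (i₀ : Fin m) (c : F)
    (s : K) (hs : 2 * s = algebraMap F K (formF A g g) * (δ * δ) + 2 * δ * algebraMap F K c)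
    (X : Fin m → K) :
    formK K A (mixedGenerator e f g i₀ s δ X) (mixedGenerator e f g i₀ s δ X) =
      2 * δ * (X i₀ * X i₀) * (algebraMap F K c + δ * algebraMap F K (formF A g g)) := by
  rw [mixedGenerator_apply, formK_frameK hA H]
  simp only [dotProduct_single, single_dotProduct, Function.update_self]
  linear_combination (X i₀ * X i₀) * hs

end Generators

/-! ### Generators meeting exactly one of the classes `E` and `S`. -/

section Excess

variable {F K : Type*} [Field F] [Field K] [Algebra F K] [Finite F] [Finite K] {r m : ℕ}
  {A : Matrix (Fin (r + 1)) (Fin (r + 1)) F} {δ : K} {d : F} (Δ : QuadExt F K δ d)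
include Δ

/-- Every class of nonzero squares or nonsquares of `K` is represented by an element with
prescribed nonzero coordinate at `δ`. -/
theorem exists_isSquare_coord (a : F) (ha : a ≠ 0) :
    (∃ c : F, IsSquare (algebraMap F K c + δ * algebraMap F K a)) ∧
      ∃ c : F, ¬ IsSquare (algebraMap F K c + δ * algebraMap F K a) := by
  -- Scaling by `a / v`, a square in `K`, moves the coordinate at `δ` from `v` to `a` without
  -- changing the square class. It suffices to find one square and one nonsquare with nonzero
  -- `δ`-coordinate.
  have key : ∀ u v : F, v ≠ 0 →
      (IsSquare (algebraMap F K (a / v * u) + δ * algebraMap F K a) ↔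
        IsSquare (algebraMap F K u + δ * algebraMap F K v)) := by
    intro u v hv
    obtain ⟨s, hs⟩ := isSquare_algebraMap (K := K) Δ.two_ne Δ.card (a / v)
    have hs0 : s ≠ 0 := by
      rintro rfl
      rw [mul_zero, map_eq_zero_iff _ (algebraMap F K).injective] at hs
      exact div_ne_zero ha hv hs
    have h : algebraMap F K (a / v * u) + δ * algebraMap F K a =
        s * s * (algebraMap F K u + δ * algebraMap F K v) := by
      have : a = a / v * v := (div_mul_cancel₀ a hv).symm
      conv_lhs => rw [this]
      rw [mul_div_cancel_right₀ _ hv, map_mul, map_mul, hs]; ring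
    rw [h]
    constructor
    · rintro ⟨t, ht⟩
      exact ⟨t / s, by field_simp; linear_combination ht⟩
    · rintro ⟨t, ht⟩
      exact ⟨t * s, by linear_combination (s * s) * ht⟩
  constructor
  -- The square used is `(1 + δ)² = (1 + d) + 2 δ`. In the other case any nonsquare of `K` works,
  -- since elements of `F` are squares.
  · refine ⟨_, (key (1 + d) 2 Δ.two_ne).2 ⟨1 + δ, ?_⟩⟩
    rw [map_add, map_one, ← Δ.sq, map_ofNat]; ring
  · let := Fintype.ofFinite K
    have h2K : ringChar K ≠ 2 := fun h => Δ.two_ne' (by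
      have h' := CharP.cast_eq_zero K (ringChar K)
      rw [h] at h'
      exact_mod_cast h')
    obtain ⟨η, hη⟩ := FiniteField.exists_nonsquare h2K
    obtain ⟨u, v, rfl⟩ := Δ.exists_eq η
    have hv : v ≠ 0 := by
      rintro rfl
      apply hη
      rw [map_zero, mul_zero, add_zero]
      exact isSquare_algebraMap Δ.two_ne Δ.card u
    exact ⟨_, fun h => hη ((key u v hv).1 h)⟩

theorem exists_mixed_isGenerator (hA : A.IsSymm) (hdet : A.det ≠ 0) (hr : r = 2 * m)
    (hm : 0 < m) (k : Fin 4) (hk : k = 2 ∨ k = 3) :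
    ∃ ψ : (Fin m → K) →ₗ[K] (Fin (r + 1) → K), IsGenerator A ψ ∧
      (∃ X, vecClass δ A k (ψ X)) ∧ ∀ X i, vecClass δ A i (ψ X) → i = 0 ∨ i = 1 ∨ i = k := by
  obtain ⟨e, f, g, H⟩ := exists_frame Δ.two_ne hA hdet hr
  let i₀ : Fin m := ⟨0, hm⟩
  have h2 := Δ.two_ne'
  have hδ := Δ.ne_zero
  obtain ⟨c, hc⟩ : ∃ c : F, (IsSquare (algebraMap F K c + δ * algebraMap F K (formF A g g)) ↔
      k = 3) := by
    obtain ⟨⟨c, hc⟩, c', hc'⟩ := exists_isSquare_coord Δ (formF A g g) H.gg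
    rcases hk with rfl | rfl
    · exact ⟨c', by simpa using hc'⟩
    · exact ⟨c, by simpa using hc⟩
  -- Isotropy forces the `F`-part of `s`; the `δ`-part `c` is free and selects the class.
  let s : K := algebraMap F K (formF A g g * d / 2) + δ * algebraMap F K c
  have hd2 : (2 : K) * algebraMap F K (formF A g g * d / 2) =
      algebraMap F K (formF A g g) * algebraMap F K d := by
    rw [← map_mul, ← map_ofNat (algebraMap F K) 2, ← map_mul, mul_div_cancel₀ _ Δ.two_ne]
  have hs : s + frob F K s = algebraMap F K (formF A g g) * algebraMap F K d := by
    rw [← hd2]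
    simp only [s, map_add, map_mul, AlgHom.commutes, Δ.frob]
    ring
  have hs' : 2 * s = algebraMap F K (formF A g g) * (δ * δ) + 2 * δ * algebraMap F K c := by
    rw [Δ.sq, ← hd2]; simp only [s]; ring
  have hη0 : algebraMap F K c + δ * algebraMap F K (formF A g g) ≠ 0 := fun h =>
    H.gg (Δ.eq_zero h).2
  have hψ := mixedGenerator_isGenerator Δ hA H hr i₀ s hs
  have hform := formK_mixedGenerator hA H i₀ c s hs'
  have hsq : ∀ X : Fin m → K, X i₀ ≠ 0 →
      (IsSquare (2 * δ * formK K A (mixedGenerator e f g i₀ s δ X)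
        (mixedGenerator e f g i₀ s δ X)) ↔ k = 3) := by
    intro X hX
    rw [← hc, hform]
    obtain ⟨t, ht⟩ := isSquare_algebraMap (K := K) Δ.two_ne Δ.card d
    have ht0 : t ≠ 0 := by
      rintro rfl
      rw [mul_zero, map_eq_zero_iff _ (algebraMap F K).injective] at ht
      exact Δ.d_ne ht
    rw [← Δ.sq] at ht
    -- With `t² = δ² = d`, everything apart from `c + δ B(g, g)` is absorbed into a square.
    have : 2 * δ * (2 * δ * (X i₀ * X i₀) * (algebraMap F K c + δ *
        algebraMap F K (formF A g g))) = (2 * t * X i₀) * (2 * t * X i₀) *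
        (algebraMap F K c + δ * algebraMap F K (formF A g g)) := by
      linear_combination (4 * X i₀ * X i₀ * (algebraMap F K c + δ *
        algebraMap F K (formF A g g))) * ht
    rw [this]
    have hne : 2 * t * X i₀ ≠ 0 := mul_ne_zero (mul_ne_zero h2 ht0) hX
    constructor
    · rintro ⟨w, hw⟩
      exact ⟨w / (2 * t * X i₀), by
        rw [div_mul_div_comm, ← hw, mul_div_cancel_left₀ _ (mul_ne_zero hne hne)]⟩
    · rintro ⟨w, hw⟩
      exact ⟨2 * t * X i₀ * w, by rw [hw]; ring⟩
  have hcls : ∀ X : Fin m → K, X i₀ ≠ 0 → vecClass δ A k (mixedGenerator e f g i₀ s δ X) := by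
    intro X hX
    have h0 : formK K A (mixedGenerator e f g i₀ s δ X) (mixedGenerator e f g i₀ s δ X) ≠ 0 := by
      rw [hform]
      exact mul_ne_zero (mul_ne_zero (mul_ne_zero h2 hδ) (mul_ne_zero hX hX)) hη0
    rcases hk with rfl | rfl
    · exact ⟨hψ.isotropic X X, h0, fun h => by simpa using (hsq X hX).1 h⟩
    · exact ⟨hψ.isotropic X X, h0, (hsq X hX).2 rfl⟩
  refine ⟨_, hψ, ⟨fun _ => 1, hcls _ one_ne_zero⟩, fun X i hi => ?_⟩
  by_cases hX : X i₀ = 0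
  · have h0 : formK K A (mixedGenerator e f g i₀ s δ X) (mixedGenerator e f g i₀ s δ X) = 0 := by
      rw [hform, hX]; simp
    fin_cases i
    · exact Or.inl rfl
    · exact Or.inr (Or.inl rfl)
    · exact absurd h0 hi.2.1
    · exact absurd h0 hi.2.1
  · exact Or.inr (Or.inr ((vecClass_iff_of hi k).1 (hcls X hX)))

omit Δ in
theorem card_sum_vecClass (f : Fin 4 → ℤ)
    (hf : ∀ j, (Nat.card {Z : Fin (r + 1) → K // vecClass δ A j Z} : ℤ) = f j) :
    (Nat.card {Z : Fin (r + 1) → K // VecH A Z} : ℤ) = f 0 + f 1 + f 2 + f 3 := by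
  classical
  let := Fintype.ofFinite K
  have h := sum_eq_sum_vecClass (δ := δ) (A := A) (Finset.univ.filter (VecH A)) id
    (fun x hx => (Finset.mem_filter.1 hx).2) (fun _ => 1) (fun _ => 1) (fun _ _ _ => rfl)
  rw [Finset.sum_const, nsmul_eq_mul, mul_one, ← Fintype.card_subtype,
    ← Nat.card_eq_fintype_card] at h
  rw [h, Fin.sum_univ_four]
  have h1 : ∀ i, (((Finset.univ.filter (VecH A)).filter
      fun x : Fin (r + 1) → K => vecClass δ A i (id x)).card : ℤ) = f i := fun i => by
    rw [← hf i, Nat.card_eq_fintype_card, Fintype.card_subtype, Finset.filter_filter]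
    congr 2
    ext x
    simp only [id, Finset.mem_filter, Finset.mem_univ, true_and, and_iff_right_iff_imp]
    exact vecClass_vecH
  rw [h1, h1, h1, h1]
  ring

/-- The sizes of the four classes, divided by the size of a generator. -/
def tightParam (q r : ℕ) : Fin 4 → ℕ :=
  ![q + 1, q ^ (r - 1) - q, (q ^ (r + 1) - q ^ (r - 1)) / 2, (q ^ (r + 1) - q ^ (r - 1)) / 2]

end Excess

/-! ### Vanishing of the excess, tightness and the list of orbits. -/

section Main

variable {F K : Type*} [Field F] [Field K] [Algebra F K] [Finite F] [Finite K] {r m : ℕ}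
  {A : Matrix (Fin (r + 1)) (Fin (r + 1)) F} {δ : K} {d : F} (Δ : QuadExt F K δ d)

/-- The natural-number subtractions do not truncate, and the halving is exact because a difference
of two odd numbers is even. -/
theorem tightParam_cast {q : ℕ} (hq : Odd q) (hr : 2 ≤ r) :
    ((tightParam q r 0 : ℕ) : ℤ) = q + 1 ∧ ((tightParam q r 1 : ℕ) : ℤ) = (q : ℤ) ^ (r - 1) - q ∧
      2 * ((tightParam q r 2 : ℕ) : ℤ) = (q : ℤ) ^ (r + 1) - (q : ℤ) ^ (r - 1) ∧
      2 * ((tightParam q r 3 : ℕ) : ℤ) = (q : ℤ) ^ (r + 1) - (q : ℤ) ^ (r - 1) := by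
  have hpos : 0 < q := hq.pos
  have h1 : q ≤ q ^ (r - 1) := Nat.le_self_pow (by omega) q
  have h2 : q ^ (r - 1) ≤ q ^ (r + 1) := Nat.pow_le_pow_right hpos (by omega)
  have h3 : 2 * ((q ^ (r + 1) - q ^ (r - 1)) / 2) = q ^ (r + 1) - q ^ (r - 1) :=
    Nat.mul_div_cancel' (Nat.Odd.sub_odd hq.pow hq.pow).two_dvd
  have h4 : 2 * (((q ^ (r + 1) - q ^ (r - 1)) / 2 : ℕ) : ℤ) =
      (q : ℤ) ^ (r + 1) - (q : ℤ) ^ (r - 1) := by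
    have := congrArg (Nat.cast : ℕ → ℤ) h3
    rw [Nat.cast_sub h2] at this
    push_cast at this ⊢
    exact this
  refine ⟨?_, ?_, h4, h4⟩
  · simp [tightParam]
  · simp [tightParam, Nat.cast_sub h1]

include Δ

omit [Finite K] in
theorem odd_card : Odd (Nat.card F) := by
  classical
  let := Fintype.ofFinite F
  rw [Nat.card_eq_fintype_card, Nat.odd_iff]
  refine FiniteField.odd_card_of_char_ne_two fun h => Δ.two_ne ?_
  have h' := CharP.cast_eq_zero F (ringChar F)
  rw [h] at h'
  exact_mod_cast h'

omit [Finite K] in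
theorem card_pow_eq (k : ℕ) : (Nat.card K : ℤ) ^ k = (Nat.card F : ℤ) ^ (2 * k) := by
  rw [Δ.card, Nat.cast_pow, ← pow_mul]

/-- The sizes of the four classes. -/
theorem card_vecClass (hA : A.IsSymm) (hdet : A.det ≠ 0) (hr : r = 2 * m) (hm : 0 < m)
    (j : Fin 4) : (Nat.card {Z // vecClass δ A j Z} : ℤ) =
      (tightParam (Nat.card F) r j : ℤ) * ((Nat.card K : ℤ) ^ m - 1) := by
  rw [card_pow_eq Δ, ← hr]
  obtain ⟨t0, t1, t2, t3⟩ := tightParam_cast (q := Nat.card F) (r := r) (odd_card Δ) (by omega)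
  have hpow : (Nat.card F : ℤ) ^ (r + 1) = (Nat.card F : ℤ) ^ (r - 1) * (Nat.card F : ℤ) ^ 2 := by
    rw [← pow_add]; congr 1; omega
  have h0 : (Nat.card {Z : Fin (r + 1) → K // vecClass δ A 0 Z} : ℤ) =
      (tightParam (Nat.card F) r 0 : ℤ) * ((Nat.card F : ℤ) ^ r - 1) := by
    rw [t0]; exact card_vecQ Δ hA hdet hr hm
  have h1 : (Nat.card {Z : Fin (r + 1) → K // vecClass δ A 1 Z} : ℤ) =
      (tightParam (Nat.card F) r 1 : ℤ) * ((Nat.card F : ℤ) ^ r - 1) := by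
    have h := card_vecQ_add_card_vecO Δ hA hdet hr hm
    rw [t1]
    rw [t0] at h0
    change ((Nat.card {Z : Fin (r + 1) → K // vecClass δ A 0 Z} : ℤ)) +
      (Nat.card {Z : Fin (r + 1) → K // vecClass δ A 1 Z} : ℤ) = _ at h
    linear_combination h - h0
  have h3 : (Nat.card {Z : Fin (r + 1) → K // vecClass δ A 3 Z} : ℤ) =
      (tightParam (Nat.card F) r 3 : ℤ) * ((Nat.card F : ℤ) ^ r - 1) := by
    have h := card_vecS Δ hA hdet hr hm
    change 2 * (Nat.card {Z : Fin (r + 1) → K // vecClass δ A 3 Z} : ℤ) = _ at h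
    rw [hpow] at t3
    refine mul_left_cancel₀ (two_ne_zero (α := ℤ)) ?_
    linear_combination h - ((Nat.card F : ℤ) ^ r - 1) * t3
  -- The nonsquare class is not counted directly: it is what remains of all nonzero isotropic
  -- vectors.
  have h2 : (Nat.card {Z : Fin (r + 1) → K // vecClass δ A 2 Z} : ℤ) =
      (tightParam (Nat.card F) r 2 : ℤ) * ((Nat.card F : ℤ) ^ r - 1) := by
    have h := card_sum_vecClass (δ := δ) (A := A) _ (fun _ => rfl)
    have h' := card_isotropic Δ hA hdet hr
    rw [card_eq_card_ne_zero_add_one _ (by simp [herm_eq])] at h'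
    change (((Nat.card {Z : Fin (r + 1) → K // VecH A Z} + 1 : ℕ)) : ℤ) = _ at h'
    push_cast at h'
    rw [h, h0, h1, h3] at h'
    refine mul_left_cancel₀ (two_ne_zero (α := ℤ)) ?_
    rw [t0, t1] at h'
    linear_combination 2 * h' - ((Nat.card F : ℤ) ^ r - 1) * (t2 + t3)
  fin_cases j
  exacts [h0, h1, h2, h3]

theorem excess_eq_zero (hA : A.IsSymm) (hdet : A.det ≠ 0) (hr : r = 2 * m) (hm : 2 ≤ m)
    (j : Fin 4) (Z : Fin (r + 1) → K) (hZ : VecH A Z) :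
    excess A m (vecClass δ A j) (tightParam (Nat.card F) r j) Z = 0 := by
  classical
  let := Fintype.ofFinite K
  have hm0 : 0 < m := by omega
  set n : Fin 4 → ℤ := fun j => (tightParam (Nat.card F) r j : ℤ) with hn
  obtain ⟨ε, hε⟩ := exists_excess_const (m := m) Δ hA hdet n
  have hcard : ∀ j, (Nat.card {Z // vecClass δ A j Z} : ℤ) = n j * ((Nat.card K : ℤ) ^ m - 1) :=
    card_vecClass Δ hA hdet hr hm0
  have hsymm := card_mul_excess Δ hA n hcard ε hε
  let s : Finset (Fin m → K) := Finset.univ.erase 0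
  have hs : ∀ X, X ∈ s ↔ X ≠ 0 := fun X => by simp [s]
  have hgen : ∀ ψ : (Fin m → K) →ₗ[K] (Fin (r + 1) → K), IsGenerator A ψ → ∀ j,
      ∑ i, ((s.filter fun X => vecClass δ A i (ψ X)).card : ℤ) * ε i j = 0 := by
    intro ψ hψ j
    rw [← sum_excess_generator Δ hA hm0 hψ (fun _ => vecClass_vecH) (n j) (hcard j) s hs]
    refine (sum_eq_sum_vecClass s ψ (fun X hX => ⟨fun h => (hs X).1 hX ?_, hψ.isotropic X X⟩) _
      (fun i => ε i j) (fun i Z h => hε i j Z h)).symm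
    exact hψ.inj (by rw [h, map_zero])
  have hfilter : ∀ (ψ : (Fin m → K) →ₗ[K] (Fin (r + 1) → K)) (i : Fin 4) (X : Fin m → K),
      vecClass δ A i (ψ X) → ((s.filter fun X => vecClass δ A i (ψ X)).card : ℤ) ≠ 0 := by
    intro ψ i X hX
    refine Nat.cast_ne_zero.2 (Finset.card_ne_zero_of_mem (a := X) ?_)
    refine Finset.mem_filter.2 ⟨(hs X).2 ?_, hX⟩
    rintro rfl
    exact (vecClass_homogeneous i).ne_zero _ hX (map_zero ψ)
  have hempty : ∀ (ψ : (Fin m → K) →ₗ[K] (Fin (r + 1) → K)) (i : Fin 4),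
      (∀ X, ¬ vecClass δ A i (ψ X)) → ((s.filter fun X => vecClass δ A i (ψ X)).card : ℤ) = 0 := by
    intro ψ i h
    rw [Finset.filter_false_of_mem fun X _ => h X]
    rfl
  obtain ⟨e, f, g, H⟩ := exists_frame Δ.two_ne hA hdet hr
  let i₀ : Fin m := ⟨0, hm0⟩
  have he0 : e i₀ ≠ 0 := by
    intro h
    have := H.ef i₀ i₀
    rw [h] at this
    simp at this
  -- This amounts to `(q + 1)(q^(r-1) - 1) = (q + 1)(q^(r-2) - 1) + (q² - 1) q^(r-2)`.
  have h00 : ε 0 0 = 0 := by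
    have hQ : vecClass δ A 0 (incl F K r (e i₀)) :=
      ⟨incl_ne_zero he0, 1, e i₀, (one_smul _ _).symm, H.ee _ _⟩
    rw [← hε 0 0 _ hQ, excess_eq _ (vecClass_iff_of hQ 0), if_pos rfl]
    have h := card_vecQ_perp Δ hA hdet hr hm0 (e i₀) he0 (H.ee _ _)
    change perpCount A (vecClass δ A 0) (incl F K r (e i₀)) = _ at h
    rw [h, hn]
    simp only
    rw [(tightParam_cast (odd_card Δ) (by omega)).1, card_pow_eq Δ, Δ.card]
    have h1 : (Nat.card F : ℤ) ^ (r - 1) = (Nat.card F : ℤ) ^ (2 * (m - 1)) * Nat.card F := by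
      rw [← pow_succ]; congr 1; omega
    rw [h1]
    push_cast
    ring
  -- An extended generator has vectors of classes `0` and `1` only, and some of class `1`; with `ε 0
  -- j = 0` the vanishing sum reduces to a nonzero multiple of `ε 1 j`.
  have hext : ∀ j, ε 0 j = 0 → ε 1 j = 0 := by
    intro j hj
    obtain ⟨X, hX0, hX⟩ := exists_vecO Δ hA H hr hm
    have h := hgen _ (extendedGenerator_isGenerator hA H hr) j
    rw [Fin.sum_univ_four, hj, hempty _ 2 fun X h =>
      h.2.1 (extendedGenerator_singular hA H X), hempty _ 3 fun X h =>
      h.2.1 (extendedGenerator_singular hA H X)] at h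
    have h1 := hfilter (extendedGenerator K e f g) 1 X hX
    exact (mul_eq_zero.1 (by simpa only [mul_zero, zero_mul, zero_add, add_zero] using h)).resolve_left h1
  -- In a mixed generator the contributions of classes `0` and `1` are already known to vanish, so
  -- the single further class `k` is isolated.
  have hmix : ∀ k : Fin 4, k = 2 ∨ k = 3 → ∀ j, ε 0 j = 0 → ε k j = 0 := by
    intro k hk j hj
    obtain ⟨ψ, hψ, ⟨X, hX⟩, h'⟩ := exists_mixed_isGenerator Δ hA hdet hr hm0 k hk
    have h := hgen ψ hψ j
    have h1 := hfilter ψ k X hX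
    rw [Fin.sum_univ_four, hj, hext j hj] at h
    rcases hk with rfl | rfl
    · rw [hempty ψ 3 fun X h => by rcases h' X 3 h with h | h | h <;> exact absurd h (by decide)] at h
      exact (mul_eq_zero.1 (by simpa only [mul_zero, zero_mul, zero_add, add_zero] using h)).resolve_left h1
    · rw [hempty ψ 2 fun X h => by rcases h' X 2 h with h | h | h <;> exact absurd h (by decide)] at h
      exact (mul_eq_zero.1 (by simpa only [mul_zero, zero_mul, zero_add, add_zero] using h)).resolve_left h1
  have hcol : ∀ j i, ε 0 j = 0 → ε i j = 0 := by
    intro j i hj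
    fin_cases i
    exacts [hj, hext j hj, hmix 2 (Or.inl rfl) j hj, hmix 3 (Or.inr rfl) j hj]
  -- Column `0` vanishes by `h00`; the weighted symmetry transfers this to row `0`, since class `0`
  -- is nonempty.
  have hrow : ∀ j, ε 0 j = 0 := by
    intro j
    have h := hsymm 0 j
    rw [hcol 0 j h00, mul_zero] at h
    refine (mul_eq_zero.1 h).resolve_left (Nat.cast_ne_zero.2 ?_)
    have : Nonempty {Z : Fin (r + 1) → K // vecClass δ A 0 Z} :=
      ⟨⟨incl F K r (e i₀), incl_ne_zero he0, 1, e i₀, (one_smul _ _).symm, H.ee _ _⟩⟩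
    exact Nat.card_pos.ne'
  obtain ⟨i, hi⟩ := exists_vecClass_iff (δ := δ) hZ
  rw [hε i j Z ((hi i).2 rfl)]
  exact hcol j i (hrow j)

-- With `r = 2 m`, the sum defining `theta` has `(2 m - 4) / 2 + 1 = m - 1` terms.
omit [Finite F] [Finite K] Δ in
theorem theta_mul (q m : ℕ) (hm : 2 ≤ m) :
    (theta ((2 * m - 4) / 2) (q ^ 2) : ℤ) * ((q : ℤ) ^ 2 - 1) = (q : ℤ) ^ (2 * (m - 1)) - 1 := by
  have h : (2 * m - 4) / 2 + 1 = m - 1 := by omega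
  rw [theta, h, pow_mul]
  push_cast
  exact geom_sum_mul ((q : ℤ) ^ 2) (m - 1)

/-- Zero excess is the tightness equation multiplied by `q² - 1`, the number of nonzero vectors on a
point over `K`. -/
theorem isTight_vecClass (hA : A.IsSymm) (hdet : A.det ≠ 0) (hr : r = 2 * m) (hm : 2 ≤ m)
    (j : Fin 4) :
    IsTight K A (tightParam (Nat.card F) r j) (pointsOf (vecClass δ A j)) := by
  refine ⟨?_, ?_⟩
  · rw [hermVariety_eq]
    exact fun P hP => vecClass_vecH hP
  · intro P hP
    rw [hermVariety_eq] at hP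
    have h0 := excess_eq_zero Δ hA hdet hr hm j P.rep hP
    have hp : Homogeneous (fun R : Fin (r + 1) → K =>
        vecClass δ A j R ∧ herm K A R P.rep = 0) :=
      ⟨fun Z h => (vecClass_homogeneous j).ne_zero Z h.1, fun c Z hc h =>
        ⟨(vecClass_homogeneous j).smul c Z hc h.1, by rw [herm_smul_left, h.2, mul_zero]⟩⟩
    have hset : hermPerp K A P ∩ pointsOf (vecClass δ A j) =
        pointsOf (fun R : Fin (r + 1) → K => vecClass δ A j R ∧ herm K A R P.rep = 0) :=
      Set.ext fun R => and_comm
    have h1 := card_homogeneous hp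
    rw [← hset] at h1
    have h2 : perpCount A (vecClass δ A j) P.rep =
        ((Nat.card F : ℤ) ^ 2 - 1) * (hermPerp K A P ∩ pointsOf (vecClass δ A j)).ncard := by
      rw [perpCount, h1, Nat.cast_mul, card_sub_one_cast, Δ.card]
      push_cast
      rfl
    have h3 := theta_mul (Nat.card F) m hm
    rw [← hr] at h3
    have h4 : (Nat.card F : ℤ) ^ 2 - 1 ≠ 0 := by
      have := one_lt_card (L := F)
      nlinarith
    have h5 : 2 * (m - 1) = r - 2 := by omega
    rw [excess, h2, card_pow_eq Δ, Δ.card, h5] at h0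
    rw [h5] at h3
    push_cast at h0
    constructor
    · intro h
      have h : vecClass δ A j P.rep := h
      rw [if_pos h] at h0
      zify
      refine mul_left_cancel₀ h4 ?_
      linear_combination h0 - (tightParam (Nat.card F) r j : ℤ) * h3
    · intro h
      have h : ¬ vecClass δ A j P.rep := h
      rw [if_neg h] at h0
      zify
      refine mul_left_cancel₀ h4 ?_
      linear_combination h0 - (tightParam (Nat.card F) r j : ℤ) * h3

theorem exists_vecClass (hA : A.IsSymm) (hdet : A.det ≠ 0) (hr : r = 2 * m) (hm : 2 ≤ m)
    (j : Fin 4) : ∃ Z, vecClass δ A j Z := by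
  have hm0 : 0 < m := by omega
  obtain ⟨e, f, g, H⟩ := exists_frame Δ.two_ne hA hdet hr
  fin_cases j
  · refine ⟨incl F K r (e ⟨0, hm0⟩), incl_ne_zero fun h => ?_, 1, _, (one_smul _ _).symm,
      H.ee _ _⟩
    have := H.ef ⟨0, hm0⟩ ⟨0, hm0⟩
    rw [h] at this
    simp at this
  · obtain ⟨X, -, hX⟩ := exists_vecO Δ hA H hr hm
    exact ⟨_, hX⟩
  · obtain ⟨ψ, -, ⟨X, hX⟩, -⟩ := exists_mixed_isGenerator Δ hA hdet hr hm0 2 (Or.inl rfl)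
    exact ⟨_, hX⟩
  · obtain ⟨ψ, -, ⟨X, hX⟩, -⟩ := exists_mixed_isGenerator Δ hA hdet hr hm0 3 (Or.inr rfl)
    exact ⟨_, hX⟩

theorem exists_mem_pointsOf (hA : A.IsSymm) (hdet : A.det ≠ 0) (hr : r = 2 * m) (hm : 2 ≤ m)
    (j : Fin 4) : ∃ P, P ∈ pointsOf (vecClass δ A j) := by
  obtain ⟨Z, hZ⟩ := exists_vecClass Δ hA hdet hr hm j
  exact ⟨_, (mk_mem_pointsOf (vecClass_homogeneous j) Z
    ((vecClass_homogeneous j).ne_zero Z hZ)).2 hZ⟩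

theorem orbits_eq_range (hA : A.IsSymm) (hdet : A.det ≠ 0) (hr : r = 2 * m) (hm : 2 ≤ m) :
    (fun P => MulAction.orbit (groupG K A) P) '' hermVariety K A =
      Set.range fun j => pointsOf (vecClass δ A j) := by
  have horb := fun j => orbit_eq_pointsOf (vecClass_homogeneous (δ := δ) (A := A) j)
    (vecClass_invariant Δ j) (vecClass_transitive Δ hA hdet j)
  ext X
  constructor
  · rintro ⟨P, hP, rfl⟩
    rw [hermVariety_eq] at hP
    obtain ⟨j, hj⟩ := exists_vecClass_iff (δ := δ) (Z := P.rep) hP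
    exact ⟨j, (horb j P ((hj j).2 rfl)).symm⟩
  · rintro ⟨j, rfl⟩
    obtain ⟨P, hP⟩ := exists_mem_pointsOf Δ hA hdet hr hm j
    refine ⟨P, ?_, horb j P hP⟩
    rw [hermVariety_eq]
    exact vecClass_vecH hP

theorem ncard_range_pointsOf (hA : A.IsSymm) (hdet : A.det ≠ 0) (hr : r = 2 * m) (hm : 2 ≤ m) :
    (Set.range fun j => pointsOf (vecClass δ A j)).ncard = 4 := by
  rw [← Set.image_univ, Set.ncard_image_of_injective, Set.ncard_univ, Nat.card_eq_fintype_card,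
    Fintype.card_fin]
  intro i j h
  obtain ⟨P, hP⟩ := exists_mem_pointsOf Δ hA hdet hr hm i
  have hP' : P ∈ pointsOf (vecClass δ A j) := by
    have h : pointsOf (vecClass δ A i) = pointsOf (vecClass δ A j) := h
    rwa [← h]
  exact (vecClass_iff_of (Z := P.rep) hP j).1 hP'

theorem range_pointsOf (hA : A.IsSymm) :
    (Set.range fun j => pointsOf (vecClass δ A j)) =
      {setQ K A, setO K A, setE K A, setS K A} := by
  rw [setQ_eq, setO_eq Δ hA, setE_eq Δ hA, setS_eq Δ hA]
  ext X
  simp only [Set.mem_range, Fin.exists_fin_succ, Set.mem_insert_iff, Set.mem_singleton_iff,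
    @eq_comm _ X]
  simp [vecClass]

end Main

end HermTight

end

theorem mainTheorem9 (q r : ℕ) (hq : Odd q) (hr4 : 4 ≤ r) (hr : Even r)
    (F K : Type*) [Field F] [Field K] [Algebra F K]
    (hF : Nat.card F = q) (hK : Nat.card K = q ^ 2)
    (A : Matrix (Fin (r + 1)) (Fin (r + 1)) F) (hA : A.IsSymm) (hdet : A.det ≠ 0) :
    ((fun P => MulAction.orbit (HermTight.groupG K A) P) '' HermTight.hermVariety K A =
        {HermTight.setQ K A, HermTight.setO K A, HermTight.setE K A, HermTight.setS K A} ∧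
      ({HermTight.setQ K A, HermTight.setO K A, HermTight.setE K A, HermTight.setS K A} :
        Set (Set (ℙ K (Fin (r + 1) → K)))).ncard = 4) ∧
    HermTight.IsTight K A (q + 1) (HermTight.setQ K A) ∧
    HermTight.IsTight K A (q ^ (r - 1) - q) (HermTight.setO K A) ∧
    HermTight.IsTight K A ((q ^ (r + 1) - q ^ (r - 1)) / 2) (HermTight.setE K A) ∧
    HermTight.IsTight K A ((q ^ (r + 1) - q ^ (r - 1)) / 2) (HermTight.setS K A) := by
  have : Finite F := Nat.finite_of_card_ne_zero (by rw [hF]; exact hq.pos.ne')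
  have : Finite K := Nat.finite_of_card_ne_zero (by rw [hK]; exact (pow_pos hq.pos 2).ne')
  have h2 : (2 : F) ≠ 0 := by
    let := Fintype.ofFinite F
    rw [Nat.card_eq_fintype_card] at hF
    refine Ring.two_ne_zero fun h => ?_
    have := FiniteField.even_card_of_char_two h
    rw [hF] at this
    rw [Nat.odd_iff] at hq
    omega
  subst hF
  obtain ⟨δ, d, Δ⟩ := HermTight.exists_quadExt (F := F) (K := K) h2 hK
  obtain ⟨m, hm⟩ := hr
  have hr2 : r = 2 * m := by omega
  have hm2 : 2 ≤ m := by omega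
  have htight := HermTight.isTight_vecClass Δ hA hdet hr2 hm2
  rw [← HermTight.range_pointsOf Δ hA]
  refine ⟨⟨HermTight.orbits_eq_range Δ hA hdet hr2 hm2,
    HermTight.ncard_range_pointsOf Δ hA hdet hr2 hm2⟩, ?_, ?_, ?_, ?_⟩
  · rw [HermTight.setQ_eq]; exact htight 0
  · rw [HermTight.setO_eq Δ hA]; exact htight 1
  · rw [HermTight.setE_eq Δ hA]; exact htight 2
  · rw [HermTight.setS_eq Δ hA]; exact htight 3
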